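/- Let $d\ge 1$, let $A=\{(i,j)\in\mathbb Z^2: i,j\ge 0,\ i+j\le d\}$, and let $\mathcal T$ be a unimodular triangulation of $A$, i.e. a triangulation of the triangle $d\cdot\Delta_2=\operatorname{conv}\{(0,0),(d,0),(0,d)\}$ with vertices in $A$, all of whose triangles have area $\tfrac12$; $\mathcal T$ need not be regular. Let $\eta(i,j)=(i+1)(j+1)\in\mathbb Z/2\mathbb Z$ for $(i,j)\in A$ be the Harnack sign distribution. Recall the patchworked curve $\mathcal C(\mathcal T,\eta)$. Reflect $\mathcal T$ at the coordinate axes to obtain a triangulation of the diamond $|x|+|y|\le d$, and extend the signs by $\eta(i,-j)=\eta(i,j)+j$, $\eta(-i,j)=\eta(i,j)+i$, $\eta(-i,-j)=\eta(i,j)+i+j$. Identifying antipodal points on the boundary of the diamond gives a cell decomposition $\mathcal S$ of $\mathbb{RP}^2$. The curve $\mathcal C(\mathcal T,\eta)\subset\mathbb{RP}^2$ is the subgraph of the dual graph of $\mathcal S$ that consists of the dual edges of those edges of $\mathcal S$ whose endpoints have distinct signs. Its connected components are called loops. A loop is an oval if it separates $\mathbb{RP}^2$ into a disk (its interior) and a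 Möbius strip, and a pseudo-line if it does not separate $\mathbb{RP}^2$. An oval is even (odd) if it lies in the interior of an even (odd) number of other ovals; $p$ and $n$ denote the numbers of even and odd ovals. The real scheme of the curve records its loops and the nesting of its ovals: $\langle k\rangle$ denotes $k$ ovals outside one another, $1\langle X\rangle$ an oval whose interior contains $X$, $X\sqcup Y$ two separable schemes, and $J$ a single pseudo-line. Then every loop of $\mathcal C(\mathcal T,\eta)$ is an oval or a pseudo-line, and $\mathcal C(\mathcal T,\eta)$ is an $M$-curve of degree $d$, i.e. it has exactly $\tfrac12(d-1)(d-2)+1$ loops. Moreover: - if $d=2k$ is even, its real scheme is $\left\langle \tfrac32(k^2-k)\sqcup 1\left\langle \tfrac12(k-1)(k-2)\right\rangle\right\rangle$, so that $p=\tfrac32(k^2-k)+1$ and $n=\tfrac12(k-1)(k-2)$; - if $d$ is odd, its real scheme is $\left\langle J\sqcup \tfrac12(d-1)(d-2)\right\rangle$, so that $(p,n)=\left(\tfrac12(d-1)(d-2),\,0\right)$. -/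

import Mathlib

namespace TCurve

/-! ### Lattice triangulations of the dilated triangle -/

/-- The lattice points `A = d·Δ₂ ∩ ℤ²`. -/
def latticePoints (d : ℕ) : Set (ℤ × ℤ) :=
  {v | 0 ≤ v.1 ∧ 0 ≤ v.2 ∧ v.1 + v.2 ≤ (d : ℤ)}

/-- The inclusion `ℤ² ⊆ ℝ²`. -/
def toPlane (v : ℤ × ℤ) : ℝ × ℝ := ((v.1 : ℝ), (v.2 : ℝ))

/-- The dilated triangle `d·Δ₂ = conv {(0,0), (d,0), (0,d)}`. -/
def dilatedTriangle (d : ℕ) : Set (ℝ × ℝ) :=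
  convexHull ℝ {((0 : ℝ), (0 : ℝ)), ((d : ℝ), (0 : ℝ)), ((0 : ℝ), (d : ℝ))}

/-- A triangulation of `A`: a geometric simplicial complex which covers exactly `d·Δ₂` and whose
vertices form a subset of `A`. No regularity is asked for. -/
structure Triangulation (d : ℕ) extends Geometry.SimplicialComplex ℝ (ℝ × ℝ) where
  /-- the simplices cover exactly the dilated triangle -/
  space_eq : toSimplicialComplex.space = dilatedTriangle d
  /-- all vertices are lattice points of the dilated triangle -/
  vertices_subset : toSimplicialComplex.vertices ⊆ toPlane '' latticePoints d

/-- The simplices of a triangulation (vertices, edges, triangles), written by their vertices in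
`ℤ²`. -/
def Triangulation.latticeFaces {d : ℕ} (T : Triangulation d) : Set (Finset (ℤ × ℤ)) :=
  {s | s.image toPlane ∈ T.faces}

/-- Twice the Euclidean area of the triangle with vertices `u`, `v`, `w`. -/
def twiceArea (u v w : ℤ × ℤ) : ℤ :=
  |(v.1 - u.1) * (w.2 - u.2) - (w.1 - u.1) * (v.2 - u.2)|

/-- A triangulation is unimodular if each of its triangles has Euclidean area `1/2`. -/
def Triangulation.IsUnimodular {d : ℕ} (T : Triangulation d) : Prop :=
  ∀ u v w : ℤ × ℤ, u ≠ v → v ≠ w → u ≠ w →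
    ({u, v, w} : Finset (ℤ × ℤ)) ∈ T.latticeFaces → twiceArea u v w = 1

/-! ### Sign distributions -/

/-- The extension of a sign distribution from `A` to the diamond `|i| + |j| ≤ d`:
`σ(i,-j) = σ(i,j) + j`, `σ(-i,j) = σ(i,j) + i`, `σ(-i,-j) = σ(i,j) + i + j` for `(i,j) ∈ A`.
Only the values of `σ` on `A` matter. -/
def extendSign (σ : ℤ × ℤ → ZMod 2) (v : ℤ × ℤ) : ZMod 2 :=
  σ (|v.1|, |v.2|) + (if v.1 < 0 then (v.1 : ZMod 2) else 0)
    + (if v.2 < 0 then (v.2 : ZMod 2) else 0)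

/-- The Harnack sign distribution `η(i,j) = (i+1)(j+1)`. -/
def harnackSign (v : ℤ × ℤ) : ZMod 2 := ((v.1 + 1) * (v.2 + 1) : ℤ)

/-! ### The cell decomposition of the real projective plane -/

/-- The reflection of the plane with signs `ε` at the coordinate axes. -/
def reflect (ε : ℤˣ × ℤˣ) (v : ℤ × ℤ) : ℤ × ℤ := ((ε.1 : ℤ) * v.1, (ε.2 : ℤ) * v.2)

/-- The simplices of the triangulation of the diamond: the union of the four reflected copies of
the triangulation. -/
def Triangulation.diamondFaces {d : ℕ} (T : Triangulation d) : Set (Finset (ℤ × ℤ)) :=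
  {s | ∃ ε : ℤˣ × ℤˣ, ∃ t ∈ T.latticeFaces, s = t.image (reflect ε)}

/-- The antipode of a finite point set. -/
def antipode (s : Finset (ℤ × ℤ)) : Finset (ℤ × ℤ) := s.image fun v => -v

/-- The antipodal identification on the boundary of the diamond, for simplices given by their
vertices: a simplex in the boundary `|i| + |j| = d` is identified with its antipode. -/
def antipodalSetoid (d : ℕ) : Setoid (Finset (ℤ × ℤ)) where
  r s t := s = t ∨ ((∀ v ∈ s, |v.1| + |v.2| = (d : ℤ)) ∧ t = antipode s)
  iseqv := by
    have hinv : ∀ s : Finset (ℤ × ℤ), antipode (antipode s) = s := by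
      intro s; simp [antipode, Finset.image_image]
    have hbd : ∀ s : Finset (ℤ × ℤ), (∀ v ∈ s, |v.1| + |v.2| = (d : ℤ)) →
        ∀ v ∈ antipode s, |v.1| + |v.2| = (d : ℤ) := by
      intro s hs v hv
      obtain ⟨w, hw, rfl⟩ := Finset.mem_image.1 hv
      simpa using hs w hw
    refine ⟨fun s => Or.inl rfl, ?_, ?_⟩
    · rintro s t (rfl | ⟨h, rfl⟩)
      · exact Or.inl rfl
      · exact Or.inr ⟨hbd s h, (hinv s).symm⟩
    · rintro s t u (rfl | ⟨h, rfl⟩) (rfl | ⟨h', rfl⟩)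
      · exact Or.inl rfl
      · exact Or.inr ⟨h', rfl⟩
      · exact Or.inr ⟨h, rfl⟩
      · exact Or.inl (hinv s).symm

/-- Simplices up to the antipodal identification. -/
abbrev Cell (d : ℕ) : Type := Quotient (antipodalSetoid d)

/-- The `n`-dimensional cells of the cell decomposition `S` of `ℝP²`. -/
def Triangulation.cells {d : ℕ} (T : Triangulation d) (n : ℕ) : Set (Cell d) :=
  {c | ∃ s ∈ T.diamondFaces, s.card = n + 1 ∧ c = Quotient.mk (antipodalSetoid d) s}

/-- The cell `a` of `S` is a face of the cell `b` of `S`. -/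
def Triangulation.IsFace {d : ℕ} (T : Triangulation d) (a b : Cell d) : Prop :=
  ∃ s ∈ T.diamondFaces, ∃ t ∈ T.diamondFaces, s ⊆ t ∧
    a = Quotient.mk (antipodalSetoid d) s ∧ b = Quotient.mk (antipodalSetoid d) t

/-! ### The patchworked curve and its loops -/

/-- The edges of `S` whose endpoints have distinct signs. (At the boundary of the diamond, the
endpoints of an edge have distinct signs if and only if those of the antipodal edge do.) -/
def bicoloredEdges {d : ℕ} (T : Triangulation d) (σ : ℤ × ℤ → ZMod 2) : Set (Cell d) :=
  {e | ∃ u v : ℤ × ℤ, ({u, v} : Finset (ℤ × ℤ)) ∈ T.diamondFaces ∧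
    extendSign σ u ≠ extendSign σ v ∧ e = Quotient.mk (antipodalSetoid d) {u, v}}

/-- The nodes of the patchworked curve: the triangles of `S` with a bicolored edge. -/
abbrev CurveNode {d : ℕ} (T : Triangulation d) (σ : ℤ × ℤ → ZMod 2) : Type :=
  {a : Cell d // a ∈ T.cells 2 ∧ ∃ e ∈ bicoloredEdges T σ, T.IsFace e a}

/-- The patchworked curve `C(T,σ)`: the subgraph of the dual graph of `S` which consists of the
dual edges of the bicolored edges of `S`. -/
def curve {d : ℕ} (T : Triangulation d) (σ : ℤ × ℤ → ZMod 2) : SimpleGraph (CurveNode T σ) where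
  Adj a b := a ≠ b ∧ ∃ e ∈ bicoloredEdges T σ, T.IsFace e a.1 ∧ T.IsFace e b.1
  symm := ⟨fun _ _ ⟨hne, e, he, ha, hb⟩ => ⟨hne.symm, e, he, hb, ha⟩⟩
  loopless := ⟨fun _ h => h.1 rfl⟩

/-- The loops of the patchworked curve: its connected components. -/
abbrev Loop {d : ℕ} (T : Triangulation d) (σ : ℤ × ℤ → ZMod 2) : Type :=
  (curve T σ).ConnectedComponent

/-- The edges of `S` which are crossed by the loop `L`. -/
def crossedEdges {d : ℕ} {T : Triangulation d} {σ : ℤ × ℤ → ZMod 2} (L : Loop T σ) :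
    Set (Cell d) :=
  {e | e ∈ bicoloredEdges T σ ∧ ∃ a ∈ L.supp, T.IsFace e a.1}

/-! ### Complement of a loop: ovals and pseudo-lines -/

/-- The `1`-skeleton of `S` without the edges crossed by the loop `L`. Every connected component of
`ℝP² ∖ L` contains a vertex of `S`, and two vertices of `S` lie in the same connected component of
`ℝP² ∖ L` if and only if they are connected in this graph. -/
def cutGraph {d : ℕ} {T : Triangulation d} {σ : ℤ × ℤ → ZMod 2} (L : Loop T σ) :
    SimpleGraph (T.cells 0) where
  Adj x y := x ≠ y ∧ ∃ e ∈ T.cells 1, e ∉ crossedEdges L ∧ T.IsFace x.1 e ∧ T.IsFace y.1 e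
  symm := ⟨fun _ _ ⟨hne, e, he, hL, hx, hy⟩ => ⟨hne.symm, e, he, hL, hy, hx⟩⟩
  loopless := ⟨fun _ h => h.1 rfl⟩

/-- The sides of the loop `L`: the connected components of `ℝP² ∖ L`. -/
abbrev Side {d : ℕ} {T : Triangulation d} {σ : ℤ × ℤ → ZMod 2} (L : Loop T σ) : Type :=
  (cutGraph L).ConnectedComponent

/-- The vertices of `S` which lie on the given side of a loop. -/
def sideVertices {d : ℕ} {T : Triangulation d} {σ : ℤ × ℤ → ZMod 2} {L : Loop T σ}
    (W : Side L) : Set (Cell d) :=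
  {c | ∃ x ∈ W.supp, c = x.1}

/-- The edges of `S` which lie on the given side of a loop and are not crossed by it. -/
def sideEdges {d : ℕ} {T : Triangulation d} {σ : ℤ × ℤ → ZMod 2} {L : Loop T σ}
    (W : Side L) : Set (Cell d) :=
  {e | e ∈ T.cells 1 ∧ e ∉ crossedEdges L ∧ ∃ x ∈ W.supp, T.IsFace x.1 e}

/-- The triangles of `S` which lie on the given side of a loop and are not crossed by it. -/
def sideTriangles {d : ℕ} {T : Triangulation d} {σ : ℤ × ℤ → ZMod 2} {L : Loop T σ}
    (W : Side L) : Set (Cell d) :=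
  {a | a ∈ T.cells 2 ∧ (∀ e ∈ crossedEdges L, ¬ T.IsFace e a) ∧ ∃ x ∈ W.supp, T.IsFace x.1 a}

/-- The Euler characteristic of a side of a loop. The cells of `S` which lie on the side and do
not meet the loop form a subcomplex, and the side retracts onto it. -/
noncomputable def eulerChar {d : ℕ} {T : Triangulation d} {σ : ℤ × ℤ → ZMod 2} {L : Loop T σ}
    (W : Side L) : ℤ :=
  ((sideVertices W).ncard : ℤ) - ((sideEdges W).ncard : ℤ) + ((sideTriangles W).ncard : ℤ)

/-- The side `W` of a loop which separates `ℝP²` is a disk. Each side of a separating loop is the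
interior of a compact connected surface in `ℝP²` with one boundary circle; such a surface is a disk
if and only if its Euler characteristic is `1`. -/
def IsDisk {d : ℕ} {T : Triangulation d} {σ : ℤ × ℤ → ZMod 2} {L : Loop T σ}
    (W : Side L) : Prop := eulerChar W = 1

/-- The side `W` of a loop which separates `ℝP²` is a Möbius strip: as before, this is recognized
by the Euler characteristic `0`. -/
def IsMoebius {d : ℕ} {T : Triangulation d} {σ : ℤ × ℤ → ZMod 2} {L : Loop T σ}
    (W : Side L) : Prop := eulerChar W = 0

/-- A loop is an oval if it separates `ℝP²` into exactly two components, a disk (the interior of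
the oval) and a Möbius strip. -/
def IsOval {d : ℕ} {T : Triangulation d} {σ : ℤ × ℤ → ZMod 2} (L : Loop T σ) : Prop :=
  ∃ D M : Side L, D ≠ M ∧ (∀ W : Side L, W = D ∨ W = M) ∧ IsDisk D ∧ IsMoebius M

/-- A loop is a pseudo-line if it does not separate `ℝP²`. -/
def IsPseudoLine {d : ℕ} {T : Triangulation d} {σ : ℤ × ℤ → ZMod 2} (L : Loop T σ) : Prop :=
  (cutGraph L).Connected

/-- The ovals of the patchworked curve. -/
abbrev Oval {d : ℕ} (T : Triangulation d) (σ : ℤ × ℤ → ZMod 2) : Type :=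
  {L : Loop T σ // IsOval L}

/-- The oval `P` lies in the interior of another oval `O`: all edges of `S` crossed by `P` have
their endpoints in the disk bounded by `O`. -/
def LiesInside {d : ℕ} {T : Triangulation d} {σ : ℤ × ℤ → ZMod 2} (P O : Oval T σ) : Prop :=
  P ≠ O ∧ ∃ D : Side O.1, IsDisk D ∧
    ∀ e ∈ crossedEdges P.1, ∀ x ∈ T.cells 0, T.IsFace x e → x ∈ sideVertices D

/-- An oval is even if it lies in the interior of an even number of other ovals. -/
def IsEvenOval {d : ℕ} {T : Triangulation d} {σ : ℤ × ℤ → ZMod 2} (P : Oval T σ) : Prop :=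
  Even (Nat.card {O : Oval T σ // LiesInside P O})

/-- The number `p` of even ovals. -/
noncomputable def numEvenOvals {d : ℕ} (T : Triangulation d) (σ : ℤ × ℤ → ZMod 2) : ℕ :=
  Nat.card {P : Oval T σ // IsEvenOval P}

/-- The number `n` of odd ovals. -/
noncomputable def numOddOvals {d : ℕ} (T : Triangulation d) (σ : ℤ × ℤ → ZMod 2) : ℕ :=
  Nat.card {P : Oval T σ // ¬ IsEvenOval P}

/-- An `M`-curve of degree `d` is a curve whose number of loops attains the Harnack bound
`(d-1)(d-2)/2 + 1`. -/
def IsMCurve {d : ℕ} (T : Triangulation d) (σ : ℤ × ℤ → ZMod 2) : Prop :=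
  Finite (Loop T σ) ∧
    (Nat.card (Loop T σ) : ℚ) = 1 / 2 * ((d : ℚ) - 1) * ((d : ℚ) - 2) + 1

/-! ### Real schemes in Rohlin–Viro notation -/

/-- Arrangements of ovals in Rohlin–Viro notation: the empty scheme `⟨0⟩`, an oval `⟨1⟨X⟩⟩` which
contains `X`, and the union `⟨X ⊔ Y⟩` of two separable schemes. -/
inductive OvalScheme : Type
  | zero : OvalScheme
  | nest : OvalScheme → OvalScheme
  | union : OvalScheme → OvalScheme → OvalScheme

/-- The set of ovals of an arrangement. -/
def OvalScheme.Ovals : OvalScheme → Type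
  | .zero => Empty
  | .nest X => Option X.Ovals
  | .union X Y => X.Ovals ⊕ Y.Ovals

/-- `X.Inside a b`: the oval `a` of the arrangement `X` lies in the interior of its oval `b`. In
`1⟨X⟩`, the outer oval is `none`. -/
def OvalScheme.Inside : (X : OvalScheme) → X.Ovals → X.Ovals → Prop
  | .zero => fun _ _ => False
  | .nest X => fun (a b : Option X.Ovals) =>
      match a, b with
      | none, _ => False
      | some _, none => True
      | some a', some b' => X.Inside a' b'
  | .union X Y => fun (a b : X.Ovals ⊕ Y.Ovals) =>
      match a, b with
      | .inl a', .inl b' => X.Inside a' b'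
      | .inr a', .inr b' => Y.Inside a' b'
      | _, _ => False

/-- `⟨k⟨X⟩⟩`: `k` disjoint ovals, each of which contains `X`. -/
def OvalScheme.copies : ℕ → OvalScheme → OvalScheme
  | 0, _ => .zero
  | k + 1, X => .union (.nest X) (OvalScheme.copies k X)

/-- `⟨k⟩ = ⟨k⟨0⟩⟩`. -/
def OvalScheme.empties (k : ℕ) : OvalScheme := OvalScheme.copies k .zero

/-- The real scheme of the patchworked curve is `⟨X⟩` (for `J = 0`) or `⟨J ⊔ X⟩` (for `J = 1`):
every loop is an oval or a pseudo-line, there are `J` pseudo-lines, and the ovals together with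
their nesting correspond to the arrangement `X`. -/
def HasRealScheme {d : ℕ} (T : Triangulation d) (σ : ℤ × ℤ → ZMod 2) (J : Fin 2)
    (X : OvalScheme) : Prop :=
  (∀ L : Loop T σ, IsOval L ∨ IsPseudoLine L) ∧
  {L : Loop T σ | IsPseudoLine L}.encard = (J : ℕ) ∧
  Nonempty ((LiesInside : Oval T σ → Oval T σ → Prop) ≃r X.Inside)

end TCurve

/-!
The idea is that the Harnack signs see only parities. In each of the four reflected copies of
`d·Δ₂`, the points of one parity class carry one sign and all other points carry the other sign; for
each of the four classes this happens in exactly one quadrant (`extendSign_reflect`). The copy of a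
lattice point `v` in the quadrant `quad v` of its class is called *isolated*. The vertices of a
unimodular triangle lie in three different classes (`eq_of_quad_eq`), so all neighbours of an
isolated point within its quadrant have the opposite sign, and a bicolored edge is an edge with an
isolated endpoint (`mem_bicoloredEdges_iff`). The nodes of the curve correspond to pairs of a
triangle and one of its vertices (`exists_eq_mkNode`, `mkNode_inj`).

The nodes at a fixed vertex `v` are connected, since the triangles at `v` form a chain
(`star_chain`). If `v` is an interior point of `d·Δ₂`, these nodes form a loop around the isolated
copy of `v`. The stars of two consecutive boundary points are linked through the boundary edge
between them, which lies in two quadrants, or in a quadrant and its opposite. Hence all boundary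
points belong to one further loop (`reachable_iff`). The number of loops is therefore one more than
the number `(d-1)(d-2)/2` of interior lattice points.

A loop around an interior point separates one vertex of `S` from all others (`sides_of_inner`). The
loop along the boundary cuts off the isolated copies of the boundary points. In each quadrant, the
remaining points are connected by edges (`connected_off`), and the three quadrants other than the
first are connected at the origin. If `d` is odd, the corner `(d, 0)` also connects the first
quadrant to them, so this loop is a pseudo-line (`isPseudoLine_of_odd`). If `d` is even, the points
of the first quadrant form a side of their own (`sides_of_outer`). It contains exactly the loops
around the interior points with two even coordinates, of which there are `(k-1)(k-2)/2` if
`d = 2k`.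

The Euler characteristics are found by double counting. Each edge of `S` lies in two triangles, and
a triangle has three uncrossed edges if the loop does not meet it and one otherwise. Together with
the number `d²` of triangles of the triangulation, obtained from areas (`ncard_triangles`), this
shows that the two sides of a separating loop have total Euler characteristic `1`
(`eulerChar_add_eulerChar`) and that the inner side of the boundary loop has Euler characteristic
`1`. Throughout, the triangulation may be irregular: only its local structure at vertices and edges
and its area are used.
-/

namespace TCurve

open Set

/-! ### Chains of closed sets -/

/-- If a preconnected set `K` is covered by finitely many closed sets, then any two of them that meet
`K` are joined by a chain of these sets in which consecutive ones meet within `K`, and hence are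
related by `r`. -/
theorem exists_chain_of_isPreconnected {X ι : Type*} [TopologicalSpace X] {K : Set X}
    (hK : IsPreconnected K) {I : Set ι} (hI : I.Finite) {C : ι → Set X}
    (hC : ∀ i ∈ I, IsClosed (C i)) (hcov : K ⊆ ⋃ i ∈ I, C i) {r : ι → ι → Prop}
    (hr : ∀ i ∈ I, ∀ j ∈ I, (K ∩ (C i ∩ C j)).Nonempty → r i j) {i j : ι} (hi : i ∈ I) (hj : j ∈ I)
    (hKi : (K ∩ C i).Nonempty) (hKj : (K ∩ C j).Nonempty) :
    Relation.ReflTransGen (fun a b => a ∈ I ∧ b ∈ I ∧ r a b) i j := by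
  set g : ι → ι → Prop := fun a b => a ∈ I ∧ b ∈ I ∧ r a b
  by_contra hij
  set R : Set ι := {k ∈ I | Relation.ReflTransGen g i k}
  set R' : Set ι := {k ∈ I | ¬ Relation.ReflTransGen g i k}
  have hR : R.Finite := hI.subset fun k hk => hk.1
  have hR' : R'.Finite := hI.subset fun k hk => hk.1
  have key := isPreconnected_closed_iff.1 hK (⋃ k ∈ R, C k) (⋃ k ∈ R', C k)
    (hR.isClosed_biUnion fun k hk => hC k hk.1) (hR'.isClosed_biUnion fun k hk => hC k hk.1)
    (by
      intro x hx
      obtain ⟨k, hk, hxk⟩ := mem_iUnion₂.1 (hcov hx)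
      by_cases h : Relation.ReflTransGen g i k
      · exact Or.inl (mem_iUnion₂.2 ⟨k, ⟨hk, h⟩, hxk⟩)
      · exact Or.inr (mem_iUnion₂.2 ⟨k, ⟨hk, h⟩, hxk⟩))
    (by
      obtain ⟨x, hx, hxi⟩ := hKi
      exact ⟨x, hx, mem_iUnion₂.2 ⟨i, ⟨hi, .refl⟩, hxi⟩⟩)
    (by
      obtain ⟨x, hx, hxj⟩ := hKj
      exact ⟨x, hx, mem_iUnion₂.2 ⟨j, ⟨hj, hij⟩, hxj⟩⟩)
  obtain ⟨x, hx, h1, h2⟩ := key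
  obtain ⟨k, hk, hxk⟩ := mem_iUnion₂.1 h1
  obtain ⟨l, hl, hxl⟩ := mem_iUnion₂.1 h2
  exact hl.2 (hk.2.tail ⟨hk.1, hl.1, hr k hk.1 l hl.1 ⟨x, hx, hxk, hxl⟩⟩)

/-- A convex subset of the plane which is not contained in a line stays preconnected after a point
is removed. -/
theorem isPreconnected_diff_singleton {K : Set (ℝ × ℝ)} (hK : Convex ℝ K) (v : ℝ × ℝ)
    (hdim : ∀ n : ℝ × ℝ, n ≠ 0 → ∃ p ∈ K, n.1 * (p.1 - v.1) + n.2 * (p.2 - v.2) ≠ 0) :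
    IsPreconnected (K \ {v}) := by
  have hseg : ∀ x ∈ K, ∀ y ∈ K, v ∉ segment ℝ x y → ∃ t ⊆ K \ {v}, x ∈ t ∧ y ∈ t ∧
      IsPreconnected t := fun x hx y hy hv =>
    ⟨segment ℝ x y, fun z hz => ⟨hK.segment_subset hx hy hz, fun h => hv (h ▸ hz)⟩,
      left_mem_segment ℝ x y, right_mem_segment ℝ x y, (convex_segment x y).isPreconnected⟩
  refine isPreconnected_of_forall_pair fun x hx y hy => ?_
  by_cases hv : v ∈ segment ℝ x y
  · obtain ⟨a, b, ha, hb, hab, hxy⟩ := hv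
    have hn : (-(x.2 - v.2), x.1 - v.1) ≠ (0 : ℝ × ℝ) := by
      intro h
      have h1 := congrArg Prod.fst h
      have h2 := congrArg Prod.snd h
      simp only [Prod.fst_zero, Prod.snd_zero] at h1 h2
      exact hx.2 (Prod.ext (by linarith) (by linarith))
    obtain ⟨p, hp, hpn⟩ := hdim _ hn
    simp only at hpn
    have e1 : a * x.1 + b * y.1 = v.1 := by simpa using congrArg Prod.fst hxy
    have e2 : a * x.2 + b * y.2 = v.2 := by simpa using congrArg Prod.snd hxy
    -- `p` lies off the line through `x`, `v`, `y`, so the detour through `p` avoids `v`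
    have hb0 : b ≠ 0 := by
      rintro rfl
      have : a = 1 := by linarith
      subst this
      exact hx.2 (Prod.ext (by linarith) (by linarith))
    have ha0 : a ≠ 0 := by
      rintro rfl
      have : b = 1 := by linarith
      subst this
      exact hy.2 (Prod.ext (by linarith) (by linarith))
    have f1 : b * (y.1 - v.1) = -a * (x.1 - v.1) := by linear_combination e1 - v.1 * hab
    have f2 : b * (y.2 - v.2) = -a * (x.2 - v.2) := by linear_combination e2 - v.2 * hab
    have hxp : v ∉ segment ℝ x p := by
      rintro ⟨α, β, hα, hβ, hαβ, h⟩
      have g1 : α * x.1 + β * p.1 = v.1 := by simpa using congrArg Prod.fst h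
      have g2 : α * x.2 + β * p.2 = v.2 := by simpa using congrArg Prod.snd h
      have : β * (-(x.2 - v.2) * (p.1 - v.1) + (x.1 - v.1) * (p.2 - v.2)) = 0 := by
        linear_combination (-(x.2 - v.2)) * g1 + (x.1 - v.1) * g2 +
          ((x.2 - v.2) * v.1 - (x.1 - v.1) * v.2) * hαβ
      have hβ0 : β = 0 := (mul_eq_zero.1 this).resolve_right hpn
      subst hβ0
      have : α = 1 := by linarith
      subst this
      exact hx.2 (Prod.ext (by linarith) (by linarith))
    have hpy : v ∉ segment ℝ p y := by
      rintro ⟨β, α, hβ, hα, hαβ, h⟩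
      have g1 : β * p.1 + α * y.1 = v.1 := by simpa using congrArg Prod.fst h
      have g2 : β * p.2 + α * y.2 = v.2 := by simpa using congrArg Prod.snd h
      have g1' : β * (p.1 - v.1) + α * (y.1 - v.1) = 0 := by linear_combination g1 - v.1 * hαβ
      have g2' : β * (p.2 - v.2) + α * (y.2 - v.2) = 0 := by linear_combination g2 - v.2 * hαβ
      have : b * β * (-(x.2 - v.2) * (p.1 - v.1) + (x.1 - v.1) * (p.2 - v.2)) = 0 := by
        linear_combination (-(x.2 - v.2)) * b * g1' + (x.1 - v.1) * b * g2' +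
          α * (x.2 - v.2) * f1 - α * (x.1 - v.1) * f2
      have hβ0 : β = 0 := by
        rcases mul_eq_zero.1 this with h | h
        · exact (mul_eq_zero.1 h).resolve_left hb0
        · exact absurd h hpn
      subst hβ0
      have : α = 1 := by linarith
      subst this
      exact hy.2 (Prod.ext (by linarith) (by linarith))
    obtain ⟨s, hs, hxs, hps, hsc⟩ := hseg x hx.1 p hp hxp
    obtain ⟨t, ht, hpt, hyt, htc⟩ := hseg p hp y hy.1 hpy
    exact ⟨s ∪ t, union_subset hs ht, Or.inl hxs, Or.inr hyt, hsc.union p hps hpt htc⟩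
  · exact hseg x hx.1 y hy.1 hv

/-! ### Convex hulls of lattice simplices -/

/-- The determinant of the triangle `u`, `v`, `w`: twice its signed area. -/
def orient (u v w : ℤ × ℤ) : ℤ :=
  (v.1 - u.1) * (w.2 - u.2) - (w.1 - u.1) * (v.2 - u.2)

/-- The convex hull of a finite set of lattice points. -/
def hull (s : Finset (ℤ × ℤ)) : Set (ℝ × ℝ) := convexHull ℝ (toPlane '' (s : Set (ℤ × ℤ)))

theorem toPlane_injective : Function.Injective toPlane := by
  rintro ⟨a, b⟩ ⟨c, e⟩ h
  simpa [toPlane] using h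

theorem hull_mono {s t : Finset (ℤ × ℤ)} (h : s ⊆ t) : hull s ⊆ hull t :=
  convexHull_mono (image_mono (by exact_mod_cast h))

theorem mem_hull_of_mem {s : Finset (ℤ × ℤ)} {v : ℤ × ℤ} (h : v ∈ s) : toPlane v ∈ hull s :=
  subset_convexHull ℝ _ ⟨v, h, rfl⟩

theorem isCompact_hull (s : Finset (ℤ × ℤ)) : IsCompact (hull s) :=
  (s.finite_toSet.image _).isCompact_convexHull (𝕜 := ℝ)

theorem isClosed_hull (s : Finset (ℤ × ℤ)) : IsClosed (hull s) := (isCompact_hull s).isClosed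

theorem convex_hull (s : Finset (ℤ × ℤ)) : Convex ℝ (hull s) := convex_convexHull ℝ _

theorem hull_empty : hull ∅ = ∅ := by simp [hull]

theorem hull_singleton (v : ℤ × ℤ) : hull {v} = {toPlane v} := by simp [hull]

theorem mem_hull_pair {u v : ℤ × ℤ} {p : ℝ × ℝ} : p ∈ hull {u, v} ↔
    ∃ a b : ℝ, 0 ≤ a ∧ 0 ≤ b ∧ a + b = 1 ∧ a * u.1 + b * v.1 = p.1 ∧ a * u.2 + b * v.2 = p.2 := by
  have : hull {u, v} = segment ℝ (toPlane u) (toPlane v) := by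
    simp [hull, image_pair, convexHull_pair]
  rw [this]
  constructor
  · rintro ⟨a, b, ha, hb, hab, rfl⟩
    exact ⟨a, b, ha, hb, hab, by simp [toPlane], by simp [toPlane]⟩
  · rintro ⟨a, b, ha, hb, hab, h1, h2⟩
    exact ⟨a, b, ha, hb, hab, Prod.ext (by simpa [toPlane] using h1) (by simpa [toPlane] using h2)⟩

theorem mem_hull_triple {u v w : ℤ × ℤ} {p : ℝ × ℝ} : p ∈ hull {u, v, w} ↔
    ∃ a b c : ℝ, 0 ≤ a ∧ 0 ≤ b ∧ 0 ≤ c ∧ a + b + c = 1 ∧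
      a * u.1 + b * v.1 + c * w.1 = p.1 ∧ a * u.2 + b * v.2 + c * w.2 = p.2 := by
  have : hull {u, v, w} = convexHull ℝ {toPlane u, toPlane v, toPlane w} := by
    simp [hull, image_insert_eq]
  rw [this, convexHull_insert (Set.insert_nonempty _ _), convexHull_pair]
  simp only [mem_convexJoin, mem_singleton_iff, exists_eq_left]
  constructor
  · rintro ⟨q, ⟨b, c, hb, hc, hbc, rfl⟩, ⟨s, t, hs, ht, hst, rfl⟩⟩
    refine ⟨s, t * b, t * c, hs, by positivity, by positivity, ?_, ?_, ?_⟩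
    · linear_combination hst + t * hbc
    · simp [toPlane]; ring
    · simp [toPlane]; ring
  · rintro ⟨a, b, c, ha, hb, hc, habc, h1, h2⟩
    by_cases h : b + c = 0
    · have hb0 : b = 0 := by linarith
      have hc0 : c = 0 := by linarith
      subst hb0 hc0
      have : a = 1 := by linarith
      subst this
      refine ⟨toPlane v, left_mem_segment ℝ _ _, 1, 0, by norm_num, le_rfl, by norm_num, ?_⟩
      exact Prod.ext (by simpa [toPlane] using h1) (by simpa [toPlane] using h2)
    · refine ⟨(b / (b + c)) • toPlane v + (c / (b + c)) • toPlane w,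
        ⟨b / (b + c), c / (b + c), by positivity, by positivity, by field_simp, rfl⟩,
        a, b + c, ha, by positivity, by linarith, ?_⟩
      rw [smul_add, smul_smul, smul_smul, mul_div_cancel₀ _ h, mul_div_cancel₀ _ h]
      exact Prod.ext (by simp [toPlane]; linarith) (by simp [toPlane]; linarith)

theorem mem_dilatedTriangle {d : ℕ} {p : ℝ × ℝ} :
    p ∈ dilatedTriangle d ↔ 0 ≤ p.1 ∧ 0 ≤ p.2 ∧ p.1 + p.2 ≤ d := by
  have h0 : dilatedTriangle d = hull {(0, 0), ((d : ℤ), 0), (0, (d : ℤ))} := by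
    simp [dilatedTriangle, hull, image_insert_eq, toPlane]
  rw [h0, mem_hull_triple]
  constructor
  · rintro ⟨a, b, c, ha, hb, hc, habc, h1, h2⟩
    simp only [Int.cast_zero, mul_zero, zero_add, add_zero, Int.cast_natCast] at h1 h2
    have hd : (0 : ℝ) ≤ d := by positivity
    refine ⟨by rw [← h1]; positivity, by rw [← h2]; positivity, ?_⟩
    rw [← h1, ← h2]
    nlinarith
  · rintro ⟨h1, h2, h3⟩
    rcases Nat.eq_zero_or_pos d with rfl | hd
    · simp only [Nat.cast_zero] at h3
      exact ⟨1, 0, 0, by norm_num, le_rfl, le_rfl, by norm_num, by simp; linarith,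
        by simp; linarith⟩
    · have hd : (0 : ℝ) < d := by exact_mod_cast hd
      refine ⟨1 - (p.1 + p.2) / d, p.1 / d, p.2 / d, ?_, by positivity, by positivity, ?_, ?_, ?_⟩
      · rw [sub_nonneg, div_le_one hd]; exact h3
      · field_simp; ring
      · simp; field_simp
      · simp; field_simp

theorem toPlane_mem_dilatedTriangle {d : ℕ} {v : ℤ × ℤ} (hv : v ∈ latticePoints d) :
    toPlane v ∈ dilatedTriangle d := by
  obtain ⟨h1, h2, h3⟩ := hv
  refine mem_dilatedTriangle.2 ⟨by simpa [toPlane] using h1, by simpa [toPlane] using h2, ?_⟩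
  simp only [toPlane]
  exact_mod_cast h3

theorem convex_dilatedTriangle (d : ℕ) : Convex ℝ (dilatedTriangle d) := convex_convexHull ℝ _

theorem latticePoints_finite (d : ℕ) : (latticePoints d).Finite :=
  ((Set.finite_Icc (0 : ℤ) d).prod (Set.finite_Icc (0 : ℤ) d)).subset fun v ⟨h1, h2, h3⟩ =>
    ⟨⟨h1, by linarith⟩, ⟨h2, by linarith⟩⟩

/-- A convex hull of at most two points of the plane has area zero. -/
theorem volume_hull_eq_zero {s : Finset (ℤ × ℤ)} (hs : s.card ≤ 2) :
    MeasureTheory.volume (hull s) = 0 := by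
  rcases s.eq_empty_or_nonempty with rfl | hne
  · simp [hull_empty]
  refine MeasureTheory.measure_mono_null (convexHull_subset_affineSpan _)
    (MeasureTheory.Measure.addHaar_affineSubspace _ _ fun htop => ?_)
  have h1 := congrArg AffineSubspace.direction htop
  rw [direction_affineSpan, AffineSubspace.direction_top] at h1
  have hc : s.card = s.card - 1 + 1 := by have := hne.card_pos; omega
  have h2 := finrank_vectorSpan_image_finset_le ℝ toPlane s hc
  have h3 : vectorSpan ℝ (↑(s.image toPlane) : Set (ℝ × ℝ)) = ⊤ := by
    rw [Finset.coe_image]; exact h1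
  rw [h3, finrank_top, Module.finrank_prod, Module.finrank_self] at h2
  omega

/-! ### Faces of a triangulation -/

section Faces

variable {d : ℕ} (T : Triangulation d)

/-- The triangles of a triangulation, by their vertices. -/
def Triangulation.triangles : Set (Finset (ℤ × ℤ)) := {t ∈ T.latticeFaces | t.card = 3}

variable {T}

theorem latticeFaces_nonempty {s : Finset (ℤ × ℤ)} (hs : s ∈ T.latticeFaces) : s.Nonempty :=
  Finset.image_nonempty.1 (T.toSimplicialComplex.nonempty_of_mem_faces hs)

theorem latticeFaces_down {s t : Finset (ℤ × ℤ)} (ht : t ∈ T.latticeFaces) (h : s ⊆ t)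
    (hs : s.Nonempty) : s ∈ T.latticeFaces :=
  T.toSimplicialComplex.down_closed ht (Finset.image_subset_image h) (hs.image _)

theorem mem_latticePoints_of_mem {s : Finset (ℤ × ℤ)} (hs : s ∈ T.latticeFaces) {v : ℤ × ℤ}
    (hv : v ∈ s) : v ∈ latticePoints d := by
  have h : {v} ∈ T.latticeFaces :=
    latticeFaces_down hs (Finset.singleton_subset_iff.2 hv) (Finset.singleton_nonempty v)
  have h' : toPlane v ∈ T.toSimplicialComplex.vertices := by
    simpa [Triangulation.latticeFaces, Geometry.SimplicialComplex.vertices] using h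
  obtain ⟨w, hw, hwv⟩ := T.vertices_subset h'
  exact toPlane_injective hwv ▸ hw

variable (T) in
theorem latticeFaces_finite : T.latticeFaces.Finite := by
  refine ((latticePoints_finite d).toFinset.powerset.finite_toSet).subset fun s hs => ?_
  rw [Finset.mem_coe, Finset.mem_powerset]
  exact fun v hv => (latticePoints_finite d).mem_toFinset.2 (mem_latticePoints_of_mem hs hv)

variable (T) in
theorem triangles_finite : T.triangles.Finite := (latticeFaces_finite T).subset fun _ h => h.1

theorem hull_inter_subset {s t : Finset (ℤ × ℤ)} (hs : s ∈ T.latticeFaces)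
    (ht : t ∈ T.latticeFaces) : hull s ∩ hull t ⊆ hull (s ∩ t) := by
  have := T.toSimplicialComplex.inter_subset_convexHull hs ht
  rw [Finset.coe_image, Finset.coe_image, ← image_inter toPlane_injective] at this
  simpa [hull] using this

theorem hull_subset_dilatedTriangle {s : Finset (ℤ × ℤ)} (hs : s ∈ T.latticeFaces) :
    hull s ⊆ dilatedTriangle d := by
  refine convexHull_min ?_ (convex_dilatedTriangle d)
  rintro _ ⟨v, hv, rfl⟩
  exact toPlane_mem_dilatedTriangle (mem_latticePoints_of_mem hs hv)

variable (T) in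
theorem exists_latticeFace_of_mem {p : ℝ × ℝ} (hp : p ∈ dilatedTriangle d) :
    ∃ s ∈ T.latticeFaces, p ∈ hull s := by
  rw [← T.space_eq, Geometry.SimplicialComplex.mem_space_iff] at hp
  obtain ⟨S, hS, hpS⟩ := hp
  have hsub : (S : Set (ℝ × ℝ)) ⊆ toPlane '' latticePoints d := fun x hx =>
    T.vertices_subset (T.toSimplicialComplex.down_closed hS
      (Finset.singleton_subset_iff.2 hx) (Finset.singleton_nonempty x))
  obtain ⟨s, -, rfl⟩ := Finset.subset_set_image_iff.1 hsub
  exact ⟨s, hS, by simpa [hull] using hpS⟩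

theorem card_le_three {s : Finset (ℤ × ℤ)} (hs : s ∈ T.latticeFaces) : s.card ≤ 3 := by
  have h := (T.toSimplicialComplex.indep hs).card_le_finrank_succ
  rw [Fintype.card_coe, Finset.card_image_of_injective _ toPlane_injective] at h
  have h2 := Submodule.finrank_le (vectorSpan ℝ (Set.range
    (Subtype.val : {x // x ∈ s.image toPlane} → ℝ × ℝ)))
  rw [Module.finrank_prod, Module.finrank_self] at h2
  omega

theorem ne_of_card_triple {α : Type*} [DecidableEq α] {u v w : α}
    (h : ({u, v, w} : Finset α).card = 3) : u ≠ v ∧ v ≠ w ∧ u ≠ w := by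
  have h2 : ∀ a b : α, ({a, b} : Finset α).card ≤ 2 := fun _ _ => Finset.card_le_two
  refine ⟨?_, ?_, ?_⟩ <;> rintro rfl
  · have := h2 u w; simp_all
  · have := h2 u v; simp_all
  · have := h2 v u
    rw [Finset.insert_comm] at h
    simp_all

theorem orient_of_mem (hT : T.IsUnimodular) {u v w : ℤ × ℤ} (h : {u, v, w} ∈ T.triangles) :
    orient u v w = 1 ∨ orient u v w = -1 := by
  obtain ⟨h1, h2, h3⟩ := ne_of_card_triple h.2
  have := hT u v w h1 h2 h3 h.1
  exact (abs_eq one_pos.le).1 this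

end Faces

/-! ### Barycentric coordinates in unimodular triangles -/

/-- In a unimodular triangle, the barycentric coordinates of a point of `(1/N)ℤ²` lie in
`(1/N)ℤ`. -/
theorem exists_int_barycentric {u v w x : ℤ × ℤ} {N : ℤ} {a b c : ℝ}
    (hD : orient u v w = 1 ∨ orient u v w = -1) (habc : a + b + c = 1)
    (h1 : N * (a * u.1 + b * v.1 + c * w.1) = x.1)
    (h2 : N * (a * u.2 + b * v.2 + c * w.2) = x.2) :
    ∃ A B C : ℤ, N * a = A ∧ N * b = B ∧ N * c = C := by
  have hD2 : ((orient u v w : ℤ) : ℝ) * (orient u v w : ℤ) = 1 := by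
    rcases hD with h | h <;> rw [h] <;> norm_num
  set D := orient u v w with hDdef
  have hDr : (D : ℝ) = ((v.1 : ℝ) - u.1) * (w.2 - u.2) - (w.1 - u.1) * (v.2 - u.2) := by
    rw [hDdef, orient]; push_cast; ring
  have g1 : (x.1 : ℝ) - N * u.1 = N * (b * (v.1 - u.1) + c * (w.1 - u.1)) := by
    linear_combination -h1 + N * u.1 * habc
  have g2 : (x.2 : ℝ) - N * u.2 = N * (b * (v.2 - u.2) + c * (w.2 - u.2)) := by
    linear_combination -h2 + N * u.2 * habc
  have hB : N * b = ((D * ((x.1 - N * u.1) * (w.2 - u.2) - (w.1 - u.1) * (x.2 - N * u.2)) : ℤ)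
      : ℝ) := by
    push_cast
    rw [g1, g2]
    have : (N : ℝ) * b = (D * D) * (N * b) := by rw [hD2, one_mul]
    rw [this]
    nth_rewrite 2 [hDr]
    ring
  have hC : N * c = ((D * ((v.1 - u.1) * (x.2 - N * u.2) - (x.1 - N * u.1) * (v.2 - u.2)) : ℤ)
      : ℝ) := by
    push_cast
    rw [g1, g2]
    have : (N : ℝ) * c = (D * D) * (N * c) := by rw [hD2, one_mul]
    rw [this]
    nth_rewrite 2 [hDr]
    ring
  obtain ⟨B, hB⟩ : ∃ B : ℤ, N * b = B := ⟨_, hB⟩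
  obtain ⟨C, hC⟩ : ∃ C : ℤ, N * c = C := ⟨_, hC⟩
  refine ⟨N - B - C, B, C, ?_, hB, hC⟩
  rw [Int.cast_sub, Int.cast_sub, ← hB, ← hC]
  linear_combination N * habc

/-- The midpoint of two lattice points. -/
noncomputable def mid (u w : ℤ × ℤ) : ℝ × ℝ := (((u.1 : ℝ) + w.1) / 2, ((u.2 : ℝ) + w.2) / 2)

theorem mid_mem_hull (u w : ℤ × ℤ) : mid u w ∈ hull {u, w} :=
  mem_hull_pair.2 ⟨1 / 2, 1 / 2, by norm_num, by norm_num, by norm_num, by simp [mid]; ring,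
    by simp [mid]; ring⟩

theorem mid_ne_left {u w : ℤ × ℤ} (h : u ≠ w) : mid u w ≠ toPlane u := by
  intro hm
  apply h
  have h1 := congrArg Prod.fst hm
  have h2 := congrArg Prod.snd hm
  simp only [mid, toPlane] at h1 h2
  have h1 : (w.1 : ℝ) = u.1 := by linarith
  have h2 : (w.2 : ℝ) = u.2 := by linarith
  exact Prod.ext (by exact_mod_cast h1.symm) (by exact_mod_cast h2.symm)

theorem mid_comm (u w : ℤ × ℤ) : mid u w = mid w u := by
  simp only [mid, add_comm]

section Pure

open Filter Topology

variable {d : ℕ} {T : Triangulation d}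

theorem exists_eq_triple {t : Finset (ℤ × ℤ)} (ht : t ∈ T.triangles) :
    ∃ u v w, t = {u, v, w} := by
  obtain ⟨u, v, w, -, -, -, h⟩ := Finset.card_eq_three.1 ht.2
  exact ⟨u, v, w, h⟩

/-- The only lattice points in a unimodular triangle are its vertices. -/
theorem mem_of_toPlane_mem_hull (hT : T.IsUnimodular) {t : Finset (ℤ × ℤ)} (ht : t ∈ T.triangles)
    {x : ℤ × ℤ} (hx : toPlane x ∈ hull t) : x ∈ t := by
  obtain ⟨u, v, w, rfl⟩ := exists_eq_triple ht
  obtain ⟨a, b, c, ha, hb, hc, habc, h1, h2⟩ := mem_hull_triple.1 hx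
  simp only [toPlane] at h1 h2
  obtain ⟨A, B, C, hA, hB, hC⟩ := exists_int_barycentric (N := 1) (x := x) (orient_of_mem hT ht)
    habc (by rw [h1]; simp) (by rw [h2]; simp)
  simp only [Int.cast_one, one_mul] at hA hB hC
  subst hA hB hC
  have ha : 0 ≤ A := by exact_mod_cast ha
  have hb : 0 ≤ B := by exact_mod_cast hb
  have hc : 0 ≤ C := by exact_mod_cast hc
  have h1 : A * u.1 + B * v.1 + C * w.1 = x.1 := by exact_mod_cast h1
  have h2 : A * u.2 + B * v.2 + C * w.2 = x.2 := by exact_mod_cast h2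
  have hs : A + B + C = 1 := by exact_mod_cast habc
  have : (A = 1 ∧ B = 0 ∧ C = 0) ∨ (A = 0 ∧ B = 1 ∧ C = 0) ∨ (A = 0 ∧ B = 0 ∧ C = 1) := by omega
  simp only [Finset.mem_insert, Finset.mem_singleton]
  rcases this with ⟨rfl, rfl, rfl⟩ | ⟨rfl, rfl, rfl⟩ | ⟨rfl, rfl, rfl⟩
  · left; ext <;> simp_all
  · right; left; ext <;> simp_all
  · right; right; ext <;> simp_all

theorem interior_nonempty (hd : 1 ≤ d) : (interior (dilatedTriangle d)).Nonempty := by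
  have hd' : (1 : ℝ) ≤ d := by exact_mod_cast hd
  refine ⟨(1 / 3, 1 / 3), mem_interior.2 ⟨{p | 0 < p.1 ∧ 0 < p.2 ∧ p.1 + p.2 < d},
    fun p hp => mem_dilatedTriangle.2 ⟨hp.1.le, hp.2.1.le, hp.2.2.le⟩, ?_, ?_⟩⟩
  · exact (isOpen_lt continuous_const continuous_fst).inter
      ((isOpen_lt continuous_const continuous_snd).inter
        (isOpen_lt (continuous_fst.add continuous_snd) continuous_const))
  · simp only [mem_ofPred_eq]
    refine ⟨by norm_num, by norm_num, by linarith⟩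

variable (T) in
/-- The triangles cover the dilated triangle: the lower-dimensional faces have area zero, hence
cannot contain a relatively open part of it. -/
theorem exists_triangle_mem_hull (hd : 1 ≤ d) {p : ℝ × ℝ} (hp : p ∈ dilatedTriangle d) :
    ∃ t ∈ T.triangles, p ∈ hull t := by
  by_contra! hcon
  set Z := ⋃ t ∈ T.triangles, hull t
  have hZ : IsClosed Z := (triangles_finite T).isClosed_biUnion fun t _ => isClosed_hull t
  have hpZ : p ∈ Zᶜ := by
    intro h
    obtain ⟨t, ht, hpt⟩ := mem_iUnion₂.1 h
    exact hcon t ht hpt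
  have hcl : p ∈ closure (interior (dilatedTriangle d)) := by
    rw [(convex_dilatedTriangle d).closure_interior_eq_closure_of_nonempty_interior
      (interior_nonempty hd)]
    exact subset_closure hp
  have hne : (Zᶜ ∩ interior (dilatedTriangle d)).Nonempty :=
    mem_closure_iff.1 hcl _ hZ.isOpen_compl hpZ
  have hpos := (hZ.isOpen_compl.inter isOpen_interior).measure_pos MeasureTheory.volume hne
  refine hpos.ne' (MeasureTheory.measure_mono_null
    (t := ⋃ s ∈ {s ∈ T.latticeFaces | s.card ≤ 2}, hull s) ?_ ?_)
  · rintro q ⟨hqZ, hq⟩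
    obtain ⟨s, hs, hqs⟩ := exists_latticeFace_of_mem T (interior_subset hq)
    refine mem_iUnion₂.2 ⟨s, ⟨hs, ?_⟩, hqs⟩
    by_contra hc
    exact hqZ (mem_iUnion₂.2 ⟨s, ⟨hs, by have := card_le_three hs; omega⟩, hqs⟩)
  · rw [MeasureTheory.measure_biUnion_null_iff
      ((latticeFaces_finite T).subset fun s hs => hs.1).countable]
    exact fun s hs => volume_hull_eq_zero hs.2

variable (T) in
/-- The triangles which contain points sufficiently close to `p` contain `p`. -/
theorem eventually_mem_hull (p : ℝ × ℝ) :
    ∀ᶠ q in 𝓝 p, ∀ t ∈ T.triangles, q ∈ hull t → p ∈ hull t := by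
  rw [eventually_all_finite (triangles_finite T)]
  intro t _
  by_cases h : p ∈ hull t
  · exact Eventually.of_forall fun _ _ => h
  · filter_upwards [(isClosed_hull t).isOpen_compl.mem_nhds h] with q hq hqt
    exact absurd hqt hq

/-- A face which contains the midpoint of an edge contains the edge. -/
theorem pair_subset_of_mid_mem_hull {u w : ℤ × ℤ} (huw : u ≠ w) (he : {u, w} ∈ T.latticeFaces)
    {t : Finset (ℤ × ℤ)} (ht : t ∈ T.latticeFaces) (hm : mid u w ∈ hull t) : {u, w} ⊆ t := by
  have h := hull_inter_subset he ht ⟨mid_mem_hull u w, hm⟩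
  by_contra hsub
  have : u ∉ t ∨ w ∉ t := by
    by_contra! hc
    exact hsub (by simp [Finset.insert_subset_iff, hc.1, hc.2])
  rcases this with hu | hw
  · have h' := hull_mono (t := {w}) (by grind) h
    rw [hull_singleton, mid_comm] at h'
    exact mid_ne_left huw.symm h'
  · have h' := hull_mono (t := {u}) (by grind) h
    rw [hull_singleton] at h'
    exact mid_ne_left huw h'

theorem exists_triangle_of_vertex (hd : 1 ≤ d) (hT : T.IsUnimodular) {v : ℤ × ℤ}
    (hv : v ∈ latticePoints d) : ∃ t ∈ T.triangles, v ∈ t := by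
  obtain ⟨t, ht, h⟩ := exists_triangle_mem_hull T hd (toPlane_mem_dilatedTriangle hv)
  exact ⟨t, ht, mem_of_toPlane_mem_hull hT ht h⟩

theorem exists_triangle_of_face (hd : 1 ≤ d) (hT : T.IsUnimodular) {s : Finset (ℤ × ℤ)}
    (hs : s ∈ T.latticeFaces) : ∃ t ∈ T.triangles, s ⊆ t := by
  have h1 := (latticeFaces_nonempty hs).card_pos
  have h3 := card_le_three hs
  have : s.card = 1 ∨ s.card = 2 ∨ s.card = 3 := by omega
  rcases this with h | h | h
  · obtain ⟨v, rfl⟩ := Finset.card_eq_one.1 h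
    obtain ⟨t, ht, hv⟩ := exists_triangle_of_vertex hd hT
      (mem_latticePoints_of_mem hs (Finset.mem_singleton_self v))
    exact ⟨t, ht, Finset.singleton_subset_iff.2 hv⟩
  · obtain ⟨u, w, huw, rfl⟩ := Finset.card_eq_two.1 h
    obtain ⟨t, ht, hm⟩ := exists_triangle_mem_hull T hd
      (hull_subset_dilatedTriangle hs (mid_mem_hull u w))
    exact ⟨t, ht, pair_subset_of_mid_mem_hull huw hs ht.1 hm⟩
  · exact ⟨s, ⟨hs, h⟩, Finset.Subset.rfl⟩

theorem exists_third {t : Finset (ℤ × ℤ)} (ht : t ∈ T.triangles) {x y : ℤ × ℤ} (hx : x ∈ t)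
    (hy : y ∈ t) (hxy : x ≠ y) : ∃ z, t = {x, y, z} ∧ z ≠ x ∧ z ≠ y := by
  obtain ⟨z, hz⟩ : ∃ z, t \ {x, y} = {z} := by
    rw [← Finset.card_eq_one, Finset.card_sdiff_of_subset (by grind), ht.2,
      Finset.card_pair hxy]
  have hteq : t = {x, y, z} := by
    have : t = t \ {x, y} ∪ {x, y} := (Finset.sdiff_union_of_subset (by grind)).symm
    rw [this, hz]
    grind
  exact ⟨z, hteq, by grind, by grind⟩

/-- The parity class of a lattice point, encoded as a quadrant: the quadrant in which, for the
Harnack signs, the copies of this class have a sign different from that of all other points. Hence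
the copy of `v` in quadrant `q` is called *isolated* if `quad v = q`. -/
def quad (v : ℤ × ℤ) : ℤˣ × ℤˣ := (v.2.negOnePow, v.1.negOnePow)

theorem quad_eq_iff {u v : ℤ × ℤ} : quad u = quad v ↔ Even (u.1 - v.1) ∧ Even (u.2 - v.2) := by
  rw [quad, quad, Prod.mk.injEq, Int.negOnePow_eq_iff, Int.negOnePow_eq_iff, and_comm]

/-- The vertices of a unimodular triangle lie in three different parity classes. -/
theorem eq_of_quad_eq (hT : T.IsUnimodular) {t : Finset (ℤ × ℤ)} (ht : t ∈ T.triangles)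
    {x y : ℤ × ℤ} (hx : x ∈ t) (hy : y ∈ t) (h : quad x = quad y) : x = y := by
  by_contra hxy
  obtain ⟨z, rfl, -, -⟩ := exists_third ht hx hy hxy
  obtain ⟨⟨k, hk⟩, ⟨l, hl⟩⟩ := quad_eq_iff.1 h
  have e1 : y.1 - x.1 = -2 * k := by omega
  have e2 : y.2 - x.2 = -2 * l := by omega
  have := orient_of_mem hT ht
  rw [orient, e1, e2] at this
  have h2 : 2 * (-k * (z.2 - x.2) + (z.1 - x.1) * l) = 1 ∨
    2 * (-k * (z.2 - x.2) + (z.1 - x.1) * l) = -1 := by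
    rcases this with h | h
    · left; linarith
    · right; linarith
  omega

end Pure

section Local

open Filter Topology

variable {d : ℕ} {T : Triangulation d}

/-! ### The triangles at an edge -/

/-- The edge `{u, w}` of `d·Δ₂` lies in one of the three sides. -/
def IsBoundaryEdge (d : ℕ) (u w : ℤ × ℤ) : Prop :=
  (u.1 = 0 ∧ w.1 = 0) ∨ (u.2 = 0 ∧ w.2 = 0) ∨ (u.1 + u.2 = d ∧ w.1 + w.2 = d)

theorem IsBoundaryEdge.symm {u w : ℤ × ℤ} (h : IsBoundaryEdge d u w) : IsBoundaryEdge d w u := by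
  unfold IsBoundaryEdge at *; tauto

/-- Two triangles of the triangulation whose third vertices differ by a positive multiple of their
common edge overlap. -/
theorem not_add_smul_third (hT : T.IsUnimodular) {u w a b : ℤ × ℤ} (ha : {u, w, a} ∈ T.triangles)
    (hb : {u, w, b} ∈ T.triangles) {k : ℤ} (hk : 1 ≤ k) (h1 : a.1 = b.1 + k * (w.1 - u.1))
    (h2 : a.2 = b.2 + k * (w.2 - u.2)) : False := by
  have hab : a ≠ b := by
    rintro rfl
    have hw := (ne_of_card_triple ha.2).1
    have e1 : k * (w.1 - u.1) = 0 := by linarith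
    have e2 : k * (w.2 - u.2) = 0 := by linarith
    have hk0 : k ≠ 0 := by omega
    have e1 := (mul_eq_zero.1 e1).resolve_left hk0
    have e2 := (mul_eq_zero.1 e2).resolve_left hk0
    exact hw (Prod.ext (by linarith) (by linarith))
  have hk' : (0 : ℝ) < 1 + k := by have : (1 : ℝ) ≤ k := by exact_mod_cast hk
                                   linarith
  have hk0 : (0 : ℝ) ≤ k := by exact_mod_cast (by omega : (0 : ℤ) ≤ k)
  have h1' : (a.1 : ℝ) = b.1 + k * (w.1 - u.1) := by exact_mod_cast h1
  have h2' : (a.2 : ℝ) = b.2 + k * (w.2 - u.2) := by exact_mod_cast h2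
  -- the intersection point of the segments from `u` to `a` and from `w` to `b`
  set p : ℝ × ℝ := ((k * u.1 + a.1) / (1 + k), (k * u.2 + a.2) / (1 + k)) with hp
  have hpa : p ∈ hull {u, w, a} := mem_hull_triple.2 ⟨k / (1 + k), 0, 1 / (1 + k), by positivity,
    le_rfl, by positivity, by field_simp; ring, by simp only [hp]; field_simp; ring,
    by simp only [hp]; field_simp; ring⟩
  have hpb : p ∈ hull {u, w, b} := mem_hull_triple.2 ⟨0, k / (1 + k), 1 / (1 + k), le_rfl,
    by positivity, by positivity, by field_simp; ring,
    by simp only [hp]; rw [h1']; field_simp; ring,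
    by simp only [hp]; rw [h2']; field_simp; ring⟩
  have hpe := hull_mono (t := {u, w}) (by grind) (hull_inter_subset ha.1 hb.1 ⟨hpa, hpb⟩)
  obtain ⟨α, β, -, -, hαβ, e1, e2⟩ := mem_hull_pair.1 hpe
  have hdet : ((w.1 : ℝ) - u.1) * (p.2 - u.2) - (p.1 - u.1) * (w.2 - u.2) = 0 := by
    rw [← e1, ← e2]
    have : α = 1 - β := by linarith
    subst this
    ring
  have hdet2 : (1 + (k : ℝ)) * (((w.1 : ℝ) - u.1) * (p.2 - u.2) - (p.1 - u.1) * (w.2 - u.2)) =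
      (orient u w a : ℤ) := by
    simp only [hp, orient]
    push_cast
    field_simp
    ring
  rw [hdet, mul_zero] at hdet2
  have hz : orient u w a = 0 := by exact_mod_cast hdet2.symm
  rcases orient_of_mem hT ha with h | h <;> omega

/-- On each side of an edge there is at most one triangle. -/
theorem eq_of_orient_eq (hT : T.IsUnimodular) {u w a b : ℤ × ℤ} (ha : {u, w, a} ∈ T.triangles)
    (hb : {u, w, b} ∈ T.triangles) (h : orient u w a = orient u w b) : a = b := by
  obtain ⟨D, hD⟩ : ∃ D, D = orient u w a := ⟨_, rfl⟩
  have hDD : D * D = 1 := by rcases orient_of_mem hT ha with h | h <;> rw [hD, h] <;> norm_num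
  have hab : (w.1 - u.1) * (a.2 - b.2) = (a.1 - b.1) * (w.2 - u.2) := by
    simp only [orient] at h; linarith
  obtain ⟨k, hk⟩ : ∃ k, k = D * ((a.1 - b.1) * (a.2 - u.2) - (a.2 - b.2) * (a.1 - u.1)) :=
    ⟨_, rfl⟩
  have k1 : k * (w.1 - u.1) = a.1 - b.1 := by
    have e : (a.1 - b.1) = D * D * (a.1 - b.1) := by rw [hDD, one_mul]
    rw [e, hk]
    nth_rewrite 3 [hD]
    simp only [orient]
    linear_combination (-D * (a.1 - u.1)) * hab
  have k2 : k * (w.2 - u.2) = a.2 - b.2 := by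
    have e : (a.2 - b.2) = D * D * (a.2 - b.2) := by rw [hDD, one_mul]
    rw [e, hk]
    nth_rewrite 3 [hD]
    simp only [orient]
    linear_combination (-D * (a.2 - u.2)) * hab
  rcases lt_trichotomy k 0 with hk0 | hk0 | hk0
  · exact (not_add_smul_third hT hb ha (k := -k) (by omega) (by linarith) (by linarith)).elim
  · subst hk0
    exact Prod.ext (by linarith) (by linarith)
  · exact (not_add_smul_third hT ha hb (k := k) (by omega) (by linarith) (by linarith)).elim

/-- On each side of an edge which is not contained in the boundary there is a triangle. -/
theorem exists_third_of_not_isBoundaryEdge (hd : 1 ≤ d) (hT : T.IsUnimodular) {u w : ℤ × ℤ}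
    (huw : u ≠ w) (he : {u, w} ∈ T.latticeFaces) (hb : ¬ IsBoundaryEdge d u w) {σ : ℤ}
    (hσ : σ = 1 ∨ σ = -1) : ∃ z, {u, w, z} ∈ T.triangles ∧ orient u w z = σ := by
  obtain ⟨hu1, hu2, hu3⟩ := mem_latticePoints_of_mem he (v := u) (by simp)
  obtain ⟨hw1, hw2, hw3⟩ := mem_latticePoints_of_mem he (v := w) (by simp)
  unfold IsBoundaryEdge at hb
  have hm : {p : ℝ × ℝ | 0 < p.1 ∧ 0 < p.2 ∧ p.1 + p.2 < d} ∈ 𝓝 (mid u w) := by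
    refine IsOpen.mem_nhds ((isOpen_lt continuous_const continuous_fst).inter
      ((isOpen_lt continuous_const continuous_snd).inter
        (isOpen_lt (continuous_fst.add continuous_snd) continuous_const))) ?_
    simp only [mid, mem_ofPred_eq]
    have e1 : 0 < u.1 + w.1 := by omega
    have e2 : 0 < u.2 + w.2 := by omega
    have e3 : u.1 + w.1 + (u.2 + w.2) < 2 * d := by omega
    have e1 : (0 : ℝ) < u.1 + w.1 := by exact_mod_cast e1
    have e2 : (0 : ℝ) < u.2 + w.2 := by exact_mod_cast e2
    have e3 : (u.1 : ℝ) + w.1 + (u.2 + w.2) < 2 * d := by exact_mod_cast e3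
    exact ⟨by linarith, by linarith, by linarith⟩
  set f : ℝ → ℝ × ℝ := fun δ => mid u w + (δ * (σ * (-(w.2 - u.2))), δ * (σ * (w.1 - u.1)))
  have hf : Tendsto f (𝓝[>] 0) (𝓝 (mid u w)) := by
    have hc : Continuous f := by fun_prop
    have := hc.tendsto 0
    simp only [f, zero_mul] at this
    rw [Prod.mk_zero_zero, add_zero] at this
    exact this.mono_left nhdsWithin_le_nhds
  obtain ⟨δ, ⟨hδ1, hδ2⟩, hδ⟩ := (((hf.eventually (eventually_mem_hull T _)).and
    (hf.eventually hm)).and self_mem_nhdsWithin).exists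
  obtain ⟨t, ht, hqt⟩ := exists_triangle_mem_hull T hd
    (mem_dilatedTriangle.2 ⟨hδ2.1.le, hδ2.2.1.le, hδ2.2.2.le⟩)
  have hsub := pair_subset_of_mid_mem_hull huw he ht.1 (hδ1 t ht hqt)
  obtain ⟨z, rfl, -, -⟩ := exists_third ht (hsub (by simp)) (hsub (by simp)) huw
  refine ⟨z, ht, ?_⟩
  obtain ⟨a, b, c, ha, hb, hc, habc, h1, h2⟩ := mem_hull_triple.1 hqt
  simp only [f, mid, Prod.fst_add, Prod.snd_add] at h1 h2
  have hlen : (0 : ℝ) < ((w.1 : ℝ) - u.1) ^ 2 + (w.2 - u.2) ^ 2 := by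
    have : u.1 ≠ w.1 ∨ u.2 ≠ w.2 := by
      by_contra! h
      exact huw (Prod.ext h.1 h.2)
    rcases this with h | h
    · have : (w.1 : ℝ) - u.1 ≠ 0 := sub_ne_zero.2 (by exact_mod_cast h.symm)
      positivity
    · have : (w.2 : ℝ) - u.2 ≠ 0 := sub_ne_zero.2 (by exact_mod_cast h.symm)
      positivity
  have key : c * (orient u w z : ℤ) = δ * σ * (((w.1 : ℝ) - u.1) ^ 2 + (w.2 - u.2) ^ 2) := by
    simp only [orient]
    push_cast
    have : a = 1 - b - c := by linarith
    subst this
    linear_combination ((w.1 : ℝ) - u.1) * h2 - ((w.2 : ℝ) - u.2) * h1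
  have hδ0 : (0 : ℝ) < δ := hδ
  have hpos : 0 < δ * (((w.1 : ℝ) - u.1) ^ 2 + (w.2 - u.2) ^ 2) := by positivity
  rcases hσ with rfl | rfl <;> rcases orient_of_mem hT ht with h | h <;> rw [h] at key ⊢ <;>
    push_cast at key <;> exfalso <;> nlinarith

/-- An edge which is not contained in the boundary lies in exactly two triangles. -/
theorem ncard_triangles_of_not_isBoundaryEdge (hd : 1 ≤ d) (hT : T.IsUnimodular) {u w : ℤ × ℤ}
    (huw : u ≠ w) (he : {u, w} ∈ T.latticeFaces) (hb : ¬ IsBoundaryEdge d u w) :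
    {t ∈ T.triangles | {u, w} ⊆ t}.ncard = 2 := by
  obtain ⟨a, ha, ha1⟩ := exists_third_of_not_isBoundaryEdge hd hT huw he hb (Or.inl rfl)
  obtain ⟨b, hb, hb1⟩ := exists_third_of_not_isBoundaryEdge hd hT huw he hb (Or.inr rfl)
  have hab : a ≠ b := by rintro rfl; omega
  refine Set.ncard_eq_two.2 ⟨{u, w, a}, {u, w, b}, ?_, ?_⟩
  · intro h
    have h1 := ne_of_card_triple ha.2
    have : a ∈ ({u, w, b} : Finset (ℤ × ℤ)) := h ▸ (by simp)
    simp only [Finset.mem_insert, Finset.mem_singleton] at this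
    tauto
  · ext t
    simp only [mem_ofPred_eq, mem_insert_iff, mem_singleton_iff]
    constructor
    · rintro ⟨ht, hsub⟩
      obtain ⟨z, rfl, -, -⟩ := exists_third ht (hsub (by simp)) (hsub (by simp)) huw
      rcases orient_of_mem hT ht with h | h
      · left; rw [eq_of_orient_eq hT ht ha (h.trans ha1.symm)]
      · right; rw [eq_of_orient_eq hT ht hb (h.trans hb1.symm)]
    · rintro (rfl | rfl)
      · exact ⟨ha, by grind⟩
      · exact ⟨hb, by grind⟩

/-- An edge in the boundary lies in only one triangle. -/
theorem eq_of_isBoundaryEdge (hT : T.IsUnimodular) {u w : ℤ × ℤ}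
    (huw : u ≠ w) (hb : IsBoundaryEdge d u w) {s t : Finset (ℤ × ℤ)} (hs : s ∈ T.triangles)
    (ht : t ∈ T.triangles) (hus : u ∈ s) (hws : w ∈ s) (hut : u ∈ t) (hwt : w ∈ t) : s = t := by
  obtain ⟨a, rfl, -, -⟩ := exists_third hs hus hws huw
  obtain ⟨b, rfl, -, -⟩ := exists_third ht hut hwt huw
  obtain ⟨ha1, ha2, ha3⟩ := mem_latticePoints_of_mem hs.1 (v := a) (by simp)
  obtain ⟨hb1, hb2, hb3⟩ := mem_latticePoints_of_mem ht.1 (v := b) (by simp)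
  -- both triangles lie on the inner side of the edge
  have hnn : 0 ≤ orient u w a * orient u w b := by
    unfold IsBoundaryEdge at hb
    rcases hb with ⟨h1, h2⟩ | ⟨h1, h2⟩ | ⟨h1, h2⟩
    · have e : orient u w a * orient u w b = (a.1 * b.1) * (w.2 - u.2) ^ 2 := by
        simp only [orient, h1, h2]; ring
      rw [e]; positivity
    · have e : orient u w a * orient u w b = (a.2 * b.2) * (w.1 - u.1) ^ 2 := by
        simp only [orient, h1, h2]; ring
      rw [e]; positivity
    · have e1 : u.2 = d - u.1 := by linarith
      have e2 : w.2 = d - w.1 := by linarith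
      have e : orient u w a * orient u w b =
          ((d - (a.1 + a.2)) * (d - (b.1 + b.2))) * (w.1 - u.1) ^ 2 := by
        simp only [orient, e1, e2]; ring
      rw [e]
      exact mul_nonneg (mul_nonneg (by linarith) (by linarith)) (sq_nonneg _)
  have : orient u w a = orient u w b := by
    rcases orient_of_mem hT hs with h | h <;> rcases orient_of_mem hT ht with h' | h' <;>
      rw [h, h'] at hnn ⊢ <;> omega
  rw [eq_of_orient_eq hT hs ht this]

/-! ### The triangles at a vertex -/

theorem exists_small_mem {K : Set (ℝ × ℝ)} (hK : Convex ℝ K) {p c : ℝ × ℝ} (hp : p ∈ K)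
    (hc : c ∈ K) {U : Set (ℝ × ℝ)} (hU : U ∈ 𝓝 p) :
    ∃ δ : ℝ, 0 < δ ∧ p + δ • (c - p) ∈ K ∩ U := by
  set f : ℝ → ℝ × ℝ := fun δ => p + δ • (c - p)
  have hf : Tendsto f (𝓝[>] 0) (𝓝 p) := by
    have hcont : Continuous f := by fun_prop
    have := hcont.tendsto 0
    simp only [f, zero_smul, add_zero] at this
    exact this.mono_left nhdsWithin_le_nhds
  have h1 : ∀ᶠ δ : ℝ in 𝓝[>] 0, δ < 1 := nhdsWithin_le_nhds (Iio_mem_nhds one_pos)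
  obtain ⟨δ, ⟨hδ1, hδU⟩, hδ⟩ := ((h1.and (hf.eventually hU)).and self_mem_nhdsWithin).exists
  exact ⟨δ, hδ, hK.add_smul_sub_mem hp hc ⟨le_of_lt hδ, hδ1.le⟩, hδU⟩

/-- Any two triangles at a vertex are joined by a chain of triangles at this vertex in which
consecutive triangles share an edge. -/
theorem star_chain (hd : 1 ≤ d) (hT : T.IsUnimodular) {v : ℤ × ℤ} {s t : Finset (ℤ × ℤ)}
    (hs : s ∈ T.triangles) (ht : t ∈ T.triangles) (hvs : v ∈ s) (hvt : v ∈ t) :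
    Relation.ReflTransGen (fun a b => a ∈ {t ∈ T.triangles | v ∈ t} ∧
      b ∈ {t ∈ T.triangles | v ∈ t} ∧ ∃ w, w ≠ v ∧ w ∈ a ∧ w ∈ b) s t := by
  obtain ⟨ε, hε, hball⟩ := Metric.eventually_nhds_iff_ball.1 (eventually_mem_hull T (toPlane v))
  set B := Metric.ball (toPlane v) ε
  have hB : B ∈ 𝓝 (toPlane v) := Metric.ball_mem_nhds _ hε
  have hvd : toPlane v ∈ dilatedTriangle d :=
    toPlane_mem_dilatedTriangle (mem_latticePoints_of_mem hs.1 hvs)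
  have hconv : Convex ℝ (dilatedTriangle d ∩ B) :=
    (convex_dilatedTriangle d).inter (convex_ball _ _)
  have hd' : (1 : ℝ) ≤ d := by exact_mod_cast hd
  have hK : IsPreconnected ((dilatedTriangle d ∩ B) \ {toPlane v}) := by
    refine isPreconnected_diff_singleton hconv _ fun n hn => ?_
    obtain ⟨c, hc, hcn⟩ : ∃ c ∈ dilatedTriangle d,
        n.1 * (c.1 - (toPlane v).1) + n.2 * (c.2 - (toPlane v).2) ≠ 0 := by
      by_contra! h
      have h0 := h (0, 0) (mem_dilatedTriangle.2 (by simp))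
      have h1 := h ((d : ℝ), 0) (mem_dilatedTriangle.2 (by simp))
      have h2 := h (0, (d : ℝ)) (mem_dilatedTriangle.2 (by simp))
      simp only at h0 h1 h2
      have e1 : n.1 * d = 0 := by linarith
      have e2 : n.2 * d = 0 := by linarith
      exact hn (Prod.ext ((mul_eq_zero.1 e1).resolve_right (by linarith))
        ((mul_eq_zero.1 e2).resolve_right (by linarith)))
    obtain ⟨δ, hδ, hmem⟩ := exists_small_mem (convex_dilatedTriangle d) hvd hc hB
    refine ⟨_, hmem, ?_⟩
    have : n.1 * ((toPlane v + δ • (c - toPlane v)).1 - (toPlane v).1) +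
        n.2 * ((toPlane v + δ • (c - toPlane v)).2 - (toPlane v).2) =
        δ * (n.1 * (c.1 - (toPlane v).1) + n.2 * (c.2 - (toPlane v).2)) := by
      simp; ring
    rw [this]
    exact mul_ne_zero hδ.ne' hcn
  have hmeet : ∀ t ∈ T.triangles, v ∈ t →
      (((dilatedTriangle d ∩ B) \ {toPlane v}) ∩ hull t).Nonempty := by
    intro t ht hvt
    obtain ⟨a, hat, hav⟩ := Finset.exists_mem_ne (by rw [ht.2]; norm_num) v
    obtain ⟨δ, hδ, hmem⟩ := exists_small_mem (convex_hull t) (mem_hull_of_mem hvt)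
      (mem_hull_of_mem hat) hB
    refine ⟨_, ⟨⟨hull_subset_dilatedTriangle ht.1 hmem.1, hmem.2⟩, fun h => ?_⟩, hmem.1⟩
    have h' : δ • (toPlane a - toPlane v) = 0 := by simpa using h
    rcases smul_eq_zero.1 h' with h' | h'
    · exact hδ.ne' h'
    · exact hav (toPlane_injective (sub_eq_zero.1 h'))
  refine exists_chain_of_isPreconnected hK (I := {t ∈ T.triangles | v ∈ t}) (C := hull)
    ((triangles_finite T).subset fun _ h => h.1) (fun t _ => isClosed_hull t) ?_ ?_ ⟨hs, hvs⟩
    ⟨ht, hvt⟩ (hmeet s hs hvs) (hmeet t ht hvt)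
  · rintro q ⟨⟨hqd, hqB⟩, -⟩
    obtain ⟨t, ht, hqt⟩ := exists_triangle_mem_hull T hd hqd
    exact mem_iUnion₂.2 ⟨t, ⟨ht, mem_of_toPlane_mem_hull hT ht (hball q hqB t ht hqt)⟩, hqt⟩
  · rintro a ⟨ha, hva⟩ b ⟨hb, hvb⟩ ⟨q, ⟨-, hqv⟩, hqa, hqb⟩
    have hq := hull_inter_subset ha.1 hb.1 ⟨hqa, hqb⟩
    by_contra! hcon
    have := hull_mono (t := {v}) (by
      intro w hw
      rw [Finset.mem_inter] at hw
      by_contra hwv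
      exact hcon w (by simpa using hwv) hw.1 hw.2) hq
    rw [hull_singleton] at this
    exact hqv this

/-! ### Connectedness of the edge graph -/

/-- If each triangle has at most one vertex in `P`, then the edges outside `P` connect all lattice
points of `d·Δ₂` outside `P`: paths through a vertex in `P` are rerouted around it. -/
theorem connected_off (hd : 1 ≤ d) (hT : T.IsUnimodular) {P : Set (ℤ × ℤ)}
    (hP : ∀ t ∈ T.triangles, ∀ x ∈ t, ∀ y ∈ t, x ∈ P → y ∈ P → x = y) {x y : ℤ × ℤ}
    (hx : x ∈ latticePoints d) (hy : y ∈ latticePoints d) (hxP : x ∉ P) (hyP : y ∉ P) :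
    Relation.ReflTransGen (fun a b => a ∉ P ∧ b ∉ P ∧ {a, b} ∈ T.latticeFaces ∧ a ≠ b) x y := by
  set g : ℤ × ℤ → ℤ × ℤ → Prop := fun a b => a ∉ P ∧ b ∉ P ∧ {a, b} ∈ T.latticeFaces ∧ a ≠ b
  set conn : Finset (ℤ × ℤ) → Finset (ℤ × ℤ) → Prop := fun s t =>
    ∀ a ∈ s, ∀ b ∈ t, a ∉ P → b ∉ P → Relation.ReflTransGen g a b with hconn
  have hin : ∀ t ∈ T.triangles, conn t t := by
    intro t ht a ha b hb haP hbP
    by_cases hab : a = b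
    · exact hab ▸ .refl
    · exact .single ⟨haP, hbP, latticeFaces_down ht.1 (by grind) (by simp), hab⟩
  have hshare : ∀ s ∈ T.triangles, ∀ t ∈ T.triangles, ∀ w ∈ s, w ∈ t → w ∉ P → conn s t :=
    fun s hs t ht w hws hwt hwP a ha b hb haP hbP =>
      (hin s hs a ha w hws haP hwP).trans (hin t ht w hwt b hb hwP hbP)
  have htrans : ∀ s t t', t ∈ T.triangles → conn s t → conn t t' → conn s t' := by
    intro s t t' ht h1 h2 a ha b hb haP hbP
    obtain ⟨c, hc, hcP⟩ : ∃ c ∈ t, c ∉ P := by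
      by_contra! h
      obtain ⟨c, hc, c', hc', hne⟩ := Finset.one_lt_card.1 (by rw [ht.2]; norm_num : 1 < t.card)
      exact hne (hP t ht c hc c' hc' (h c hc) (h c' hc'))
    exact (h1 a ha c hc haP hcP).trans (h2 c hc b hb hcP hbP)
  have hstep : ∀ s ∈ T.triangles, ∀ t ∈ T.triangles, ∀ w ∈ s, w ∈ t → conn s t := by
    intro s hs t ht w hws hwt
    by_cases hwP : w ∈ P
    · have hch := star_chain hd hT hs ht hws hwt
      clear ht hwt
      induction hch with
      | refl => exact hin s hs
      | tail _ h ih =>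
        obtain ⟨⟨hb, hwb⟩, ⟨hc, -⟩, z, hzw, hzb, hzc⟩ := h
        exact htrans _ _ _ hb ih (hshare _ hb _ hc z hzb hzc fun hzP =>
          hzw (hP _ hb z hzb w hwb hzP hwP))
    · exact hshare s hs t ht w hws hwt hwP
  obtain ⟨s, hs, hxs⟩ := exists_triangle_of_vertex hd hT hx
  obtain ⟨t, ht, hyt⟩ := exists_triangle_of_vertex hd hT hy
  have hmeet : ∀ t ∈ T.triangles, (dilatedTriangle d ∩ hull t).Nonempty := by
    intro t ht
    obtain ⟨w, hw⟩ := latticeFaces_nonempty ht.1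
    exact ⟨toPlane w, hull_subset_dilatedTriangle ht.1 (mem_hull_of_mem hw), mem_hull_of_mem hw⟩
  have hch := exists_chain_of_isPreconnected (convex_dilatedTriangle d).isPreconnected
    (I := T.triangles) (C := hull) (r := fun s t => ∃ w, w ∈ s ∧ w ∈ t) (triangles_finite T)
    (fun t _ => isClosed_hull t)
    (fun q hq => by
      obtain ⟨t, ht, hqt⟩ := exists_triangle_mem_hull T hd hq
      exact mem_iUnion₂.2 ⟨t, ht, hqt⟩)
    (fun a ha b hb ⟨q, _, hqa, hqb⟩ => by
      have hq := hull_inter_subset ha.1 hb.1 ⟨hqa, hqb⟩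
      rcases (a ∩ b).eq_empty_or_nonempty with h | ⟨w, hw⟩
      · rw [h, hull_empty] at hq; exact hq.elim
      · exact ⟨w, (Finset.mem_inter.1 hw).1, (Finset.mem_inter.1 hw).2⟩)
    hs ht (hmeet s hs) (hmeet t ht)
  have hst : conn s t := by
    clear ht hyt
    induction hch with
    | refl => exact hin s hs
    | tail _ h ih =>
      obtain ⟨hb, hc, w, hwb, hwc⟩ := h
      exact htrans _ _ _ hb ih (hstep _ hb _ hc w hwb hwc)
  exact hst x hxs y hyt hxP hyP

/-! ### Edges in the boundary -/

/-- If every pair of lattice points with the same midpoint as `v`, `v + δ` lies on the line of `v`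
in direction `δ`, then `{v, v + δ}` is an edge. -/
theorem pair_mem_latticeFaces (hd : 1 ≤ d) (hT : T.IsUnimodular) {v δ : ℤ × ℤ} (hδ : δ ≠ 0)
    (hv : v ∈ latticePoints d) (hw : v + δ ∈ latticePoints d)
    (H : ∀ x ∈ latticePoints d, ∀ y ∈ latticePoints d, x + y = v + (v + δ) →
      ∃ k : ℤ, x = v + k • δ) : {v, v + δ} ∈ T.latticeFaces := by
  have hm : mid v (v + δ) ∈ dilatedTriangle d :=
    (convex_dilatedTriangle d).segment_subset (toPlane_mem_dilatedTriangle hv)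
      (toPlane_mem_dilatedTriangle hw) ⟨1 / 2, 1 / 2, by norm_num, by norm_num, by norm_num,
        Prod.ext (by simp [mid, toPlane]; ring) (by simp [mid, toPlane]; ring)⟩
  obtain ⟨t, ht, hmt⟩ := exists_triangle_mem_hull T hd hm
  have hpair : ∀ x ∈ t, ∀ y ∈ t, x + y = v + (v + δ) → {v, v + δ} ∈ T.latticeFaces := by
    intro x hx y hy hxy
    obtain ⟨k, rfl⟩ := H x (mem_latticePoints_of_mem ht.1 hx) y
      (mem_latticePoints_of_mem ht.1 hy) hxy
    have hy' : y = v + (1 - k) • δ := by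
      rw [sub_smul, one_smul]
      linear_combination hxy
    subst hy'
    have hne : v + k • δ ≠ v + (1 - k) • δ := by
      intro h
      have h' : (2 * k - 1) • δ = 0 := by
        have : (2 * k - 1) • δ = k • δ - (1 - k) • δ := by rw [← sub_smul]; congr 1; ring
        rw [this, add_left_cancel h, sub_self]
      rcases smul_eq_zero.1 h' with h' | h'
      · omega
      · exact hδ h'
    obtain ⟨z, rfl, -, -⟩ := exists_third ht hx hy hne
    have hor : orient (v + k • δ) (v + (1 - k) • δ) z =
        (1 - 2 * k) * orient v (v + δ) z := by
      simp only [orient, Prod.fst_add, Prod.snd_add, Prod.smul_fst, Prod.smul_snd, smul_eq_mul]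
      ring
    have hu : IsUnit (1 - 2 * k) := by
      refine isUnit_of_mul_isUnit_left (y := orient v (v + δ) z) ?_
      rw [← hor, Int.isUnit_iff]
      exact orient_of_mem hT ht
    have hk : k = 0 ∨ k = 1 := by rcases Int.isUnit_iff.1 hu with h | h <;> omega
    refine latticeFaces_down ht.1 ?_ (by simp)
    rcases hk with rfl | rfl
    · simp [Finset.insert_subset_iff]
    · simp [Finset.insert_subset_iff]
  obtain ⟨x, y, z, rfl⟩ := exists_eq_triple ht
  obtain ⟨a, b, c, ha, hb, hc, habc, h1, h2⟩ := mem_hull_triple.1 hmt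
  obtain ⟨A, B, C, hA, hB, hC⟩ := exists_int_barycentric (N := 2) (x := v + (v + δ))
    (orient_of_mem hT ht) habc (by rw [h1]; simp [mid]; ring) (by rw [h2]; simp [mid]; ring)
  push_cast at hA hB hC
  simp only [mid] at h1 h2
  have ha : 0 ≤ A := by exact_mod_cast (by rw [← hA]; positivity : (0 : ℝ) ≤ A)
  have hb : 0 ≤ B := by exact_mod_cast (by rw [← hB]; positivity : (0 : ℝ) ≤ B)
  have hc : 0 ≤ C := by exact_mod_cast (by rw [← hC]; positivity : (0 : ℝ) ≤ C)
  have hs : A + B + C = 2 := by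
    have : (A : ℝ) + B + C = 2 := by rw [← hA, ← hB, ← hC]; linear_combination 2 * habc
    exact_mod_cast this
  have e1 : A * x.1 + B * y.1 + C * z.1 = v.1 + (v.1 + δ.1) := by
    have : (A : ℝ) * x.1 + B * y.1 + C * z.1 = v.1 + (v + δ).1 := by
      rw [← hA, ← hB, ← hC]; linear_combination 2 * h1
    exact_mod_cast this
  have e2 : A * x.2 + B * y.2 + C * z.2 = v.2 + (v.2 + δ.2) := by
    have : (A : ℝ) * x.2 + B * y.2 + C * z.2 = v.2 + (v + δ).2 := by
      rw [← hA, ← hB, ← hC]; linear_combination 2 * h2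
    exact_mod_cast this
  have : (A = 2 ∧ B = 0 ∧ C = 0) ∨ (A = 0 ∧ B = 2 ∧ C = 0) ∨ (A = 0 ∧ B = 0 ∧ C = 2) ∨
    (A = 1 ∧ B = 1 ∧ C = 0) ∨ (A = 1 ∧ B = 0 ∧ C = 1) ∨ (A = 0 ∧ B = 1 ∧ C = 1) := by omega
  rcases this with ⟨rfl, rfl, rfl⟩ | ⟨rfl, rfl, rfl⟩ | ⟨rfl, rfl, rfl⟩ | ⟨rfl, rfl, rfl⟩ |
    ⟨rfl, rfl, rfl⟩ | ⟨rfl, rfl, rfl⟩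
  · exact hpair x (by simp) x (by simp)
      (Prod.ext (by simp only [Prod.fst_add]; linarith) (by simp only [Prod.snd_add]; linarith))
  · exact hpair y (by simp) y (by simp)
      (Prod.ext (by simp only [Prod.fst_add]; linarith) (by simp only [Prod.snd_add]; linarith))
  · exact hpair z (by simp) z (by simp)
      (Prod.ext (by simp only [Prod.fst_add]; linarith) (by simp only [Prod.snd_add]; linarith))
  · exact hpair x (by simp) y (by simp)
      (Prod.ext (by simp only [Prod.fst_add]; linarith) (by simp only [Prod.snd_add]; linarith))
  · exact hpair x (by simp) z (by simp)
      (Prod.ext (by simp only [Prod.fst_add]; linarith) (by simp only [Prod.snd_add]; linarith))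
  · exact hpair y (by simp) z (by simp)
      (Prod.ext (by simp only [Prod.fst_add]; linarith) (by simp only [Prod.snd_add]; linarith))

/-- The sides of `d·Δ₂` are subdivided into unit segments; this and the following two lemmas treat
the sides on the second axis, on the first axis, and opposite to the origin. -/
theorem left_pair_mem (hd : 1 ≤ d) (hT : T.IsUnimodular) {j : ℤ} (h0 : 0 ≤ j) (h1 : j < d) :
    {((0 : ℤ), j), (0, j + 1)} ∈ T.latticeFaces := by
  have := pair_mem_latticeFaces hd hT (v := (0, j)) (δ := (0, 1)) (by simp)
    ⟨le_rfl, h0, by simp; omega⟩ ⟨by simp, by simp; omega, by simp; omega⟩ (by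
      rintro ⟨x1, x2⟩ ⟨hx1, hx2, hx3⟩ ⟨y1, y2⟩ ⟨hy1, hy2, hy3⟩ hxy
      simp only [Prod.mk_add_mk, Prod.mk.injEq] at hxy hx1 hy1
      refine ⟨x2 - j, ?_⟩
      ext
      · simp; omega
      · simp)
  simpa using this

theorem bottom_pair_mem (hd : 1 ≤ d) (hT : T.IsUnimodular) {i : ℤ} (h0 : 0 ≤ i) (h1 : i < d) :
    {(i, (0 : ℤ)), (i + 1, 0)} ∈ T.latticeFaces := by
  have := pair_mem_latticeFaces hd hT (v := (i, 0)) (δ := (1, 0)) (by simp)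
    ⟨h0, le_rfl, by simp; omega⟩ ⟨by simp; omega, by simp, by simp; omega⟩ (by
      rintro ⟨x1, x2⟩ ⟨hx1, hx2, hx3⟩ ⟨y1, y2⟩ ⟨hy1, hy2, hy3⟩ hxy
      simp only [Prod.mk_add_mk, Prod.mk.injEq] at hxy hx2 hy2
      refine ⟨x1 - i, ?_⟩
      ext
      · simp
      · simp; omega)
  simpa using this

theorem diagonal_pair_mem (hd : 1 ≤ d) (hT : T.IsUnimodular) {i : ℤ} (h0 : 0 ≤ i) (h1 : i < d) :
    {(i, (d : ℤ) - i), (i + 1, d - (i + 1))} ∈ T.latticeFaces := by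
  have := pair_mem_latticeFaces hd hT (v := (i, d - i)) (δ := (1, -1)) (by simp)
    ⟨h0, by simp; omega, by simp⟩ ⟨by simp; omega, by simp; omega, by simp; omega⟩ (by
      rintro ⟨x1, x2⟩ ⟨hx1, hx2, hx3⟩ ⟨y1, y2⟩ ⟨hy1, hy2, hy3⟩ hxy
      simp only [Prod.mk_add_mk, Prod.mk.injEq] at hxy hx3 hy3
      refine ⟨x1 - i, ?_⟩
      ext
      · simp
      · simp; omega)
  have e : (i, (d : ℤ) - i) + (1, -1) = (i + 1, d - (i + 1)) := by ext <;> simp; ring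
  rwa [e] at this

end Local

/-! ### The number of triangles -/

section Area

open MeasureTheory
open scoped Pointwise

theorem dilatedTriangle_eq_smul {d : ℕ} (hd : 1 ≤ d) :
    dilatedTriangle d = (d : ℝ) • dilatedTriangle 1 := by
  have hd' : (0 : ℝ) < d := by exact_mod_cast hd
  ext p
  rw [Set.mem_smul_set_iff_inv_smul_mem₀ hd'.ne', mem_dilatedTriangle, mem_dilatedTriangle]
  simp only [Prod.smul_fst, Prod.smul_snd, smul_eq_mul, Nat.cast_one]
  rw [mul_nonneg_iff_of_pos_left (inv_pos.2 hd'), mul_nonneg_iff_of_pos_left (inv_pos.2 hd'),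
    ← mul_add, inv_mul_le_iff₀ hd', mul_one]

theorem volume_dilatedTriangle_one_pos : 0 < volume (dilatedTriangle 1) :=
  (isOpen_interior.measure_pos volume (interior_nonempty le_rfl)).trans_le
    (measure_mono interior_subset)

theorem volume_dilatedTriangle_one_ne_top : volume (dilatedTriangle 1) ≠ ⊤ := by
  have : dilatedTriangle 1 = hull {(0, 0), (1, 0), (0, 1)} := by
    simp [dilatedTriangle, hull, image_insert_eq, toPlane]
  rw [this]
  exact (isCompact_hull _).measure_lt_top.ne

theorem volume_hull_of_orient {u v w : ℤ × ℤ} (h : orient u v w = 1 ∨ orient u v w = -1) :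
    volume (hull {u, v, w}) = volume (dilatedTriangle 1) := by
  set M : Matrix (Fin 2) (Fin 2) ℝ :=
    !![(v.1 : ℝ) - u.1, (w.1 : ℝ) - u.1; (v.2 : ℝ) - u.2, (w.2 : ℝ) - u.2]
  set L : ℝ × ℝ →ₗ[ℝ] ℝ × ℝ :=
    Matrix.toLin (Module.Basis.finTwoProd ℝ) (Module.Basis.finTwoProd ℝ) M
  have hL : ∀ b c : ℝ, L (b, c) = ((v.1 - u.1) * b + (w.1 - u.1) * c,
      (v.2 - u.2) * b + (w.2 - u.2) * c) := fun b c => Matrix.toLin_finTwoProd_apply _ _ _ _ _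
  have hdet : |LinearMap.det L| = 1 := by
    have : LinearMap.det L = (orient u v w : ℤ) := by
      rw [LinearMap.det_toLin, Matrix.det_fin_two_of, orient]
      push_cast; ring
    rw [this]
    rcases h with h | h <;> rw [h] <;> simp
  have himg : hull {u, v, w} = (fun x => toPlane u + x) '' (L '' dilatedTriangle 1) := by
    rw [image_image]
    ext p
    rw [mem_hull_triple]
    constructor
    · rintro ⟨a, b, c, ha, hb, hc, habc, h1, h2⟩
      refine ⟨(b, c), mem_dilatedTriangle.2 ⟨hb, hc, by simp; linarith⟩, ?_⟩
      have : a = 1 - b - c := by linarith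
      subst this
      simp only [hL]
      refine Prod.ext ?_ ?_
      · rw [← h1]; simp [toPlane]; ring
      · rw [← h2]; simp [toPlane]; ring
    · rintro ⟨⟨b, c⟩, hbc, rfl⟩
      obtain ⟨hb, hc, hs⟩ := mem_dilatedTriangle.1 hbc
      simp only [Nat.cast_one] at hb hc hs
      refine ⟨1 - b - c, b, c, by linarith, hb, hc, by ring, ?_, ?_⟩ <;>
      · simp only [hL]; simp [toPlane]; ring
  rw [himg, image_add_left, measure_preimage_add, Measure.addHaar_image_linearMap, hdet]
  simp

/-- Comparing areas, a unimodular triangulation of `d·Δ₂` has `d²` triangles. -/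
theorem ncard_triangles {d : ℕ} (hd : 1 ≤ d) {T : Triangulation d} (hT : T.IsUnimodular) :
    T.triangles.ncard = d ^ 2 := by
  have hfin := triangles_finite T
  have hcover : dilatedTriangle d = ⋃ t ∈ hfin.toFinset, hull t := by
    apply Subset.antisymm
    · intro p hp
      obtain ⟨t, ht, hpt⟩ := exists_triangle_mem_hull T hd hp
      exact mem_iUnion₂.2 ⟨t, hfin.mem_toFinset.2 ht, hpt⟩
    · exact iUnion₂_subset fun t ht => hull_subset_dilatedTriangle (hfin.mem_toFinset.1 ht).1
  have hsum : volume (dilatedTriangle d) = ∑ t ∈ hfin.toFinset, volume (hull t) := by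
    rw [hcover]
    refine measure_biUnion_finset₀ ?_ fun t _ => (isClosed_hull t).nullMeasurableSet
    intro s hs t ht hst
    have hs := hfin.mem_toFinset.1 hs
    have ht := hfin.mem_toFinset.1 ht
    refine measure_mono_null (hull_inter_subset hs.1 ht.1) (volume_hull_eq_zero ?_)
    by_contra! hc
    have h1 : s ∩ t = s := Finset.eq_of_subset_of_card_le Finset.inter_subset_left
      (by rw [hs.2]; omega)
    have h2 : s ∩ t = t := Finset.eq_of_subset_of_card_le Finset.inter_subset_right
      (by rw [ht.2]; omega)
    exact hst (h1.symm.trans h2)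
  rw [Finset.sum_congr rfl (g := fun _ => volume (dilatedTriangle 1)) (by
    intro t ht
    have ht := hfin.mem_toFinset.1 ht
    obtain ⟨u, v, w, rfl⟩ := exists_eq_triple ht
    exact volume_hull_of_orient (orient_of_mem hT ht)), Finset.sum_const, nsmul_eq_mul,
    dilatedTriangle_eq_smul hd, Measure.addHaar_smul] at hsum
  have := (ENNReal.mul_left_inj volume_dilatedTriangle_one_pos.ne'
    volume_dilatedTriangle_one_ne_top).1 hsum
  rw [Module.finrank_prod, Module.finrank_self, abs_of_nonneg (by positivity),
    ← Nat.cast_pow, ENNReal.ofReal_natCast] at this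
  rw [Set.ncard_eq_toFinset_card _ hfin]
  exact_mod_cast this.symm

end Area

/-! ### The cells of the projective plane -/

/-- The cell of `S` represented by the copy of the simplex `s` in quadrant `q`. -/
def cellOf (d : ℕ) (s : Finset (ℤ × ℤ)) (q : ℤˣ × ℤˣ) : Cell d :=
  Quotient.mk (antipodalSetoid d) (s.image (reflect q))

theorem absPt_reflect {q : ℤˣ × ℤˣ} {v : ℤ × ℤ} (h1 : 0 ≤ v.1) (h2 : 0 ≤ v.2) :
    (|(reflect q v).1|, |(reflect q v).2|) = v := by
  obtain ⟨a, b⟩ := q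
  ext
  · rcases Int.units_eq_one_or a with rfl | rfl <;> simp [reflect, abs_of_nonneg h1]
  · rcases Int.units_eq_one_or b with rfl | rfl <;> simp [reflect, abs_of_nonneg h2]

theorem reflect_injective (q : ℤˣ × ℤˣ) : Function.Injective (reflect q) := by
  intro u v h
  simp only [reflect, Prod.mk.injEq, mul_eq_mul_left_iff, Units.ne_zero, or_false] at h
  exact Prod.ext h.1 h.2

theorem eq_of_reflect_eq {d : ℕ} {q q' : ℤˣ × ℤˣ} {u v : ℤ × ℤ} (hu : u ∈ latticePoints d)
    (hv : v ∈ latticePoints d) (h : reflect q u = reflect q' v) : u = v := by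
  rw [← absPt_reflect (q := q) hu.1 hu.2.1, h, absPt_reflect hv.1 hv.2.1]

theorem reflect_neg (q : ℤˣ × ℤˣ) (v : ℤ × ℤ) : reflect (-q) v = -reflect q v := by
  simp [reflect]

theorem reflect_eq_iff {q q' : ℤˣ × ℤˣ} {v : ℤ × ℤ} : reflect q v = reflect q' v ↔
    (q.1 = q'.1 ∨ v.1 = 0) ∧ (q.2 = q'.2 ∨ v.2 = 0) := by
  simp only [reflect, Prod.mk.injEq, mul_eq_mul_right_iff, Units.val_inj]

/-- Two copies of simplices give the same cell of `S` if and only if they coincide, or are antipodal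
simplices in the boundary of the diamond. -/
theorem cellOf_eq_iff {d : ℕ} {s s' : Finset (ℤ × ℤ)} {q q' : ℤˣ × ℤˣ}
    (hs : ∀ v ∈ s, v ∈ latticePoints d) (hs' : ∀ v ∈ s', v ∈ latticePoints d) :
    cellOf d s q = cellOf d s' q' ↔ s = s' ∧ ((∀ v ∈ s, reflect q v = reflect q' v) ∨
      ∀ v ∈ s, v.1 + v.2 = d ∧ reflect (-q) v = reflect q' v) := by
  have key : ∀ p p' : ℤˣ × ℤˣ, s.image (reflect p) = s'.image (reflect p') ↔
      s = s' ∧ ∀ v ∈ s, reflect p v = reflect p' v := by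
    intro p p'
    constructor
    · intro h
      have h1 : ∀ v ∈ s, v ∈ s' ∧ reflect p v = reflect p' v := by
        intro v hv
        have : reflect p v ∈ s'.image (reflect p') := h ▸ Finset.mem_image_of_mem _ hv
        obtain ⟨w, hw, hwv⟩ := Finset.mem_image.1 this
        obtain rfl := eq_of_reflect_eq (hs' w hw) (hs v hv) hwv
        exact ⟨hw, hwv.symm⟩
      have h2 : ∀ w ∈ s', w ∈ s := by
        intro w hw
        have : reflect p' w ∈ s.image (reflect p) := h ▸ Finset.mem_image_of_mem _ hw
        obtain ⟨v, hv, hwv⟩ := Finset.mem_image.1 this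
        obtain rfl := eq_of_reflect_eq (hs' w hw) (hs v hv) hwv.symm
        exact hv
      exact ⟨Finset.ext fun v => ⟨fun hv => (h1 v hv).1, h2 v⟩, fun v hv => (h1 v hv).2⟩
    · rintro ⟨rfl, h⟩
      exact Finset.image_congr fun v hv => h v hv
  have hbd : (∀ v ∈ s.image (reflect q), |v.1| + |v.2| = (d : ℤ)) ↔ ∀ v ∈ s, v.1 + v.2 = d := by
    rw [Finset.forall_mem_image]
    refine forall₂_congr fun v hv => ?_
    have := absPt_reflect (q := q) (hs v hv).1 (hs v hv).2.1
    rw [show |(reflect q v).1| = v.1 from congrArg Prod.fst this,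
      show |(reflect q v).2| = v.2 from congrArg Prod.snd this]
  have hanti : antipode (s.image (reflect q)) = s.image (reflect (-q)) := by
    rw [antipode, Finset.image_image]
    exact Finset.image_congr fun v _ => (reflect_neg q v).symm
  unfold cellOf
  rw [Quotient.eq]
  change s.image (reflect q) = s'.image (reflect q') ∨
    ((∀ v ∈ s.image (reflect q), |v.1| + |v.2| = (d : ℤ)) ∧
      s'.image (reflect q') = antipode (s.image (reflect q))) ↔ _
  rw [hbd, hanti, key, eq_comm (a := s'.image (reflect q')), key]
  constructor
  · rintro (⟨rfl, h⟩ | ⟨h, rfl, h'⟩)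
    · exact ⟨rfl, Or.inl h⟩
    · exact ⟨rfl, Or.inr fun v hv => ⟨h v hv, h' v hv⟩⟩
  · rintro ⟨rfl, h | h⟩
    · exact Or.inl ⟨rfl, h⟩
    · exact Or.inr ⟨fun v hv => (h v hv).1, rfl, fun v hv => (h v hv).2⟩

theorem cellOf_singleton_eq_iff {d : ℕ} {u v : ℤ × ℤ} {q q' : ℤˣ × ℤˣ}
    (hu : u ∈ latticePoints d) (hv : v ∈ latticePoints d) :
    cellOf d {u} q = cellOf d {v} q' ↔ u = v ∧ (reflect q u = reflect q' u ∨
      (u.1 + u.2 = d ∧ reflect (-q) u = reflect q' u)) := by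
  rw [cellOf_eq_iff (by simpa using hu) (by simpa using hv)]
  simp

/-- Copies of a simplex which agree in `S` also agree on the faces of the simplex. -/
theorem cellOf_eq_of_subset {d : ℕ} {s t : Finset (ℤ × ℤ)} {q q' : ℤˣ × ℤˣ}
    (ht : ∀ v ∈ t, v ∈ latticePoints d) (hst : s ⊆ t) (h : cellOf d t q = cellOf d t q') :
    cellOf d s q = cellOf d s q' := by
  have hs : ∀ v ∈ s, v ∈ latticePoints d := fun v hv => ht v (hst hv)
  rw [cellOf_eq_iff ht ht] at h
  rw [cellOf_eq_iff hs hs]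
  exact ⟨rfl, h.2.imp (fun h v hv => h v (hst hv)) fun h v hv => h v (hst hv)⟩

theorem units_sq (a : ℤˣ) : a * a = 1 := Int.units_mul_self a

theorem units_eq_neg_of_ne {a b : ℤˣ} (h : a ≠ b) : b = -a := by
  rcases Int.units_eq_one_or a with rfl | rfl <;> rcases Int.units_eq_one_or b with rfl | rfl <;>
    simp_all

/-- If two different quadrants contain the same copy of an edge `{u, w}`, then the edge lies in the
boundary, and the quadrants differ by the difference of the parity classes of `u` and `w`. -/
theorem isBoundaryEdge_of_cellOf_eq {d : ℕ} {u w : ℤ × ℤ} {q q' : ℤˣ × ℤˣ}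
    (hu : u ∈ latticePoints d) (hw : w ∈ latticePoints d) (huw : quad u ≠ quad w) (hq : q ≠ q')
    (h : cellOf d {u, w} q = cellOf d {u, w} q') :
    IsBoundaryEdge d u w ∧ q' = q * (quad u * quad w) := by
  obtain ⟨u1, u2⟩ := u
  obtain ⟨w1, w2⟩ := w
  obtain ⟨a, b⟩ := q
  obtain ⟨a', b'⟩ := q'
  have hmem : ∀ v ∈ ({(u1, u2), (w1, w2)} : Finset (ℤ × ℤ)), v ∈ latticePoints d := by
    simp [hu, hw]
  rw [cellOf_eq_iff hmem hmem] at h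
  simp only [Finset.mem_insert, Finset.mem_singleton, forall_eq_or_imp, forall_eq, true_and,
    reflect_eq_iff, Prod.fst_neg, Prod.snd_neg] at h
  simp only [quad, ne_eq, Prod.mk.injEq, not_and_or, Prod.mk_mul_mk] at huw hq ⊢
  unfold IsBoundaryEdge
  simp only
  have hneg : ∀ x y : ℤ, ¬ x.negOnePow = y.negOnePow → x.negOnePow * y.negOnePow = -1 := by
    intro x y hxy
    rw [units_eq_neg_of_ne hxy, mul_neg, units_sq]
  rcases h with ⟨⟨h1, h2⟩, h3, h4⟩ | ⟨⟨h5, h1, h2⟩, h6, h3, h4⟩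
  · by_cases ha : a = a'
    · have hb : ¬ b = b' := by tauto
      have hu2 : u2 = 0 := by tauto
      have hw2 : w2 = 0 := by tauto
      subst ha hu2 hw2
      have hx : ¬ u1.negOnePow = w1.negOnePow := by tauto
      refine ⟨by simp, by simp, ?_⟩
      rw [hneg _ _ hx, mul_neg, mul_one, units_eq_neg_of_ne hb]
    · have hu1 : u1 = 0 := by tauto
      have hw1 : w1 = 0 := by tauto
      subst hu1 hw1
      have hx : ¬ u2.negOnePow = w2.negOnePow := by tauto
      have hb : b = b' := by
        by_contra hb
        have hu2 : u2 = 0 := by tauto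
        have hw2 : w2 = 0 := by tauto
        exact hx (by rw [hu2, hw2])
      refine ⟨by simp, ?_, by simp [hb]⟩
      rw [hneg _ _ hx, mul_neg, mul_one, units_eq_neg_of_ne ha]
  · have hiff : u1.negOnePow = w1.negOnePow ↔ u2.negOnePow = w2.negOnePow := by
      rw [Int.negOnePow_eq_iff, Int.negOnePow_eq_iff, Int.even_iff, Int.even_iff]
      omega
    have hx1 : ¬ u1.negOnePow = w1.negOnePow := by tauto
    have hx2 : ¬ u2.negOnePow = w2.negOnePow := by tauto
    have hne : u1 ≠ w1 := fun h => hx1 (by rw [h])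
    have ha : -a = a' := by
      by_contra ha
      have : u1 = 0 := by tauto
      have : w1 = 0 := by tauto
      omega
    have hb : -b = b' := by
      by_contra hb
      have : u2 = 0 := by tauto
      have : w2 = 0 := by tauto
      omega
    refine ⟨Or.inr (Or.inr ⟨h5, h6⟩), ?_, ?_⟩
    · rw [hneg _ _ hx2, mul_neg, mul_one, ha]
    · rw [hneg _ _ hx1, mul_neg, mul_one, hb]

/-- Each copy of an edge in the boundary of `d·Δ₂` lies in two quadrants, up to the antipodal
identification. -/
theorem cellOf_mul_of_isBoundaryEdge {d : ℕ} {u w : ℤ × ℤ} (q : ℤˣ × ℤˣ)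
    (hu : u ∈ latticePoints d) (hw : w ∈ latticePoints d) (huw : quad u ≠ quad w)
    (h : IsBoundaryEdge d u w) :
    cellOf d {u, w} q = cellOf d {u, w} (q * (quad u * quad w)) := by
  obtain ⟨u1, u2⟩ := u
  obtain ⟨w1, w2⟩ := w
  obtain ⟨a, b⟩ := q
  have hmem : ∀ v ∈ ({(u1, u2), (w1, w2)} : Finset (ℤ × ℤ)), v ∈ latticePoints d := by
    simp [hu, hw]
  rw [cellOf_eq_iff hmem hmem]
  simp only [Finset.mem_insert, Finset.mem_singleton, forall_eq_or_imp, forall_eq, true_and,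
    reflect_eq_iff, Prod.fst_neg, Prod.snd_neg]
  simp only [quad, ne_eq, Prod.mk.injEq, not_and_or, Prod.mk_mul_mk] at huw ⊢
  unfold IsBoundaryEdge at h
  simp only at h
  have hneg : ∀ x y : ℤ, ¬ x.negOnePow = y.negOnePow → x.negOnePow * y.negOnePow = -1 := by
    intro x y hxy
    rw [units_eq_neg_of_ne hxy, mul_neg, units_sq]
  rcases h with ⟨rfl, rfl⟩ | ⟨rfl, rfl⟩ | ⟨h5, h6⟩
  · left; simp
  · left; simp
  · right
    have hiff : u1.negOnePow = w1.negOnePow ↔ u2.negOnePow = w2.negOnePow := by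
      rw [Int.negOnePow_eq_iff, Int.negOnePow_eq_iff, Int.even_iff, Int.even_iff]
      omega
    rw [hneg u1 w1 (by tauto), hneg u2 w2 (by tauto)]
    simp [h5, h6]

section Cells

variable {d : ℕ} {T : Triangulation d}

theorem mem_diamondFaces {s : Finset (ℤ × ℤ)} (hs : s ∈ T.latticeFaces) (q : ℤˣ × ℤˣ) :
    s.image (reflect q) ∈ T.diamondFaces := ⟨q, s, hs, rfl⟩

theorem mem_cells_iff {n : ℕ} {c : Cell d} :
    c ∈ T.cells n ↔ ∃ s ∈ T.latticeFaces, s.card = n + 1 ∧ ∃ q, c = cellOf d s q := by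
  constructor
  · rintro ⟨_, ⟨q, s, hs, rfl⟩, hc, rfl⟩
    rw [Finset.card_image_of_injective _ (reflect_injective q)] at hc
    exact ⟨s, hs, hc, q, rfl⟩
  · rintro ⟨s, hs, hc, q, rfl⟩
    exact ⟨_, mem_diamondFaces hs q,
      by rw [Finset.card_image_of_injective _ (reflect_injective q), hc], rfl⟩

theorem isFace_cellOf_iff {t : Finset (ℤ × ℤ)} (ht : t ∈ T.latticeFaces) {q : ℤˣ × ℤˣ}
    {a : Cell d} : T.IsFace a (cellOf d t q) ↔ ∃ s ⊆ t, s.Nonempty ∧ a = cellOf d s q := by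
  have hmem : ∀ {s}, s ∈ T.latticeFaces → ∀ v ∈ s, v ∈ latticePoints d :=
    fun hs v hv => mem_latticePoints_of_mem hs hv
  constructor
  · rintro ⟨_, ⟨p, s, hs, rfl⟩, _, ⟨p', t', ht', rfl⟩, hsub, rfl, h⟩
    change cellOf d t q = cellOf d t' p' at h
    obtain rfl := ((cellOf_eq_iff (hmem ht) (hmem ht')).1 h).1
    have hs' : s ⊆ t ∧ s.image (reflect p) = s.image (reflect p') := by
      have h1 : ∀ v ∈ s, v ∈ t ∧ reflect p v = reflect p' v := by
        intro v hv
        obtain ⟨w, hw, hwv⟩ := Finset.mem_image.1 (hsub (Finset.mem_image_of_mem _ hv))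
        obtain rfl := eq_of_reflect_eq (hmem ht w hw) (hmem hs v hv) hwv
        exact ⟨hw, hwv.symm⟩
      exact ⟨fun v hv => (h1 v hv).1, Finset.image_congr fun v hv => (h1 v hv).2⟩
    refine ⟨s, hs'.1, latticeFaces_nonempty hs, ?_⟩
    rw [cellOf_eq_of_subset (hmem ht) hs'.1 h, cellOf, hs'.2]
  · rintro ⟨s, hst, hne, rfl⟩
    exact ⟨_, mem_diamondFaces (latticeFaces_down ht hst hne) q, _, mem_diamondFaces ht q,
      Finset.image_subset_image hst, rfl, rfl⟩

theorem quad_ne_of_edge (hd : 1 ≤ d) (hT : T.IsUnimodular) {u w : ℤ × ℤ}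
    (he : {u, w} ∈ T.latticeFaces) (huw : u ≠ w) : quad u ≠ quad w := by
  intro h
  obtain ⟨t, ht, hsub⟩ := exists_triangle_of_face hd hT he
  exact huw (eq_of_quad_eq hT ht (hsub (by simp)) (hsub (by simp)) h)

/-- The four copies of a triangle are different cells of `S`: if two of them agreed, then two edges
at a vertex would determine the same change of quadrants, and their other endpoints would lie in the
same parity class. -/
theorem cellOf_triangle_inj (hT : T.IsUnimodular) {s t : Finset (ℤ × ℤ)} (hs : s ∈ T.triangles)
    (ht : t ∈ T.triangles) {q q' : ℤˣ × ℤˣ} (h : cellOf d s q = cellOf d t q') :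
    s = t ∧ q = q' := by
  have hmem : ∀ {s}, s ∈ T.triangles → ∀ v ∈ s, v ∈ latticePoints d :=
    fun hs v hv => mem_latticePoints_of_mem hs.1 hv
  obtain rfl := ((cellOf_eq_iff (hmem hs) (hmem ht)).1 h).1
  refine ⟨rfl, ?_⟩
  by_contra hq
  obtain ⟨u, v, w, rfl⟩ := exists_eq_triple hs
  obtain ⟨huv, hvw, huw⟩ := ne_of_card_triple hs.2
  have huv' := isBoundaryEdge_of_cellOf_eq (hmem hs u (by simp)) (hmem hs v (by simp))
    (fun h => huv (eq_of_quad_eq hT hs (by simp) (by simp) h)) hq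
    (cellOf_eq_of_subset (hmem hs) (by grind) h)
  have huw' := isBoundaryEdge_of_cellOf_eq (hmem hs u (by simp)) (hmem hs w (by simp))
    (fun h => huw (eq_of_quad_eq hT hs (by simp) (by simp) h)) hq
    (cellOf_eq_of_subset (hmem hs) (by grind) h)
  exact hvw (eq_of_quad_eq hT hs (by simp) (by simp)
    (mul_left_cancel (mul_left_cancel (huv'.2.symm.trans huw'.2))))

/-! ### Signs -/

/-- In quadrant `q`, the isolated points are exactly those of one sign. -/
theorem extendSign_reflect (q : ℤˣ × ℤˣ) {v : ℤ × ℤ} (h1 : 0 ≤ v.1) (h2 : 0 ≤ v.2) :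
    extendSign harnackSign (reflect q v) =
      (if q = 1 then 0 else 1) + if quad v = q then 1 else 0 := by
  have habs := absPt_reflect (q := q) h1 h2
  have hx : ∀ (a : ℤˣ) (x : ℤ), 0 ≤ x →
      (if (a : ℤ) * x < 0 then (((a : ℤ) * x : ℤ) : ZMod 2) else 0) =
        if a = 1 then 0 else (x : ZMod 2) := by
    intro a x hx
    rcases Int.units_eq_one_or a with rfl | rfl
    · simp [not_lt.2 hx]
    · rcases hx.eq_or_lt with rfl | hx
      · simp
      · simp [hx, ZMod.neg_eq_self_mod_two]
  have : extendSign harnackSign (reflect q v) = harnackSign v +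
      (if q.1 = 1 then 0 else (v.1 : ZMod 2)) + if q.2 = 1 then 0 else (v.2 : ZMod 2) := by
    rw [extendSign, habs, ← hx q.1 v.1 h1, ← hx q.2 v.2 h2]
    rfl
  rw [this]
  obtain ⟨a, b⟩ := q
  obtain ⟨x, y⟩ := v
  simp only [harnackSign]
  have hz0 : ∀ n : ℤ, Even n → (n : ZMod 2) = 0 := fun n hn => (ZMod.intCast_eq_zero_iff_even).2 hn
  have hz1 : ∀ n : ℤ, Odd n → (n : ZMod 2) = 1 := fun n hn => (ZMod.intCast_eq_one_iff_odd).2 hn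
  push_cast
  -- only the parities of the coordinates and the quadrant matter
  rcases Int.even_or_odd x with hx | hx <;> rcases Int.even_or_odd y with hy | hy <;>
    [rw [hz0 x hx, hz0 y hy, show quad (x, y) = (1, 1) from
        Prod.ext (Int.negOnePow_even _ hy) (Int.negOnePow_even _ hx)];
     rw [hz0 x hx, hz1 y hy, show quad (x, y) = (-1, 1) from
        Prod.ext (Int.negOnePow_odd _ hy) (Int.negOnePow_even _ hx)];
     rw [hz1 x hx, hz0 y hy, show quad (x, y) = (1, -1) from
        Prod.ext (Int.negOnePow_even _ hy) (Int.negOnePow_odd _ hx)];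
     rw [hz1 x hx, hz1 y hy, show quad (x, y) = (-1, -1) from
        Prod.ext (Int.negOnePow_odd _ hy) (Int.negOnePow_odd _ hx)]] <;>
    rcases Int.units_eq_one_or a with rfl | rfl <;>
    rcases Int.units_eq_one_or b with rfl | rfl <;> decide

/-- The bicolored edges are those with an isolated endpoint. -/
theorem mem_bicoloredEdges_iff (hd : 1 ≤ d) (hT : T.IsUnimodular) {e : Cell d} :
    e ∈ bicoloredEdges T harnackSign ↔ ∃ u w, {u, w} ∈ T.latticeFaces ∧ u ≠ w ∧
      e = cellOf d {u, w} (quad u) := by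
  constructor
  · rintro ⟨x, y, ⟨q, s, hs, hxy⟩, hne, rfl⟩
    have hsc : s.card = 2 := by
      rw [← Finset.card_image_of_injective _ (reflect_injective q), ← hxy]
      exact Finset.card_pair (by rintro rfl; exact hne rfl)
    obtain ⟨u, w, huw, rfl⟩ := Finset.card_eq_two.1 hsc
    have hq := quad_ne_of_edge hd hT hs huw
    obtain ⟨hu1, hu2, -⟩ := mem_latticePoints_of_mem hs (v := u) (by simp)
    obtain ⟨hw1, hw2, -⟩ := mem_latticePoints_of_mem hs (v := w) (by simp)
    have hne' : extendSign harnackSign (reflect q u) ≠ extendSign harnackSign (reflect q w) := by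
      intro h
      have hall : ∀ z ∈ ({x, y} : Finset (ℤ × ℤ)), extendSign harnackSign z =
          extendSign harnackSign (reflect q u) := by
        rw [hxy]; simp [h]
      exact hne ((hall x (by simp)).trans (hall y (by simp)).symm)
    rw [extendSign_reflect q hu1 hu2, extendSign_reflect q hw1 hw2] at hne'
    rw [hxy]
    by_cases hu : quad u = q
    · exact ⟨u, w, hs, huw, by rw [hu]; rfl⟩
    · by_cases hw : quad w = q
      · exact ⟨w, u, Finset.pair_comm u w ▸ hs, huw.symm, by
          rw [hw, Finset.pair_comm]; rfl⟩
      · simp [hu, hw] at hne'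
  · rintro ⟨u, w, hs, huw, rfl⟩
    have hq := quad_ne_of_edge hd hT hs huw
    obtain ⟨hu1, hu2, -⟩ := mem_latticePoints_of_mem hs (v := u) (by simp)
    obtain ⟨hw1, hw2, -⟩ := mem_latticePoints_of_mem hs (v := w) (by simp)
    refine ⟨reflect (quad u) u, reflect (quad u) w, ?_, ?_, ?_⟩
    · have := mem_diamondFaces hs (quad u)
      rwa [Finset.image_insert, Finset.image_singleton] at this
    · rw [extendSign_reflect _ hu1 hu2, extendSign_reflect _ hw1 hw2]
      simp [hq.symm]
    · rw [cellOf, Finset.image_insert, Finset.image_singleton]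

end Cells

section Loops

variable {d : ℕ} {T : Triangulation d}

/-! ### The loops of the curve -/

/-- The label of the loop which passes an isolated copy of the lattice point `v`: an interior point
is surrounded by a loop of its own, while all boundary points belong to one further loop, with label
`none`. -/
def tag (d : ℕ) (v : ℤ × ℤ) : Option (ℤ × ℤ) :=
  if 0 < v.1 ∧ 0 < v.2 ∧ v.1 + v.2 < d then some v else none

theorem tag_eq_some_iff {u v : ℤ × ℤ} :
    tag d u = some v ↔ u = v ∧ 0 < v.1 ∧ 0 < v.2 ∧ v.1 + v.2 < d := by
  unfold tag
  split_ifs with h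
  · simp only [Option.some.injEq]
    exact ⟨fun e => ⟨e, e ▸ h⟩, fun e => e.1⟩
  · simp only [false_iff]
    rintro ⟨rfl, h'⟩
    exact h h'

theorem tag_eq_none_iff {v : ℤ × ℤ} (hv : v ∈ latticePoints d) :
    tag d v = none ↔ v.1 = 0 ∨ v.2 = 0 ∨ v.1 + v.2 = d := by
  obtain ⟨h1, h2, h3⟩ := hv
  unfold tag
  split_ifs with h
  · simp only [false_iff]; omega
  · simp only [true_iff]; omega

theorem IsBoundaryEdge.tag_eq_none {u w : ℤ × ℤ} (h : IsBoundaryEdge d u w) : tag d u = none := by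
  unfold IsBoundaryEdge at h
  rw [tag, if_neg (by omega)]

theorem mul_quad_mul_quad (u w : ℤ × ℤ) : quad u * (quad u * quad w) = quad w := by
  ext1 <;> simp [quad, ← mul_assoc]

theorem isFace_pair {t : Finset (ℤ × ℤ)} (ht : t ∈ T.triangles)
    {u w : ℤ × ℤ} (hu : u ∈ t) (hw : w ∈ t) (q : ℤˣ × ℤˣ) :
    T.IsFace (cellOf d {u, w} q) (cellOf d t q) :=
  (isFace_cellOf_iff ht.1).2 ⟨{u, w}, by grind, by simp, rfl⟩

/-- The node of the curve in the triangle `t` which separates the isolated vertex `v` of a copy of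
`t` from the other two vertices. -/
def mkNode (hd : 1 ≤ d) (hT : T.IsUnimodular) {t : Finset (ℤ × ℤ)} (ht : t ∈ T.triangles)
    {v : ℤ × ℤ} (hv : v ∈ t) : CurveNode T harnackSign :=
  ⟨cellOf d t (quad v), mem_cells_iff.2 ⟨t, ht.1, ht.2, _, rfl⟩, by
    obtain ⟨w, hw, hwv⟩ := Finset.exists_mem_ne (by rw [ht.2]; norm_num) v
    exact ⟨_, (mem_bicoloredEdges_iff hd hT).2
      ⟨v, w, latticeFaces_down ht.1 (by grind) (by simp), hwv.symm, rfl⟩,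
      isFace_pair ht hv hw _⟩⟩

theorem eq_or_eq_of_cellOf_eq (hd : 1 ≤ d) (hT : T.IsUnimodular) {u w : ℤ × ℤ} {q : ℤˣ × ℤˣ}
    (he : {u, w} ∈ T.latticeFaces) (huw : u ≠ w)
    (h : cellOf d {u, w} (quad u) = cellOf d {u, w} q) :
    q = quad u ∨ (q = quad w ∧ IsBoundaryEdge d u w) := by
  by_cases hq : quad u = q
  · exact Or.inl hq.symm
  · have := isBoundaryEdge_of_cellOf_eq (mem_latticePoints_of_mem he (by simp))
      (mem_latticePoints_of_mem he (by simp)) (quad_ne_of_edge hd hT he huw) hq h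
    rw [mul_quad_mul_quad] at this
    exact Or.inr ⟨this.2, this.1⟩

/-- The triangles of `S` at the bicolored edge `{u, w}` with isolated endpoint `u`: they lie in the
quadrant in which `u` is isolated or, for an edge in the boundary, in the one in which `w` is. -/
theorem face_of_crossed (hd : 1 ≤ d) (hT : T.IsUnimodular) {u w : ℤ × ℤ}
    (he : {u, w} ∈ T.latticeFaces) (huw : u ≠ w) {t : Finset (ℤ × ℤ)} (ht : t ∈ T.triangles)
    {q : ℤˣ × ℤˣ} (h : T.IsFace (cellOf d {u, w} (quad u)) (cellOf d t q)) :
    u ∈ t ∧ w ∈ t ∧ (q = quad u ∨ (q = quad w ∧ IsBoundaryEdge d u w)) := by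
  obtain ⟨s, hst, hne, hs⟩ := (isFace_cellOf_iff ht.1).1 h
  have hsF := latticeFaces_down ht.1 hst hne
  obtain rfl := ((cellOf_eq_iff (fun v hv => mem_latticePoints_of_mem he hv)
    (fun v hv => mem_latticePoints_of_mem hsF hv)).1 hs).1
  exact ⟨hst (by simp), hst (by simp), eq_or_eq_of_cellOf_eq hd hT he huw hs⟩

theorem exists_eq_mkNode (hd : 1 ≤ d) (hT : T.IsUnimodular) (a : CurveNode T harnackSign) :
    ∃ (t : Finset (ℤ × ℤ)) (ht : t ∈ T.triangles) (v : ℤ × ℤ) (hv : v ∈ t),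
      a = mkNode hd hT ht hv := by
  obtain ⟨c, hc, e, he, hec⟩ := a
  obtain ⟨t, ht, htc, q, rfl⟩ := mem_cells_iff.1 hc
  obtain ⟨u, w, hF, huw, rfl⟩ := (mem_bicoloredEdges_iff hd hT).1 he
  obtain ⟨hu, hw, rfl | ⟨rfl, -⟩⟩ := face_of_crossed hd hT hF huw ⟨ht, htc⟩ hec
  · exact ⟨t, ⟨ht, htc⟩, u, hu, rfl⟩
  · exact ⟨t, ⟨ht, htc⟩, w, hw, rfl⟩

theorem mkNode_inj (hd : 1 ≤ d) (hT : T.IsUnimodular) {s t : Finset (ℤ × ℤ)}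
    {hs : s ∈ T.triangles} {ht : t ∈ T.triangles} {u v : ℤ × ℤ} {hu : u ∈ s} {hv : v ∈ t}
    (h : mkNode hd hT hs hu = mkNode hd hT ht hv) : s = t ∧ u = v := by
  obtain ⟨rfl, hq⟩ := cellOf_triangle_inj hT hs ht (congrArg Subtype.val h)
  exact ⟨rfl, eq_of_quad_eq hT hs hu hv hq⟩

/-- The label of the loop through a node. -/
noncomputable def nodeTag (hd : 1 ≤ d) (hT : T.IsUnimodular) (a : CurveNode T harnackSign) :
    Option (ℤ × ℤ) :=
  tag d (exists_eq_mkNode hd hT a).choose_spec.choose_spec.choose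

theorem nodeTag_mkNode (hd : 1 ≤ d) (hT : T.IsUnimodular) {t : Finset (ℤ × ℤ)}
    (ht : t ∈ T.triangles) {v : ℤ × ℤ} (hv : v ∈ t) :
    nodeTag hd hT (mkNode hd hT ht hv) = tag d v := by
  have h := (exists_eq_mkNode hd hT (mkNode hd hT ht hv)).choose_spec.choose_spec.choose_spec
  obtain ⟨h1, h2⟩ := h
  rw [nodeTag, ← (mkNode_inj hd hT h2).2]

theorem nodeTag_eq_of_isFace (hd : 1 ≤ d) (hT : T.IsUnimodular) {u w : ℤ × ℤ}
    (he : {u, w} ∈ T.latticeFaces) (huw : u ≠ w) (a : CurveNode T harnackSign)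
    (h : T.IsFace (cellOf d {u, w} (quad u)) a.1) : nodeTag hd hT a = tag d u := by
  obtain ⟨t, ht, v, hv, rfl⟩ := exists_eq_mkNode hd hT a
  rw [nodeTag_mkNode]
  obtain ⟨hu, hw, hq | ⟨hq, hb⟩⟩ := face_of_crossed hd hT he huw ht h
  · rw [eq_of_quad_eq hT ht hv hu hq]
  · rw [eq_of_quad_eq hT ht hv hw hq, hb.tag_eq_none, hb.symm.tag_eq_none]

theorem nodeTag_eq_of_reachable (hd : 1 ≤ d) (hT : T.IsUnimodular) {a b : CurveNode T harnackSign}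
    (h : (curve T harnackSign).Reachable a b) : nodeTag hd hT a = nodeTag hd hT b := by
  obtain ⟨p⟩ := h
  induction p with
  | nil => rfl
  | cons h _ ih =>
    refine Eq.trans ?_ ih
    obtain ⟨-, e, he, ha, hb⟩ := h
    obtain ⟨u, w, hF, huw, rfl⟩ := (mem_bicoloredEdges_iff hd hT).1 he
    rw [nodeTag_eq_of_isFace hd hT hF huw _ ha, nodeTag_eq_of_isFace hd hT hF huw _ hb]

theorem reachable_of_isFace {a b : CurveNode T harnackSign} {e : Cell d}
    (he : e ∈ bicoloredEdges T harnackSign) (ha : T.IsFace e a.1) (hb : T.IsFace e b.1) :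
    (curve T harnackSign).Reachable a b := by
  by_cases h : a = b
  · rw [h]
  · exact SimpleGraph.Adj.reachable ⟨h, e, he, ha, hb⟩

theorem reachable_star (hd : 1 ≤ d) (hT : T.IsUnimodular) {s t : Finset (ℤ × ℤ)}
    (hs : s ∈ T.triangles) (ht : t ∈ T.triangles) {v : ℤ × ℤ} (hvs : v ∈ s) (hvt : v ∈ t) :
    (curve T harnackSign).Reachable (mkNode hd hT hs hvs) (mkNode hd hT ht hvt) := by
  have hch := star_chain hd hT hs ht hvs hvt
  induction hch with
  | refl => exact .refl _
  | tail _ h ih =>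
    obtain ⟨⟨hb, hvb⟩, ⟨hc, hvc⟩, w, hwv, hwb, hwc⟩ := h
    refine (ih hb hvb).trans (reachable_of_isFace (e := cellOf d {v, w} (quad v)) ?_ ?_ ?_)
    · exact (mem_bicoloredEdges_iff hd hT).2
        ⟨v, w, latticeFaces_down hb.1 (by grind) (by simp), hwv.symm, rfl⟩
    · exact isFace_pair hb hvb hwb _
    · exact isFace_pair hc hvc hwc _

/-- The curve passes from the star of a boundary point to the star of the next boundary point: their
common boundary edge lies in the quadrants in which the one or the other is isolated. -/
theorem reachable_of_isBoundaryEdge (hd : 1 ≤ d) (hT : T.IsUnimodular) {u w : ℤ × ℤ}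
    (huw : u ≠ w) (hb : IsBoundaryEdge d u w) (he : {u, w} ∈ T.latticeFaces) {s t : Finset (ℤ × ℤ)}
    (hs : s ∈ T.triangles) (ht : t ∈ T.triangles) (hus : u ∈ s) (hwt : w ∈ t) :
    (curve T harnackSign).Reachable (mkNode hd hT hs hus) (mkNode hd hT ht hwt) := by
  obtain ⟨r, hr, hsub⟩ := exists_triangle_of_face hd hT he
  have hur : u ∈ r := hsub (by simp)
  have hwr : w ∈ r := hsub (by simp)
  refine (reachable_star hd hT hs hr hus hur).trans (.trans ?_ (reachable_star hd hT hr ht hwr hwt))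
  refine reachable_of_isFace (e := cellOf d {u, w} (quad u))
    ((mem_bicoloredEdges_iff hd hT).2 ⟨u, w, he, huw, rfl⟩) (isFace_pair hr hur hwr _) ?_
  rw [cellOf_mul_of_isBoundaryEdge _ (mem_latticePoints_of_mem he (by simp))
    (mem_latticePoints_of_mem he (by simp)) (quad_ne_of_edge hd hT he huw) hb, mul_quad_mul_quad]
  exact isFace_pair hr hur hwr _

/-- All nodes at boundary points lie on one loop, as one can pass from point to point along the
sides of `d·Δ₂` to the origin. -/
theorem reachable_origin (hd : 1 ≤ d) (hT : T.IsUnimodular) {u : ℤ × ℤ}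
    (hu : u ∈ latticePoints d) (hb : tag d u = none) {s t : Finset (ℤ × ℤ)} (hs : s ∈ T.triangles)
    (ht : t ∈ T.triangles) (hus : u ∈ s) (h0t : (0, 0) ∈ t) :
    (curve T harnackSign).Reachable (mkNode hd hT hs hus) (mkNode hd hT ht h0t) := by
  set R : ℤ × ℤ → ℤ × ℤ → Prop := fun u w => ∀ (s t : Finset (ℤ × ℤ)) (hs : s ∈ T.triangles)
    (ht : t ∈ T.triangles) (hus : u ∈ s) (hwt : w ∈ t),
    (curve T harnackSign).Reachable (mkNode hd hT hs hus) (mkNode hd hT ht hwt)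
  have htrans : ∀ u v w, v ∈ latticePoints d → R u v → R v w → R u w := by
    intro u v w hv h1 h2 s t hs ht hus hwt
    obtain ⟨r, hr, hvr⟩ := exists_triangle_of_vertex hd hT hv
    exact (h1 s r hs hr hus hvr).trans (h2 r t hr ht hvr hwt)
  have hleft : ∀ n : ℕ, n ≤ d → R (0, (n : ℤ)) (0, 0) := by
    intro n
    induction n with
    | zero => exact fun _ s t hs ht h h' => reachable_star hd hT hs ht h h'
    | succ n ih =>
      intro hn
      refine htrans _ (0, (n : ℤ)) _ ⟨le_rfl, by simp, by simp; omega⟩ ?_ (ih (by omega))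
      intro s t hs ht h h'
      refine reachable_of_isBoundaryEdge hd hT (by simp) (Or.inl ⟨rfl, rfl⟩) ?_ hs ht h h'
      rw [Finset.pair_comm]
      exact_mod_cast left_pair_mem hd hT (j := n) (by omega) (by omega)
  have hbottom : ∀ n : ℕ, n ≤ d → R ((n : ℤ), 0) (0, 0) := by
    intro n
    induction n with
    | zero => exact fun _ s t hs ht h h' => reachable_star hd hT hs ht h h'
    | succ n ih =>
      intro hn
      refine htrans _ ((n : ℤ), 0) _ ⟨by simp, le_rfl, by simp; omega⟩ ?_ (ih (by omega))
      intro s t hs ht h h'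
      refine reachable_of_isBoundaryEdge hd hT (by simp) (Or.inr (Or.inl ⟨rfl, rfl⟩)) ?_ hs ht h h'
      rw [Finset.pair_comm]
      exact_mod_cast bottom_pair_mem hd hT (i := n) (by omega) (by omega)
  have hdiag : ∀ n : ℕ, n ≤ d → R ((n : ℤ), d - n) (0, 0) := by
    intro n
    induction n with
    | zero => intro _; simpa using hleft d le_rfl
    | succ n ih =>
      intro hn
      refine htrans _ ((n : ℤ), d - n) _ ⟨by simp, by simp; omega, by simp⟩ ?_ (ih (by omega))
      intro s t hs ht h h'
      refine reachable_of_isBoundaryEdge hd hT (by simp)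
        (Or.inr (Or.inr ⟨by simp, by simp⟩)) ?_ hs ht h h'
      rw [Finset.pair_comm]
      exact_mod_cast diagonal_pair_mem hd hT (i := n) (by omega) (by omega)
  have hR : R u (0, 0) := by
    obtain ⟨u1, u2⟩ := u
    have hb := (tag_eq_none_iff hu).1 hb
    obtain ⟨h1, h2, h3⟩ := hu
    simp only at h1 h2 h3 hb
    lift u1 to ℕ using h1
    lift u2 to ℕ using h2
    rcases hb with h | h | h
    · rw [h]; exact hleft u2 (by omega)
    · rw [h]; exact hbottom u1 (by omega)
    · rw [show (u2 : ℤ) = d - u1 by omega]; exact hdiag u1 (by omega)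
  exact hR s t hs ht hus h0t

theorem zero_mem_latticePoints (d : ℕ) : ((0 : ℤ), (0 : ℤ)) ∈ latticePoints d :=
  ⟨le_rfl, le_rfl, by simp⟩

/-- Two nodes lie on the same loop if and only if their labels agree. -/
theorem reachable_iff (hd : 1 ≤ d) (hT : T.IsUnimodular) {a b : CurveNode T harnackSign} :
    (curve T harnackSign).Reachable a b ↔ nodeTag hd hT a = nodeTag hd hT b := by
  refine ⟨nodeTag_eq_of_reachable hd hT, fun h => ?_⟩
  obtain ⟨s, hs, u, hu, rfl⟩ := exists_eq_mkNode hd hT a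
  obtain ⟨t, ht, v, hv, rfl⟩ := exists_eq_mkNode hd hT b
  rw [nodeTag_mkNode, nodeTag_mkNode] at h
  cases htag : tag d u with
  | none =>
    obtain ⟨r, hr, h0⟩ := exists_triangle_of_vertex hd hT (zero_mem_latticePoints d)
    exact (reachable_origin hd hT (mem_latticePoints_of_mem hs.1 hu) htag hs hr hu h0).trans
      (reachable_origin hd hT (mem_latticePoints_of_mem ht.1 hv) (h ▸ htag) ht hr hv h0).symm
  | some x =>
    obtain ⟨rfl, -⟩ := tag_eq_some_iff.1 htag
    obtain ⟨rfl, -⟩ := tag_eq_some_iff.1 (h ▸ htag)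
    exact reachable_star hd hT hs ht hu hv

/-- The label of a loop. -/
noncomputable def loopTag (hd : 1 ≤ d) (hT : T.IsUnimodular) (L : Loop T harnackSign) :
    Option (ℤ × ℤ) :=
  L.lift (nodeTag hd hT) fun _ _ p _ => nodeTag_eq_of_reachable hd hT p.reachable

theorem loopTag_eq_of_mem (hd : 1 ≤ d) (hT : T.IsUnimodular) {L : Loop T harnackSign}
    {a : CurveNode T harnackSign} : a ∈ L.supp ↔ nodeTag hd hT a = loopTag hd hT L := by
  induction L using SimpleGraph.ConnectedComponent.ind with
  | h b =>
    rw [SimpleGraph.ConnectedComponent.mem_supp_iff, SimpleGraph.ConnectedComponent.eq,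
      reachable_iff hd hT]
    rfl

theorem loopTag_injective (hd : 1 ≤ d) (hT : T.IsUnimodular) :
    Function.Injective (loopTag hd hT : Loop T harnackSign → _) := by
  intro L M h
  obtain ⟨a, ha⟩ := L.nonempty_supp
  have hM : a ∈ M.supp := (loopTag_eq_of_mem hd hT).2 (((loopTag_eq_of_mem hd hT).1 ha).trans h)
  exact ha.symm.trans hM

theorem exists_loopTag_eq (hd : 1 ≤ d) (hT : T.IsUnimodular) {v : ℤ × ℤ}
    (hv : v ∈ latticePoints d) : ∃ L : Loop T harnackSign, loopTag hd hT L = tag d v := by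
  obtain ⟨t, ht, hvt⟩ := exists_triangle_of_vertex hd hT hv
  exact ⟨(curve T harnackSign).connectedComponentMk (mkNode hd hT ht hvt),
    nodeTag_mkNode hd hT ht hvt⟩

theorem exists_tag_eq (hd : 1 ≤ d) (hT : T.IsUnimodular) (L : Loop T harnackSign) :
    ∃ v ∈ latticePoints d, loopTag hd hT L = tag d v := by
  obtain ⟨a, ha⟩ := L.nonempty_supp
  obtain ⟨t, ht, v, hv, rfl⟩ := exists_eq_mkNode hd hT a
  exact ⟨v, mem_latticePoints_of_mem ht.1 hv,
    ((loopTag_eq_of_mem hd hT).1 ha).symm.trans (nodeTag_mkNode hd hT ht hv)⟩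

theorem mem_crossedEdges_iff (hd : 1 ≤ d) (hT : T.IsUnimodular) {L : Loop T harnackSign}
    {e : Cell d} : e ∈ crossedEdges L ↔ ∃ u w, {u, w} ∈ T.latticeFaces ∧ u ≠ w ∧
      e = cellOf d {u, w} (quad u) ∧ tag d u = loopTag hd hT L := by
  constructor
  · rintro ⟨he, a, ha, hea⟩
    obtain ⟨u, w, hF, huw, rfl⟩ := (mem_bicoloredEdges_iff hd hT).1 he
    exact ⟨u, w, hF, huw, rfl, (nodeTag_eq_of_isFace hd hT hF huw a hea).symm.trans
      ((loopTag_eq_of_mem hd hT).1 ha)⟩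
  · rintro ⟨u, w, hF, huw, rfl, htag⟩
    obtain ⟨t, ht, hsub⟩ := exists_triangle_of_face hd hT hF
    exact ⟨(mem_bicoloredEdges_iff hd hT).2 ⟨u, w, hF, huw, rfl⟩,
      mkNode hd hT ht (v := u) (hsub (by simp)),
      (loopTag_eq_of_mem hd hT).2 ((nodeTag_mkNode hd hT ht _).trans htag),
      isFace_pair ht (hsub (by simp)) (hsub (by simp)) _⟩

/-- The loop with label `l` separates the copy of the lattice point `u` in quadrant `q` from all
neighbouring points in this quadrant. -/
def IsCutOff (d : ℕ) (l : Option (ℤ × ℤ)) (u : ℤ × ℤ) (q : ℤˣ × ℤˣ) : Prop :=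
  quad u = q ∧ tag d u = l

/-- The edges crossed by a loop are those with an endpoint which is cut off by it. -/
theorem cellOf_mem_crossedEdges (hd : 1 ≤ d) (hT : T.IsUnimodular) {L : Loop T harnackSign}
    {u w : ℤ × ℤ} (he : {u, w} ∈ T.latticeFaces) (huw : u ≠ w) {q : ℤˣ × ℤˣ} :
    cellOf d {u, w} q ∈ crossedEdges L ↔
      IsCutOff d (loopTag hd hT L) u q ∨ IsCutOff d (loopTag hd hT L) w q := by
  rw [mem_crossedEdges_iff hd hT]
  constructor
  · rintro ⟨x, y, hF, hxy, h, htag⟩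
    have hs := ((cellOf_eq_iff (fun v hv => mem_latticePoints_of_mem he hv)
      (fun v hv => mem_latticePoints_of_mem hF hv)).1 h).1
    rw [hs] at h
    have hx : (u = x ∧ w = y) ∨ (u = y ∧ w = x) := by
      have hu : u ∈ ({x, y} : Finset (ℤ × ℤ)) := hs ▸ (by simp)
      have hw : w ∈ ({x, y} : Finset (ℤ × ℤ)) := hs ▸ (by simp)
      grind
    rcases eq_or_eq_of_cellOf_eq hd hT hF hxy h.symm with rfl | ⟨rfl, hb⟩
    · rcases hx with ⟨rfl, rfl⟩ | ⟨rfl, rfl⟩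
      · exact Or.inl ⟨rfl, htag⟩
      · exact Or.inr ⟨rfl, htag⟩
    · have htag' : tag d y = loopTag hd hT L := by
        rw [← htag, hb.tag_eq_none, hb.symm.tag_eq_none]
      rcases hx with ⟨rfl, rfl⟩ | ⟨rfl, rfl⟩
      · exact Or.inr ⟨rfl, htag'⟩
      · exact Or.inl ⟨rfl, htag'⟩
  · rintro (⟨rfl, h⟩ | ⟨rfl, h⟩)
    · exact ⟨u, w, he, huw, rfl, h⟩
    · exact ⟨w, u, Finset.pair_comm u w ▸ he, huw.symm, by rw [Finset.pair_comm], h⟩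

end Loops

/-! ### Counting cells -/

/-- Double counting of incidences: each element of `E` lies in two elements of `F`, and an element
of `F` contains three elements of `E` if it belongs to `W`, and only one otherwise. -/
theorem two_mul_ncard_eq {α β : Type*} {E : Set α} {F W : Set β} (hE : E.Finite) (hF : F.Finite)
    (hWF : W ⊆ F) {I : α → β → Prop} (h1 : ∀ e ∈ E, {f ∈ F | I e f}.ncard = 2)
    (h2 : ∀ f ∈ F, (f ∈ W ∧ {e ∈ E | I e f}.ncard = 3) ∨ (f ∉ W ∧ {e ∈ E | I e f}.ncard = 1)) :
    2 * E.ncard = F.ncard + 2 * W.ncard := by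
  classical
  have key := Finset.sum_card_bipartiteAbove_eq_sum_card_bipartiteBelow (s := hE.toFinset)
    (t := hF.toFinset) I
  have e1 : ∀ e ∈ hE.toFinset, (hF.toFinset.bipartiteAbove I e).card = 2 := by
    intro e he
    rw [← h1 e (hE.mem_toFinset.1 he), ← Set.ncard_coe_finset]
    congr 1
    ext f
    simp [Finset.bipartiteAbove]
  have e2 : ∀ f ∈ hF.toFinset, (hE.toFinset.bipartiteBelow I f).card = if f ∈ W then 3 else 1 := by
    intro f hf
    have : (hE.toFinset.bipartiteBelow I f).card = {e ∈ E | I e f}.ncard := by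
      rw [← Set.ncard_coe_finset]
      congr 1
      ext e
      simp [Finset.bipartiteBelow]
    rw [this]
    rcases h2 f (hF.mem_toFinset.1 hf) with ⟨h, h'⟩ | ⟨h, h'⟩ <;> simp [h, h']
  rw [Finset.sum_congr rfl e1, Finset.sum_congr rfl e2, Finset.sum_const, smul_eq_mul] at key
  have e3 : ∑ f ∈ hF.toFinset, (if f ∈ W then 3 else 1) =
      ∑ f ∈ hF.toFinset, (1 + 2 * if f ∈ W then 1 else 0) :=
    Finset.sum_congr rfl fun f _ => by split_ifs <;> rfl
  have e4 : (hF.toFinset.filter (· ∈ W)).card = W.ncard := by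
    rw [← Set.ncard_coe_finset]
    congr 1
    ext f
    simpa using fun h => hWF h
  rw [e3, Finset.sum_add_distrib, ← Finset.mul_sum, Finset.sum_boole, e4, Finset.sum_const,
    smul_eq_mul, mul_one] at key
  rw [Set.ncard_eq_toFinset_card _ hE, Set.ncard_eq_toFinset_card _ hF]
  simp only [Nat.cast_id] at key
  omega

/-- The edges of a triangle without the vertices in `B`, of which there is at most one. -/
theorem card_powersetCard_sdiff {α : Type*} [DecidableEq α] {t B : Finset α} (ht : t.card = 3)
    (hB : B ⊆ t) (hB1 : B.card ≤ 1) :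
    (B = ∅ ∧ ((t \ B).powersetCard 2).card = 3) ∨
      (B.Nonempty ∧ ((t \ B).powersetCard 2).card = 1) := by
  rw [Finset.card_powersetCard, Finset.card_sdiff_of_subset hB, ht]
  rcases B.eq_empty_or_nonempty with h | h
  · left; subst h; simp
  · right
    have : B.card = 1 := by have := h.card_pos; omega
    rw [this]
    exact ⟨h, rfl⟩

section Euler

variable {d : ℕ} {T : Triangulation d}

variable (T) in
theorem cells_finite (n : ℕ) : (T.cells n).Finite := by
  refine (((latticeFaces_finite T).prod (Set.finite_univ (α := ℤˣ × ℤˣ))).image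
    fun x => cellOf d x.1 x.2).subset ?_
  intro c hc
  obtain ⟨s, hs, -, q, rfl⟩ := mem_cells_iff.1 hc
  exact ⟨(s, q), ⟨hs, mem_univ _⟩, rfl⟩

/-- Every edge of `S` lies in exactly two triangles of `S`. -/
theorem ncard_cofaces (hd : 1 ≤ d) (hT : T.IsUnimodular) {e : Cell d} (he : e ∈ T.cells 1) :
    {f ∈ T.cells 2 | T.IsFace e f}.ncard = 2 := by
  obtain ⟨s, hs, hsc, q, rfl⟩ := mem_cells_iff.1 he
  obtain ⟨u, w, huw, rfl⟩ := Finset.card_eq_two.1 hsc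
  have hq := quad_ne_of_edge hd hT hs huw
  have hu := mem_latticePoints_of_mem hs (v := u) (by simp)
  have hw := mem_latticePoints_of_mem hs (v := w) (by simp)
  have hface : ∀ t ∈ T.triangles, ∀ q', T.IsFace (cellOf d {u, w} q) (cellOf d t q') ↔
      {u, w} ⊆ t ∧ cellOf d {u, w} q = cellOf d {u, w} q' := by
    intro t ht q'
    rw [isFace_cellOf_iff ht.1]
    constructor
    · rintro ⟨s, hst, hne, h⟩
      obtain rfl := ((cellOf_eq_iff (fun v hv => mem_latticePoints_of_mem hs hv)
        (fun v hv => mem_latticePoints_of_mem (latticeFaces_down ht.1 hst hne) hv)).1 h).1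
      exact ⟨hst, h⟩
    · rintro ⟨hst, h⟩
      exact ⟨_, hst, by simp, h⟩
  by_cases hb : IsBoundaryEdge d u w
  · obtain ⟨t, ht, hsub⟩ := exists_triangle_of_face hd hT hs
    have hne : q ≠ q * (quad u * quad w) := by
      intro h
      have h1 : quad u * quad w = 1 := by simpa using h.symm
      have h2 := mul_quad_mul_quad u w
      rw [h1, mul_one] at h2
      exact hq h2
    refine Set.ncard_eq_two.2 ⟨cellOf d t q, cellOf d t (q * (quad u * quad w)),
      fun h => hne (cellOf_triangle_inj hT ht ht h).2, ?_⟩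
    ext f
    simp only [mem_ofPred_eq, mem_insert_iff, mem_singleton_iff]
    constructor
    · rintro ⟨hf, hef⟩
      obtain ⟨t', ht', htc', q', rfl⟩ := mem_cells_iff.1 hf
      obtain ⟨hsub', h⟩ := (hface t' ⟨ht', htc'⟩ q').1 hef
      obtain rfl := eq_of_isBoundaryEdge hT huw hb ht ⟨ht', htc'⟩ (hsub (by simp)) (hsub (by simp))
        (hsub' (by simp)) (hsub' (by simp))
      by_cases hqq : q = q'
      · exact Or.inl (hqq ▸ rfl)
      · rw [(isBoundaryEdge_of_cellOf_eq hu hw hq hqq h).2]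
        exact Or.inr rfl
    · rintro (rfl | rfl)
      · exact ⟨mem_cells_iff.2 ⟨t, ht.1, ht.2, _, rfl⟩, (hface t ht _).2 ⟨hsub, rfl⟩⟩
      · exact ⟨mem_cells_iff.2 ⟨t, ht.1, ht.2, _, rfl⟩,
          (hface t ht _).2 ⟨hsub, cellOf_mul_of_isBoundaryEdge q hu hw hq hb⟩⟩
  · suffices himg : {f ∈ T.cells 2 | T.IsFace (cellOf d {u, w} q) f} =
        (fun t => cellOf d t q) '' {t ∈ T.triangles | {u, w} ⊆ t} by
      rw [himg, InjOn.ncard_image fun s hs t ht h => (cellOf_triangle_inj hT hs.1 ht.1 h).1,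
        ncard_triangles_of_not_isBoundaryEdge hd hT huw hs hb]
    ext f
    constructor
    · rintro ⟨hf, hef⟩
      obtain ⟨t, ht, htc, q', rfl⟩ := mem_cells_iff.1 hf
      obtain ⟨hsub, h⟩ := (hface t ⟨ht, htc⟩ q').1 hef
      have hqq : q = q' := by
        by_contra hqq
        exact hb (isBoundaryEdge_of_cellOf_eq hu hw hq hqq h).1
      exact ⟨t, ⟨⟨ht, htc⟩, hsub⟩, hqq ▸ rfl⟩
    · rintro ⟨t, ⟨ht, hsub⟩, rfl⟩
      exact ⟨mem_cells_iff.2 ⟨t, ht.1, ht.2, _, rfl⟩, (hface t ht _).2 ⟨hsub, rfl⟩⟩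

theorem ncard_cells_two (hd : 1 ≤ d) (hT : T.IsUnimodular) : (T.cells 2).ncard = 4 * d ^ 2 := by
  have : T.cells 2 = (fun x : Finset (ℤ × ℤ) × (ℤˣ × ℤˣ) => cellOf d x.1 x.2) ''
      (T.triangles ×ˢ (univ : Set (ℤˣ × ℤˣ))) := by
    ext c
    rw [mem_cells_iff]
    constructor
    · rintro ⟨s, hs, hc, q, rfl⟩
      exact ⟨(s, q), ⟨⟨hs, hc⟩, mem_univ _⟩, rfl⟩
    · rintro ⟨⟨s, q⟩, ⟨hs, -⟩, rfl⟩
      exact ⟨s, hs.1, hs.2, q, rfl⟩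
  rw [this, InjOn.ncard_image, Set.ncard_prod, ncard_triangles hd hT, Set.ncard_univ,
    Nat.card_eq_fintype_card, Fintype.card_prod]
  · rw [show Fintype.card ℤˣ = 2 from rfl]; ring
  · rintro ⟨s, q⟩ ⟨hs, -⟩ ⟨t, q'⟩ ⟨ht, -⟩ h
    obtain ⟨h1, h2⟩ := cellOf_triangle_inj hT hs ht h
    exact Prod.ext h1 h2

/-! ### Vertices of the cell decomposition -/

theorem singleton_mem_latticeFaces (hd : 1 ≤ d) (hT : T.IsUnimodular) {v : ℤ × ℤ}
    (hv : v ∈ latticePoints d) : {v} ∈ T.latticeFaces := by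
  obtain ⟨t, ht, hvt⟩ := exists_triangle_of_vertex hd hT hv
  exact latticeFaces_down ht.1 (by simpa using hvt) (by simp)

theorem mem_cells_zero_iff (hd : 1 ≤ d) (hT : T.IsUnimodular) {c : Cell d} :
    c ∈ T.cells 0 ↔ ∃ v ∈ latticePoints d, ∃ q, c = cellOf d {v} q := by
  rw [mem_cells_iff]
  constructor
  · rintro ⟨s, hs, hc, q, rfl⟩
    obtain ⟨v, rfl⟩ := Finset.card_eq_one.1 hc
    exact ⟨v, mem_latticePoints_of_mem hs (by simp), q, rfl⟩
  · rintro ⟨v, hv, q, rfl⟩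
    exact ⟨{v}, singleton_mem_latticeFaces hd hT hv, by simp, q, rfl⟩

theorem sum_abs_Ioo (n : ℕ) : ∑ i ∈ Finset.Ioo (-((n + 1 : ℕ) : ℤ)) ((n + 1 : ℕ) : ℤ), |i| =
    n * (n + 1) := by
  induction n with
  | zero => rfl
  | succ n ih =>
    have : Finset.Ioo (-((n + 1 + 1 : ℕ) : ℤ)) ((n + 1 + 1 : ℕ) : ℤ) =
        insert (-((n + 1 : ℕ) : ℤ)) (insert ((n + 1 : ℕ) : ℤ)
          (Finset.Ioo (-((n + 1 : ℕ) : ℤ)) ((n + 1 : ℕ) : ℤ))) := by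
      ext i
      simp only [Finset.mem_Ioo, Finset.mem_insert]
      omega
    rw [this, Finset.sum_insert, Finset.sum_insert, ih]
    · rw [abs_neg, Nat.abs_cast]; push_cast; ring
    · simp
    · simp; omega

/-- A system of representatives for the vertices of `S`: all lattice points of the diamond except
`(-d, 0)` and those on the part of its boundary below the first axis. -/
noncomputable def vertexReps (d : ℕ) : Finset (Σ _ : ℤ, ℤ) :=
  insert ⟨d, 0⟩ ((Finset.Ioo (-(d : ℤ)) d).sigma fun i => Finset.Ioc (|i| - d) (d - |i|))

theorem card_vertexReps (hd : 1 ≤ d) : (vertexReps d).card = 2 * d ^ 2 + 1 := by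
  rw [vertexReps, Finset.card_insert_of_notMem (by simp), Finset.card_sigma]
  congr 1
  obtain ⟨n, rfl⟩ : ∃ n, d = n + 1 := ⟨d - 1, by omega⟩
  have : ((∑ i ∈ Finset.Ioo (-((n + 1 : ℕ) : ℤ)) ((n + 1 : ℕ) : ℤ),
      (Finset.Ioc (|i| - ((n + 1 : ℕ) : ℤ)) (((n + 1 : ℕ) : ℤ) - |i|)).card : ℕ) : ℤ) =
      2 * (n + 1) ^ 2 := by
    rw [Nat.cast_sum, Finset.sum_congr rfl (g := fun i => 2 * ((n + 1 : ℕ) : ℤ) - 2 * |i|)]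
    · rw [Finset.sum_sub_distrib, Finset.sum_const, ← Finset.mul_sum, sum_abs_Ioo, Int.card_Ioo,
        nsmul_eq_mul, Int.toNat_of_nonneg (by omega)]
      push_cast
      ring
    · intro i hi
      rw [Finset.mem_Ioo, ← abs_lt] at hi
      rw [Int.card_Ioc, Int.toNat_of_nonneg (by omega)]
      ring
  exact_mod_cast this

theorem ncard_cells_zero (hd : 1 ≤ d) (hT : T.IsUnimodular) :
    (T.cells 0).ncard = 2 * d ^ 2 + 1 := by
  set f : (Σ _ : ℤ, ℤ) → Cell d := fun x => Quotient.mk (antipodalSetoid d) {(x.1, x.2)} with hf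
  have hfeq : ∀ x y : Σ _ : ℤ, ℤ, f x = f y ↔ (x.1, x.2) = (y.1, y.2) ∨
      (|x.1| + |x.2| = d ∧ (y.1, y.2) = (-x.1, -x.2)) := by
    intro x y
    simp only [hf]
    rw [Quotient.eq]
    change ({(x.1, x.2)} : Finset (ℤ × ℤ)) = {(y.1, y.2)} ∨
      ((∀ v ∈ ({(x.1, x.2)} : Finset (ℤ × ℤ)), |v.1| + |v.2| = (d : ℤ)) ∧
        ({(y.1, y.2)} : Finset (ℤ × ℤ)) = antipode {(x.1, x.2)}) ↔ _
    simp [antipode]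
  have hmem : ∀ x : Σ _ : ℤ, ℤ, x ∈ vertexReps d ↔ (x.1 = d ∧ x.2 = 0) ∨
      (|x.1| < d ∧ |x.1| - d < x.2 ∧ x.2 ≤ d - |x.1|) := by
    rintro ⟨i, j⟩
    simp only [vertexReps, Finset.mem_insert, Finset.mem_sigma, Finset.mem_Ioo, Finset.mem_Ioc,
      Sigma.mk.injEq, heq_eq_eq, abs_lt]
  have himg : T.cells 0 = f '' (vertexReps d : Set (Σ _ : ℤ, ℤ)) := by
    ext c
    rw [mem_cells_zero_iff hd hT]
    constructor
    · rintro ⟨v, hv, q, rfl⟩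
      obtain ⟨x, hx⟩ : ∃ x : Σ _ : ℤ, ℤ, (x.1, x.2) = reflect q v :=
        ⟨⟨(reflect q v).1, (reflect q v).2⟩, rfl⟩
      have hc : cellOf d {v} q = f x := by
        simp only [cellOf, hf, Finset.image_singleton, hx]
      have hab := absPt_reflect (q := q) hv.1 hv.2.1
      have h1 : |x.1| = v.1 := by rw [← hab, ← hx]
      have h2 : |x.2| = v.2 := by rw [← hab, ← hx]
      have hle : |x.1| + |x.2| ≤ d := by rw [h1, h2]; exact hv.2.2
      rw [hc]
      by_cases hxR : x ∈ vertexReps d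
      · exact ⟨x, hxR, rfl⟩
      · refine ⟨⟨-x.1, -x.2⟩, ?_, ?_⟩
        · rw [hmem] at hxR
          rw [Finset.mem_coe, hmem]
          simp only [abs_neg]
          grind
        · rw [hfeq]
          rw [hmem] at hxR
          right
          simp only [abs_neg, neg_neg, and_true]
          grind
    · rintro ⟨x, hx, rfl⟩
      rw [Finset.mem_coe, hmem] at hx
      have hle : |x.1| + |x.2| ≤ d := by grind
      refine ⟨(|x.1|, |x.2|), ⟨abs_nonneg _, abs_nonneg _, hle⟩,
        (if x.1 < 0 then -1 else 1, if x.2 < 0 then -1 else 1), ?_⟩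
      simp only [cellOf, hf, Finset.image_singleton]
      congr 2
      ext
      · simp only [reflect]; split_ifs <;> simp <;> grind
      · simp only [reflect]; split_ifs <;> simp <;> grind
  rw [himg, InjOn.ncard_image, Set.ncard_coe_finset, card_vertexReps hd]
  intro x hx y hy h
  rw [Finset.mem_coe, hmem] at hx hy
  rcases (hfeq x y).1 h with h | ⟨h, h'⟩
  · simp only [Prod.mk.injEq] at h
    exact Sigma.ext h.1 (heq_of_eq h.2)
  · simp only [Prod.mk.injEq] at h'
    exfalso
    rw [h'.1, h'.2, abs_neg] at hy
    grind

end Euler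

/-! ### The sides of a loop -/

/-- If no edge leaves `D`, and both `D` and its complement are nonempty and connected, then these
are the two components of the graph. -/
theorem exists_two_components {V : Type*} (G : SimpleGraph V) {D : Set V} {a b : V} (ha : a ∈ D)
    (hb : b ∉ D) (hD : ∀ x ∈ D, G.Reachable x a) (hDc : ∀ x ∉ D, G.Reachable x b)
    (hcut : ∀ x y, G.Adj x y → x ∈ D → y ∈ D) :
    ∃ C C' : G.ConnectedComponent, C ≠ C' ∧ (∀ W, W = C ∨ W = C') ∧ C.supp = D ∧ C'.supp = Dᶜ := by
  have hclosed : ∀ x y, G.Reachable x y → x ∈ D → y ∈ D := by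
    rintro x y ⟨p⟩
    induction p with
    | nil => exact id
    | cons h _ ih => exact fun hx => ih (hcut _ _ h hx)
  refine ⟨G.connectedComponentMk a, G.connectedComponentMk b, ?_, ?_, ?_, ?_⟩
  · exact fun h => hb (hclosed _ _ (SimpleGraph.ConnectedComponent.exact h) ha)
  · intro W
    induction W using SimpleGraph.ConnectedComponent.ind with
    | h x =>
      by_cases hx : x ∈ D
      · exact Or.inl (SimpleGraph.ConnectedComponent.sound (hD x hx))
      · exact Or.inr (SimpleGraph.ConnectedComponent.sound (hDc x hx))
  · ext x
    rw [SimpleGraph.ConnectedComponent.mem_supp_iff, SimpleGraph.ConnectedComponent.eq]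
    exact ⟨fun h => hclosed _ _ h.symm ha, fun h => hD x h⟩
  · ext x
    rw [SimpleGraph.ConnectedComponent.mem_supp_iff, SimpleGraph.ConnectedComponent.eq]
    exact ⟨fun h hx => hb (hclosed _ _ h hx), fun h => hDc x h⟩

section Sides

variable {d : ℕ} {T : Triangulation d}

theorem IsCutOff.eq (hT : T.IsUnimodular) {l : Option (ℤ × ℤ)} {q : ℤˣ × ℤˣ}
    {t : Finset (ℤ × ℤ)} (ht : t ∈ T.triangles) {x y : ℤ × ℤ} (hx : x ∈ t) (hy : y ∈ t)
    (hxc : IsCutOff d l x q) (hyc : IsCutOff d l y q) : x = y :=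
  eq_of_quad_eq hT ht hx hy (hxc.1.trans hyc.1.symm)

/-- The edges of a triangle which avoid the at most one vertex in `P`. -/
theorem powersetCard_cases {P : ℤ × ℤ → Prop} {t : Finset (ℤ × ℤ)} (ht : t ∈ T.triangles)
    (hP : ∀ x ∈ t, ∀ y ∈ t, P x → P y → x = y) :
    ((∀ x ∈ t, ¬ P x) ∧ {p : Finset (ℤ × ℤ) | p ⊆ t ∧ p.card = 2 ∧ ∀ x ∈ p, ¬ P x}.ncard = 3) ∨
      ((∃ x ∈ t, P x) ∧
        {p : Finset (ℤ × ℤ) | p ⊆ t ∧ p.card = 2 ∧ ∀ x ∈ p, ¬ P x}.ncard = 1) := by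
  classical
  have hset : {p : Finset (ℤ × ℤ) | p ⊆ t ∧ p.card = 2 ∧ ∀ x ∈ p, ¬ P x} =
      ((t \ t.filter P).powersetCard 2 : Finset (Finset (ℤ × ℤ))) := by
    ext p
    simp only [mem_ofPred_eq, Finset.mem_coe, Finset.mem_powersetCard, Finset.subset_iff,
      Finset.mem_sdiff, Finset.mem_filter]
    grind
  rw [hset, Set.ncard_coe_finset]
  rcases card_powersetCard_sdiff ht.2 (Finset.filter_subset P t)
    (Finset.card_le_one.2 fun x hx y hy => hP x (Finset.mem_filter.1 hx).1 y
      (Finset.mem_filter.1 hy).1 (Finset.mem_filter.1 hx).2 (Finset.mem_filter.1 hy).2) with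
    ⟨h, h'⟩ | ⟨h, h'⟩
  · exact Or.inl ⟨Finset.filter_eq_empty_iff.1 h, h'⟩
  · obtain ⟨x, hx⟩ := h
    exact Or.inr ⟨⟨x, (Finset.mem_filter.1 hx).1, (Finset.mem_filter.1 hx).2⟩, h'⟩

theorem pair_mem_of_triangle {t : Finset (ℤ × ℤ)} (ht : t ∈ T.triangles) {u w : ℤ × ℤ}
    (hu : u ∈ t) (hw : w ∈ t) : {u, w} ∈ T.latticeFaces :=
  latticeFaces_down ht.1 (by grind) (by simp)

/-- A triangle of `S` is not met by a loop if and only if none of its vertices is cut off. -/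
theorem forall_not_isFace_iff (hd : 1 ≤ d) (hT : T.IsUnimodular) {L : Loop T harnackSign}
    {t : Finset (ℤ × ℤ)} (ht : t ∈ T.triangles) {q : ℤˣ × ℤˣ} :
    (∀ e ∈ crossedEdges L, ¬ T.IsFace e (cellOf d t q)) ↔
      ∀ x ∈ t, ¬ IsCutOff d (loopTag hd hT L) x q := by
  constructor
  · intro h x hx hcut
    obtain ⟨w, hw, hwx⟩ := Finset.exists_mem_ne (by rw [ht.2]; norm_num) x
    exact h _ ((cellOf_mem_crossedEdges hd hT (pair_mem_of_triangle ht hx hw) hwx.symm).2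
      (Or.inl hcut)) (isFace_pair ht hx hw q)
  · intro h e he hface
    obtain ⟨s, hst, hne, rfl⟩ := (isFace_cellOf_iff ht.1).1 hface
    obtain ⟨u, w, hF, huw, hs, -⟩ := (mem_crossedEdges_iff hd hT).1 he
    obtain rfl := ((cellOf_eq_iff (fun v hv => mem_latticePoints_of_mem ht.1 (hst hv))
      (fun v hv => mem_latticePoints_of_mem hF hv)).1 hs).1
    rcases (cellOf_mem_crossedEdges hd hT hF huw).1 he with h' | h'
    · exact h u (hst (by simp)) h'
    · exact h w (hst (by simp)) h'

/-- The Euler characteristics of the two sides of a separating loop sum up to the Euler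
characteristic of the projective plane. -/
theorem eulerChar_add_eulerChar (hd : 1 ≤ d) (hT : T.IsUnimodular) {L : Loop T harnackSign}
    {C C' : Side L} (hne : C ≠ C') (hall : ∀ W : Side L, W = C ∨ W = C') :
    eulerChar C + eulerChar C' = 1 := by
  have hzero := fun c => mem_cells_zero_iff (T := T) hd hT (c := c)
  have hfin0 := cells_finite T 0
  have hfin1 := cells_finite T 1
  have hfin2 := cells_finite T 2
  have hsame : ∀ x y : T.cells 0, ∀ W W' : Side L, (cutGraph L).Reachable x y → x ∈ W.supp →
      y ∈ W'.supp → W = W' := fun x y W W' h hx hy =>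
    (hx.symm.trans (SimpleGraph.ConnectedComponent.sound h)).trans hy
  have hcases : ∀ x : T.cells 0, x ∈ C.supp ∨ x ∈ C'.supp := fun x =>
    (hall ((cutGraph L).connectedComponentMk x)).imp id id
  -- vertices
  have hV : (sideVertices C).ncard + (sideVertices C').ncard = 2 * d ^ 2 + 1 := by
    have hsub : ∀ W : Side L, sideVertices W ⊆ T.cells 0 := by
      rintro W _ ⟨x, -, rfl⟩; exact x.2
    rw [← ncard_cells_zero hd hT, ← Set.ncard_union_eq ?_ (hfin0.subset (hsub _))
      (hfin0.subset (hsub _))]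
    · refine congrArg Set.ncard (Subset.antisymm (union_subset (hsub _) (hsub _)) fun c hc => ?_)
      exact (hcases ⟨c, hc⟩).imp (fun h => ⟨_, h, rfl⟩) fun h => ⟨_, h, rfl⟩
    · rw [Set.disjoint_left]
      rintro _ ⟨x, hx, rfl⟩ ⟨y, hy, hxy⟩
      obtain rfl := Subtype.ext hxy
      exact hne (hsame x x C C' (.refl x) hx hy)
  -- edges
  have hE : (sideEdges C).ncard + (sideEdges C').ncard =
      {e ∈ T.cells 1 | e ∉ crossedEdges L}.ncard := by
    have hsub : ∀ W : Side L, sideEdges W ⊆ {e ∈ T.cells 1 | e ∉ crossedEdges L} :=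
      fun W e he => ⟨he.1, he.2.1⟩
    have hfin : {e ∈ T.cells 1 | e ∉ crossedEdges L}.Finite := hfin1.subset fun e he => he.1
    rw [← Set.ncard_union_eq ?_ (hfin.subset (hsub _)) (hfin.subset (hsub _))]
    · refine congrArg Set.ncard (Subset.antisymm (union_subset (hsub _) (hsub _)) fun e he => ?_)
      obtain ⟨s, hs, hsc, q, rfl⟩ := mem_cells_iff.1 he.1
      obtain ⟨v, hv⟩ := latticeFaces_nonempty hs
      have hx : cellOf d {v} q ∈ T.cells 0 :=
        (hzero _).2 ⟨v, mem_latticePoints_of_mem hs hv, q, rfl⟩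
      have hface : T.IsFace (cellOf d {v} q) (cellOf d s q) :=
        (isFace_cellOf_iff hs).2 ⟨{v}, by simpa using hv, by simp, rfl⟩
      exact (hcases ⟨_, hx⟩).imp (fun h => ⟨he.1, he.2, _, h, hface⟩)
        fun h => ⟨he.1, he.2, _, h, hface⟩
    · rw [Set.disjoint_left]
      rintro e ⟨he, hL, x, hx, hxe⟩ ⟨-, -, y, hy, hye⟩
      refine hne (hsame x y C C' ?_ hx hy)
      by_cases h : x = y
      · rw [h]
      · exact SimpleGraph.Adj.reachable ⟨h, e, he, hL, hxe, hye⟩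
  -- triangles
  have hF : (sideTriangles C).ncard + (sideTriangles C').ncard =
      {a ∈ T.cells 2 | ∀ e ∈ crossedEdges L, ¬ T.IsFace e a}.ncard := by
    have hsub : ∀ W : Side L,
        sideTriangles W ⊆ {a ∈ T.cells 2 | ∀ e ∈ crossedEdges L, ¬ T.IsFace e a} :=
      fun W e he => ⟨he.1, he.2.1⟩
    have hfin : {a ∈ T.cells 2 | ∀ e ∈ crossedEdges L, ¬ T.IsFace e a}.Finite :=
      hfin2.subset fun e he => he.1
    rw [← Set.ncard_union_eq ?_ (hfin.subset (hsub _)) (hfin.subset (hsub _))]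
    · refine congrArg Set.ncard (Subset.antisymm (union_subset (hsub _) (hsub _)) fun e he => ?_)
      obtain ⟨s, hs, hsc, q, rfl⟩ := mem_cells_iff.1 he.1
      obtain ⟨v, hv⟩ := latticeFaces_nonempty hs
      have hx : cellOf d {v} q ∈ T.cells 0 :=
        (hzero _).2 ⟨v, mem_latticePoints_of_mem hs hv, q, rfl⟩
      have hface : T.IsFace (cellOf d {v} q) (cellOf d s q) :=
        (isFace_cellOf_iff hs).2 ⟨{v}, by simpa using hv, by simp, rfl⟩
      exact (hcases ⟨_, hx⟩).imp (fun h => ⟨he.1, he.2, _, h, hface⟩)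
        fun h => ⟨he.1, he.2, _, h, hface⟩
    · rw [Set.disjoint_left]
      rintro a ⟨ha, hL, x, hx, hxa⟩ ⟨-, -, y, hy, hya⟩
      refine hne (hsame x y C C' ?_ hx hy)
      by_cases h : x = y
      · rw [h]
      obtain ⟨t, ht, htc, q, rfl⟩ := mem_cells_iff.1 ha
      obtain ⟨s, hst, hs, hxs⟩ := (isFace_cellOf_iff ht).1 hxa
      obtain ⟨r, hrt, hr, hyr⟩ := (isFace_cellOf_iff ht).1 hya
      have hsing : ∀ x : T.cells 0, ∀ s ⊆ t, x.1 = cellOf d s q → ∃ u ∈ t, s = {u} := by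
        intro x s hst hxs
        obtain ⟨u, hu, q', hxu⟩ := (hzero _).1 x.2
        have hus := ((cellOf_eq_iff (fun v hv => mem_latticePoints_of_mem ht (hst hv))
          (by simpa using hu)).1 (hxs.symm.trans hxu)).1
        exact ⟨u, hst (hus ▸ by simp), hus⟩
      obtain ⟨u, hu, rfl⟩ := hsing x s hst hxs
      obtain ⟨w, hw, rfl⟩ := hsing y r hrt hyr
      have huw : u ≠ w := by
        rintro rfl
        exact h (Subtype.ext (hxs.trans hyr.symm))
      have hF := pair_mem_of_triangle ⟨ht, htc⟩ hu hw
      refine SimpleGraph.Adj.reachable ⟨h, cellOf d {u, w} q,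
        mem_cells_iff.2 ⟨_, hF, Finset.card_pair huw, q, rfl⟩,
        fun hc => hL _ hc (isFace_pair ⟨ht, htc⟩ hu hw q), ?_, ?_⟩
      · rw [hxs]; exact (isFace_cellOf_iff hF).2 ⟨{u}, by simp, by simp, rfl⟩
      · rw [hyr]; exact (isFace_cellOf_iff hF).2 ⟨{w}, by simp, by simp, rfl⟩
  -- incidences of uncrossed edges and triangles
  have hcount : 2 * {e ∈ T.cells 1 | e ∉ crossedEdges L}.ncard = (T.cells 2).ncard +
      2 * {a ∈ T.cells 2 | ∀ e ∈ crossedEdges L, ¬ T.IsFace e a}.ncard := by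
    refine two_mul_ncard_eq (hfin1.subset fun e he => he.1) hfin2 (fun a ha => ha.1)
      (I := T.IsFace) (fun e he => ncard_cofaces hd hT he.1) ?_
    intro f hf
    obtain ⟨t, ht, htc, q, rfl⟩ := mem_cells_iff.1 hf
    have himg : {e | e ∈ {e ∈ T.cells 1 | e ∉ crossedEdges L} ∧ T.IsFace e (cellOf d t q)} =
        (fun p => cellOf d p q) '' {p : Finset (ℤ × ℤ) | p ⊆ t ∧ p.card = 2 ∧
          ∀ x ∈ p, ¬ IsCutOff d (loopTag hd hT L) x q} := by
      ext e
      constructor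
      · rintro ⟨⟨he, hL⟩, hface⟩
        obtain ⟨p, hpt, hp, rfl⟩ := (isFace_cellOf_iff ht).1 hface
        obtain ⟨p', hp', hpc, q', h⟩ := mem_cells_iff.1 he
        obtain rfl := ((cellOf_eq_iff (fun v hv => mem_latticePoints_of_mem ht (hpt hv))
          (fun v hv => mem_latticePoints_of_mem hp' hv)).1 h).1
        refine ⟨p, ⟨hpt, hpc, fun x hx hcut => hL ?_⟩, rfl⟩
        obtain ⟨u, w, huw, rfl⟩ := Finset.card_eq_two.1 hpc
        rw [cellOf_mem_crossedEdges hd hT hp' huw]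
        rcases Finset.mem_insert.1 hx with rfl | hx
        · exact Or.inl hcut
        · exact Or.inr (Finset.mem_singleton.1 hx ▸ hcut)
      · rintro ⟨p, ⟨hpt, hpc, hcut⟩, rfl⟩
        obtain ⟨u, w, huw, rfl⟩ := Finset.card_eq_two.1 hpc
        have hF : {u, w} ∈ T.latticeFaces := latticeFaces_down ht hpt (by simp)
        refine ⟨⟨mem_cells_iff.2 ⟨_, hF, hpc, q, rfl⟩, fun hL => ?_⟩,
          (isFace_cellOf_iff ht).2 ⟨_, hpt, by simp, rfl⟩⟩
        rcases (cellOf_mem_crossedEdges hd hT hF huw).1 hL with h | h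
        · exact hcut u (by simp) h
        · exact hcut w (by simp) h
    rw [himg, InjOn.ncard_image]
    · have hiff := forall_not_isFace_iff hd hT (L := L) ⟨ht, htc⟩ (q := q)
      rcases powersetCard_cases ⟨ht, htc⟩ fun x hx y hy hxc hyc =>
        IsCutOff.eq (d := d) (l := loopTag hd hT L) (q := q) hT ⟨ht, htc⟩ hx hy hxc hyc with
        ⟨h, h'⟩ | ⟨⟨x, hx, hcut⟩, h'⟩
      · exact Or.inl ⟨⟨hf, hiff.2 h⟩, h'⟩
      · exact Or.inr ⟨fun hW => hiff.1 hW.2 x hx hcut, h'⟩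
    · rintro p ⟨hp, -⟩ p' ⟨hp', -⟩ h
      exact ((cellOf_eq_iff (fun v hv => mem_latticePoints_of_mem ht (hp hv))
        (fun v hv => mem_latticePoints_of_mem ht (hp' hv))).1 h).1
  rw [ncard_cells_two hd hT] at hcount
  unfold eulerChar
  omega

/-! ### Connectedness within the quadrants -/

/-- The vertex of `S` given by the copy of a lattice point in a quadrant. -/
def vertexOf (hd : 1 ≤ d) (hT : T.IsUnimodular) {v : ℤ × ℤ} (hv : v ∈ latticePoints d)
    (q : ℤˣ × ℤˣ) : T.cells 0 :=
  ⟨cellOf d {v} q, (mem_cells_zero_iff hd hT).2 ⟨v, hv, q, rfl⟩⟩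

theorem exists_eq_vertexOf (hd : 1 ≤ d) (hT : T.IsUnimodular) (x : T.cells 0) :
    ∃ (v : ℤ × ℤ) (hv : v ∈ latticePoints d) (q : ℤˣ × ℤˣ), x = vertexOf hd hT hv q := by
  obtain ⟨v, hv, q, h⟩ := (mem_cells_zero_iff hd hT).1 x.2
  exact ⟨v, hv, q, Subtype.ext h⟩

theorem vertexOf_eq_iff (hd : 1 ≤ d) (hT : T.IsUnimodular) {u v : ℤ × ℤ}
    (hu : u ∈ latticePoints d) (hv : v ∈ latticePoints d) {q q' : ℤˣ × ℤˣ} :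
    vertexOf hd hT hu q = vertexOf hd hT hv q' ↔ u = v ∧ (reflect q u = reflect q' u ∨
      (u.1 + u.2 = d ∧ reflect (-q) u = reflect q' u)) := by
  rw [← cellOf_singleton_eq_iff hu hv, vertexOf, vertexOf, Subtype.mk.injEq]

/-- Vertices of `S` which are joined by an uncrossed edge have copies in a common quadrant where
neither is cut off. -/
theorem exists_of_adj (hd : 1 ≤ d) (hT : T.IsUnimodular) {L : Loop T harnackSign}
    {x y : T.cells 0} (h : (cutGraph L).Adj x y) :
    ∃ (u w : ℤ × ℤ) (hu : u ∈ latticePoints d) (hw : w ∈ latticePoints d) (q : ℤˣ × ℤˣ),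
      u ≠ w ∧ {u, w} ∈ T.latticeFaces ∧ x = vertexOf hd hT hu q ∧ y = vertexOf hd hT hw q ∧
      ¬ IsCutOff d (loopTag hd hT L) u q ∧ ¬ IsCutOff d (loopTag hd hT L) w q := by
  obtain ⟨hne, e, he, hL, hxe, hye⟩ := h
  obtain ⟨s, hs, hsc, q, rfl⟩ := mem_cells_iff.1 he
  have hsing : ∀ x : T.cells 0, T.IsFace x.1 (cellOf d s q) → ∃ u ∈ s, x.1 = cellOf d {u} q := by
    intro x hx
    obtain ⟨r, hrs, hr, hxr⟩ := (isFace_cellOf_iff hs).1 hx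
    obtain ⟨u, hu, q', hxu⟩ := (mem_cells_zero_iff hd hT).1 x.2
    have hus := ((cellOf_eq_iff (fun v hv => mem_latticePoints_of_mem hs (hrs hv))
      (by simpa using hu)).1 (hxr.symm.trans hxu)).1
    exact ⟨u, hrs (hus ▸ by simp), hus ▸ hxr⟩
  obtain ⟨u, hu, hxu⟩ := hsing x hxe
  obtain ⟨w, hw, hyw⟩ := hsing y hye
  have huw : u ≠ w := by
    rintro rfl
    exact hne (Subtype.ext (hxu.trans hyw.symm))
  obtain rfl : {u, w} = s := Finset.eq_of_subset_of_card_le (by grind)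
    (by rw [hsc, Finset.card_pair huw])
  rw [cellOf_mem_crossedEdges hd hT hs huw, not_or] at hL
  exact ⟨u, w, mem_latticePoints_of_mem hs hu, mem_latticePoints_of_mem hs hw, q, huw, hs,
    Subtype.ext hxu, Subtype.ext hyw, hL.1, hL.2⟩

/-- The points of a quadrant which are not cut off by a loop lie on the same side of it. -/
theorem reachable_of_not_isCutOff (hd : 1 ≤ d) (hT : T.IsUnimodular) {L : Loop T harnackSign}
    {u w : ℤ × ℤ} (hu : u ∈ latticePoints d) (hw : w ∈ latticePoints d) {q : ℤˣ × ℤˣ}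
    (huc : ¬ IsCutOff d (loopTag hd hT L) u q) (hwc : ¬ IsCutOff d (loopTag hd hT L) w q) :
    (cutGraph L).Reachable (vertexOf hd hT hu q) (vertexOf hd hT hw q) := by
  have hch := connected_off hd hT (P := {x | IsCutOff d (loopTag hd hT L) x q})
    (fun t ht x hx y hy hxc hyc => IsCutOff.eq hT ht hx hy hxc hyc) hu hw huc hwc
  clear hwc
  induction hch with
  | refl => exact .refl _
  | tail _ h ih =>
    obtain ⟨hb, hc, hF, hne⟩ := h
    have hbA := mem_latticePoints_of_mem hF (Finset.mem_insert_self _ _)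
    refine (ih hbA).trans (SimpleGraph.Adj.reachable ⟨fun h => ?_, cellOf d _ q,
      mem_cells_iff.2 ⟨_, hF, Finset.card_pair hne, q, rfl⟩, ?_, ?_, ?_⟩)
    · exact hne ((vertexOf_eq_iff hd hT hbA hw).1 h).1
    · rw [cellOf_mem_crossedEdges hd hT hF hne, not_or]
      exact ⟨hb, hc⟩
    · exact (isFace_cellOf_iff hF).2 ⟨_, by simp, by simp, rfl⟩
    · exact (isFace_cellOf_iff hF).2 ⟨{_}, by simp, by simp, rfl⟩

theorem vertexOf_zero (hd : 1 ≤ d) (hT : T.IsUnimodular) (q q' : ℤˣ × ℤˣ) :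
    (vertexOf hd hT (zero_mem_latticePoints d) q : T.cells 0) =
      vertexOf hd hT (zero_mem_latticePoints d) q' :=
  (vertexOf_eq_iff hd hT _ _).2 ⟨rfl, Or.inl (by simp [reflect])⟩

theorem quad_zero : quad (0, 0) = 1 := by simp [quad]

theorem tag_zero (d : ℕ) : tag d (0, 0) = none := by simp [tag]

/-! ### The loops around interior points -/

/-- An interior point has different copies in different quadrants. -/
theorem eq_of_vertexOf_eq (hd : 1 ≤ d) (hT : T.IsUnimodular) {u v : ℤ × ℤ}
    (hu : u ∈ latticePoints d) (hv : v ∈ latticePoints d) (hvt : tag d v = some v)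
    {q q' : ℤˣ × ℤˣ} (h : (vertexOf hd hT hu q : T.cells 0) = vertexOf hd hT hv q') :
    u = v ∧ q = q' := by
  obtain ⟨-, h1, h2, h3⟩ := tag_eq_some_iff.1 hvt
  obtain ⟨rfl, h | h⟩ := (vertexOf_eq_iff hd hT hu hv).1 h
  · rw [reflect_eq_iff] at h
    exact ⟨rfl, Prod.ext (h.1.resolve_right h1.ne') (h.2.resolve_right h2.ne')⟩
  · exact absurd h.1 h3.ne

/-- The loop around an interior point `v` is an oval, and its interior contains no vertex of `S`
other than the isolated copy of `v`. -/
theorem sides_of_inner (hd : 1 ≤ d) (hT : T.IsUnimodular) {L : Loop T harnackSign} {v : ℤ × ℤ}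
    (hL : loopTag hd hT L = some v) (hv : v ∈ latticePoints d) : ∃ C C' : Side L, C ≠ C' ∧
      (∀ W : Side L, W = C ∨ W = C') ∧ IsDisk C ∧ IsMoebius C' ∧
      sideVertices C = {cellOf d {v} (quad v)} := by
  have hvt : tag d v = some v := by
    obtain ⟨w, -, hw⟩ := exists_tag_eq hd hT L
    obtain ⟨rfl, h⟩ := tag_eq_some_iff.1 (hw.symm.trans hL)
    exact tag_eq_some_iff.2 ⟨rfl, h⟩
  set a : T.cells 0 := vertexOf hd hT hv (quad v) with ha
  have h0 : ∀ q, ¬ IsCutOff d (loopTag hd hT L) (0, 0) q := by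
    rintro q ⟨-, h⟩
    rw [hL, tag_zero] at h
    simp at h
  have hcut : ∀ (u : ℤ × ℤ) (hu : u ∈ latticePoints d) (q : ℤˣ × ℤˣ),
      vertexOf hd hT hu q ≠ a → ¬ IsCutOff d (loopTag hd hT L) u q := by
    rintro u hu q hne ⟨rfl, h⟩
    rw [hL] at h
    obtain ⟨rfl, -⟩ := tag_eq_some_iff.1 h
    exact hne rfl
  obtain ⟨C, C', hne, hall, hC, hC'⟩ := exists_two_components (cutGraph L) (D := {a}) (a := a)
    (b := vertexOf hd hT (zero_mem_latticePoints d) 1) rfl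
    (by
      intro h
      have := (eq_of_vertexOf_eq hd hT _ hv hvt h).1
      rw [← this, tag_zero] at hvt
      simp at hvt)
    (by rintro x rfl; exact .refl _)
    (by
      intro x hx
      obtain ⟨u, hu, q, rfl⟩ := exists_eq_vertexOf hd hT x
      rw [vertexOf_zero hd hT 1 q]
      exact reachable_of_not_isCutOff hd hT hu _ (hcut u hu q hx) (h0 q))
    (by
      rintro x y hadj rfl
      obtain ⟨u, w, hu, hw, q, -, -, hx, -, huc, -⟩ := exists_of_adj hd hT hadj
      obtain ⟨rfl, rfl⟩ := eq_of_vertexOf_eq hd hT hu hv hvt hx.symm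
      exact absurd ⟨rfl, hvt.trans hL.symm⟩ huc)
  have hsv : sideVertices C = {cellOf d {v} (quad v)} := by
    unfold sideVertices
    rw [hC]
    ext c
    simp [ha, vertexOf]
  have hse : sideEdges C = ∅ := by
    rw [Set.eq_empty_iff_forall_notMem]
    rintro e ⟨he, hLe, x, hx, hxe⟩
    rw [hC] at hx
    obtain ⟨s, hs, hsc, q, rfl⟩ := mem_cells_iff.1 he
    obtain ⟨r, hrs, -, hxr⟩ := (isFace_cellOf_iff hs).1 hxe
    rw [show x = a from hx] at hxr
    have hrv := ((cellOf_eq_iff (by simpa using hv)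
      (fun v hv => mem_latticePoints_of_mem hs (hrs hv))).1 hxr).1
    subst hrv
    have hq := (eq_of_vertexOf_eq hd hT hv hv hvt (q := q) (Subtype.ext hxr.symm)).2
    subst hq
    obtain ⟨w, hw, hwv⟩ := Finset.exists_mem_ne (by rw [hsc]; norm_num) v
    have hvs : v ∈ s := hrs (by simp)
    obtain rfl : {v, w} = s := Finset.eq_of_subset_of_card_le (by grind)
      (by rw [hsc, Finset.card_pair hwv.symm])
    exact hLe ((cellOf_mem_crossedEdges hd hT hs hwv.symm).2 (Or.inl ⟨rfl, hvt.trans hL.symm⟩))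
  have hst : sideTriangles C = ∅ := by
    rw [Set.eq_empty_iff_forall_notMem]
    rintro e ⟨he, hLe, x, hx, hxe⟩
    rw [hC] at hx
    obtain ⟨s, hs, hsc, q, rfl⟩ := mem_cells_iff.1 he
    obtain ⟨r, hrs, -, hxr⟩ := (isFace_cellOf_iff hs).1 hxe
    rw [show x = a from hx] at hxr
    have hrv := ((cellOf_eq_iff (by simpa using hv)
      (fun v hv => mem_latticePoints_of_mem hs (hrs hv))).1 hxr).1
    subst hrv
    have hq := (eq_of_vertexOf_eq hd hT hv hv hvt (q := q) (Subtype.ext hxr.symm)).2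
    subst hq
    exact (forall_not_isFace_iff hd hT ⟨hs, hsc⟩).1 hLe v (hrs (by simp)) ⟨rfl, hvt.trans hL.symm⟩
  have hdisk : eulerChar C = 1 := by
    unfold eulerChar
    rw [hsv, hse, hst]
    simp
  refine ⟨C, C', hne, hall, hdisk, ?_, hsv⟩
  have := eulerChar_add_eulerChar hd hT hne hall
  unfold IsMoebius
  omega

end Sides

section Outer

variable {d : ℕ} {T : Triangulation d}

/-! ### The loop along the boundary -/

theorem exists_ne_vertexOf_eq (hd : 1 ≤ d) (hT : T.IsUnimodular) {u : ℤ × ℤ}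
    (hu : u ∈ latticePoints d) (hb : tag d u = none) (q : ℤˣ × ℤˣ) :
    ∃ q', q ≠ q' ∧ (vertexOf hd hT hu q : T.cells 0) = vertexOf hd hT hu q' := by
  have hne : ∀ a : ℤˣ, a ≠ -a := by decide
  simp only [vertexOf_eq_iff, reflect_eq_iff, true_and]
  rcases (tag_eq_none_iff hu).1 hb with h | h | h
  · exact ⟨(-q.1, q.2), fun e => hne q.1 (congrArg Prod.fst e), by simp [h]⟩
  · exact ⟨(q.1, -q.2), fun e => hne q.2 (congrArg Prod.snd e), by simp [h]⟩
  · exact ⟨-q, fun e => hne q.1 (congrArg Prod.fst e), by simp [h]⟩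

/-- Every vertex of `S` lies in a quadrant in which the boundary loop does not cut it off: on the
boundary, there are two quadrants to choose from. -/
theorem exists_not_isCutOff_none (hd : 1 ≤ d) (hT : T.IsUnimodular) (x : T.cells 0) :
    ∃ (u : ℤ × ℤ) (hu : u ∈ latticePoints d) (q : ℤˣ × ℤˣ),
      x = vertexOf hd hT hu q ∧ ¬ IsCutOff d none u q := by
  obtain ⟨u, hu, q, rfl⟩ := exists_eq_vertexOf hd hT x
  by_cases h : IsCutOff d none u q
  · obtain ⟨q', hne, hq'⟩ := exists_ne_vertexOf_eq hd hT hu h.2 q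
    exact ⟨u, hu, q', hq', fun h' => hne (h.1.symm.trans h'.1)⟩
  · exact ⟨u, hu, q, rfl, h⟩

/-- All points in the three quadrants other than the first which are not cut off by the boundary
loop lie on the same side of it as the origin. -/
theorem reachable_zero_of_ne_one (hd : 1 ≤ d) (hT : T.IsUnimodular) {L : Loop T harnackSign}
    (hL : loopTag hd hT L = none) {u : ℤ × ℤ} (hu : u ∈ latticePoints d) {q : ℤˣ × ℤˣ}
    (huc : ¬ IsCutOff d none u q) (hq : q ≠ 1) :
    (cutGraph L).Reachable (vertexOf hd hT hu q) (vertexOf hd hT (zero_mem_latticePoints d) 1) := by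
  rw [vertexOf_zero hd hT 1 q]
  refine reachable_of_not_isCutOff hd hT hu _ (hL ▸ huc) ?_
  rintro ⟨h, -⟩
  exact hq (h.symm.trans quad_zero)

/-- For odd `d`, the corner `(d, 0)` connects the first quadrant to the other ones. -/
theorem isPseudoLine_of_odd (hd : 1 ≤ d) (hT : T.IsUnimodular) {L : Loop T harnackSign}
    (hL : loopTag hd hT L = none) (hodd : Odd d) : IsPseudoLine L := by
  have hc : ((d : ℤ), (0 : ℤ)) ∈ latticePoints d := ⟨by simp, le_rfl, by simp⟩
  have hquad : quad ((d : ℤ), (0 : ℤ)) = (1, -1) := by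
    rw [quad, Int.negOnePow_odd (d : ℤ) (by exact_mod_cast hodd), Int.negOnePow_zero]
  have hcorner : (vertexOf hd hT hc 1 : T.cells 0) = vertexOf hd hT hc (-1) :=
    (vertexOf_eq_iff hd hT _ _).2 ⟨rfl, Or.inr ⟨by simp, rfl⟩⟩
  have hall : ∀ x : T.cells 0,
      (cutGraph L).Reachable x (vertexOf hd hT (zero_mem_latticePoints d) 1) := by
    intro x
    obtain ⟨u, hu, q, rfl, huc⟩ := exists_not_isCutOff_none hd hT x
    by_cases hq : q = 1
    · subst hq
      refine .trans (reachable_of_not_isCutOff hd hT hu hc (hL ▸ huc) ?_)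
        (hcorner ▸ reachable_zero_of_ne_one hd hT hL hc ?_ (by decide))
      · rintro ⟨h, -⟩
        exact absurd (hquad.symm.trans h) (by decide)
      · rintro ⟨h, -⟩
        exact absurd (hquad.symm.trans h) (by decide)
    · exact reachable_zero_of_ne_one hd hT hL hu huc hq
  have : Nonempty (T.cells 0) := ⟨vertexOf hd hT hc 1⟩
  exact SimpleGraph.Connected.mk fun x y => (hall x).trans (hall y).symm

theorem negOnePow_eq_of_add_eq (heven : Even d) {x : ℤ × ℤ} (h : x.1 + x.2 = d) :
    x.1.negOnePow = x.2.negOnePow := by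
  rw [Int.negOnePow_eq_iff, show x.1 - x.2 = d - (x.2 + x.2) by omega]
  exact Even.sub (by exact_mod_cast heven) ⟨_, rfl⟩

/-- For even `d`, a point of the first quadrant which lies in another quadrant as well is cut off in
one of them. -/
theorem isCutOff_of_vertexOf_eq (hd : 1 ≤ d) (hT : T.IsUnimodular) (heven : Even d) {u : ℤ × ℤ}
    (hu : u ∈ latticePoints d) {q : ℤˣ × ℤˣ} (hq : q ≠ 1)
    (h : (vertexOf hd hT hu q : T.cells 0) = vertexOf hd hT hu 1) :
    IsCutOff d none u q ∨ IsCutOff d none u 1 := by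
  obtain ⟨a, b⟩ := q
  suffices (quad u = (a, b) ∨ quad u = 1) ∧ tag d u = none from
    this.1.imp (fun h => ⟨h, this.2⟩) fun h => ⟨h, this.2⟩
  rw [tag_eq_none_iff hu]
  have hz : ∀ a : ℤˣ, a = 1 ∨ a = -1 := Int.units_eq_one_or
  have h := ((vertexOf_eq_iff hd hT hu hu).1 h).2
  simp only [reflect_eq_iff, Prod.fst_one, Prod.snd_one, Prod.fst_neg, Prod.snd_neg] at h
  have hu2 := hz u.2.negOnePow
  have hu1 := hz u.1.negOnePow
  have hsame := negOnePow_eq_of_add_eq (x := u) heven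
  have hzero : ∀ x : ℤ, x = 0 → x.negOnePow = 1 := by rintro x rfl; simp
  simp only [quad, Prod.mk.injEq, Prod.mk_eq_one]
  have hneg : (-1 : ℤˣ) ≠ 1 := by decide
  rcases hz a with rfl | rfl <;> rcases hz b with rfl | rfl
  · exact absurd rfl hq
  · rcases h with ⟨-, h⟩ | ⟨h, h', -⟩
    · have h := h.resolve_left hneg
      exact ⟨hu1.symm.imp (fun e => ⟨hzero _ h, e⟩) fun e => ⟨hzero _ h, e⟩, Or.inr (Or.inl h)⟩
    · have h' := h'.resolve_left hneg
      exact ⟨Or.inr ⟨(hsame h) ▸ hzero _ h', hzero _ h'⟩, Or.inl h'⟩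
  · rcases h with ⟨h, -⟩ | ⟨h, -, h'⟩
    · have h := h.resolve_left hneg
      exact ⟨hu2.symm.imp (fun e => ⟨e, hzero _ h⟩) fun e => ⟨e, hzero _ h⟩, Or.inl h⟩
    · have h' := h'.resolve_left hneg
      exact ⟨Or.inr ⟨hzero _ h', (hsame h).symm ▸ hzero _ h'⟩, Or.inr (Or.inl h')⟩
  · rcases h with ⟨h, h'⟩ | ⟨h, -⟩
    · have h := h.resolve_left hneg
      have h' := h'.resolve_left hneg
      exact ⟨Or.inr ⟨hzero _ h', hzero _ h⟩, Or.inl h⟩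
    · have e := hsame h
      exact ⟨hu2.symm.imp (fun e' => ⟨e', e ▸ e'⟩) fun e' => ⟨e', e ▸ e'⟩, Or.inr (Or.inr h)⟩

/-- For even `d`, one of the endpoints of every edge in the boundary has two even coordinates. -/
theorem quad_eq_one_of_isBoundaryEdge (heven : Even d) {u w : ℤ × ℤ} (h : IsBoundaryEdge d u w)
    (huw : quad u ≠ quad w) : quad u = 1 ∨ quad w = 1 := by
  have hzero : ∀ x : ℤ, x = 0 → x.negOnePow = 1 := by rintro x rfl; simp
  simp only [quad, ne_eq, Prod.mk.injEq, Prod.mk_eq_one] at huw ⊢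
  have hu2 := Int.units_eq_one_or u.2.negOnePow
  have hu1 := Int.units_eq_one_or u.1.negOnePow
  have hw2 := Int.units_eq_one_or w.2.negOnePow
  have hw1 := Int.units_eq_one_or w.1.negOnePow
  rcases h with ⟨h, h'⟩ | ⟨h, h'⟩ | ⟨h, h'⟩
  · rw [hzero _ h, hzero _ h'] at *; grind
  · rw [hzero _ h, hzero _ h'] at *; grind
  · rw [negOnePow_eq_of_add_eq heven h, negOnePow_eq_of_add_eq heven h'] at *; grind

/-- For even `d`, the vertices in the interior of the boundary loop: the lattice points in the first
quadrant except those in the boundary with two even coordinates. -/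
def diskPoints (d : ℕ) : Set (ℤ × ℤ) := {u | u ∈ latticePoints d ∧ ¬ IsCutOff d none u 1}

theorem eq_of_cellOf_eq {s t : Finset (ℤ × ℤ)} {q : ℤˣ × ℤˣ} (hs : s ∈ T.latticeFaces)
    (ht : t ∈ T.latticeFaces) (h : cellOf d s q = cellOf d t q) : s = t :=
  ((cellOf_eq_iff (fun _ hv => mem_latticePoints_of_mem hs hv)
    (fun _ hv => mem_latticePoints_of_mem ht hv)).1 h).1

/-- Incidences of edges and triangles among the points which are not cut off in the first quadrant:
each edge on these points lies in two triangles, as it is not contained in the boundary. -/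
theorem ncard_diskEdges (hd : 1 ≤ d) (hT : T.IsUnimodular) (heven : Even d) :
    2 * {e ∈ T.latticeFaces | e.card = 2 ∧ ∀ x ∈ e, ¬ IsCutOff d none x 1}.ncard =
      d ^ 2 + 2 * {t ∈ T.triangles | ∀ x ∈ t, ¬ IsCutOff d none x 1}.ncard := by
  rw [← ncard_triangles hd hT]
  refine two_mul_ncard_eq ((latticeFaces_finite T).subset fun e he => he.1) (triangles_finite T)
    (fun t ht => ht.1) (I := fun e t => e ⊆ t) ?_ ?_
  · rintro e ⟨he, hec, hcut⟩
    obtain ⟨u, w, huw, rfl⟩ := Finset.card_eq_two.1 hec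
    refine ncard_triangles_of_not_isBoundaryEdge hd hT huw he fun hb => ?_
    rcases quad_eq_one_of_isBoundaryEdge heven hb (quad_ne_of_edge hd hT he huw) with h | h
    · exact hcut u (by simp) ⟨h, hb.tag_eq_none⟩
    · exact hcut w (by simp) ⟨h, hb.symm.tag_eq_none⟩
  · intro t ht
    have hset : {e | e ∈ {e ∈ T.latticeFaces | e.card = 2 ∧ ∀ x ∈ e, ¬ IsCutOff d none x 1} ∧
        e ⊆ t} = {p : Finset (ℤ × ℤ) | p ⊆ t ∧ p.card = 2 ∧ ∀ x ∈ p, ¬ IsCutOff d none x 1} := by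
      ext e
      constructor
      · rintro ⟨⟨-, h1, h2⟩, h3⟩
        exact ⟨h3, h1, h2⟩
      · rintro ⟨h3, h1, h2⟩
        exact ⟨⟨latticeFaces_down ht.1 h3 (Finset.card_pos.1 (by omega)), h1, h2⟩, h3⟩
    rw [hset]
    rcases powersetCard_cases ht fun x hx y hy hxc hyc =>
      IsCutOff.eq (d := d) (l := none) (q := 1) hT ht hx hy hxc hyc with ⟨h, h'⟩ | ⟨⟨x, hx, h⟩, h'⟩
    · exact Or.inl ⟨⟨ht, h⟩, h'⟩
    · exact Or.inr ⟨fun hW => hW.2 x hx h, h'⟩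

/-- For even `d`, the loop along the boundary is an oval. -/
theorem sides_of_outer (hd : 1 ≤ d) (hT : T.IsUnimodular) (heven : Even d)
    (hcard : 2 * (diskPoints d).ncard = d ^ 2 + 2) {L : Loop T harnackSign}
    (hL : loopTag hd hT L = none) : ∃ C C' : Side L, C ≠ C' ∧
      (∀ W : Side L, W = C ∨ W = C') ∧ IsDisk C ∧ IsMoebius C' ∧
      sideVertices C = (fun u => cellOf d {u} 1) '' diskPoints d := by
  set D : Set (T.cells 0) := {x | ∃ (u : ℤ × ℤ) (hu : u ∈ latticePoints d),
    ¬ IsCutOff d none u 1 ∧ x = vertexOf hd hT hu 1} with hD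
  have h01 : ((0 : ℤ), (1 : ℤ)) ∈ latticePoints d := ⟨le_rfl, by simp, by simp; omega⟩
  have h01c : ¬ IsCutOff d none (0, 1) 1 := by
    rintro ⟨h, -⟩
    exact absurd h (by decide)
  -- a point of `D` in a quadrant other than the first is cut off there
  have hquad : ∀ (u : ℤ × ℤ) (hu : u ∈ latticePoints d) (q : ℤˣ × ℤˣ), vertexOf hd hT hu q ∈ D →
      ¬ IsCutOff d none u q → q = 1 ∧ ¬ IsCutOff d none u 1 := by
    rintro u hu q ⟨v, hv, hvc, h⟩ huc
    obtain rfl := ((vertexOf_eq_iff hd hT hu hv).1 h).1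
    refine ⟨?_, hvc⟩
    by_contra hq
    exact (isCutOff_of_vertexOf_eq hd hT heven hu hq h).elim huc hvc
  obtain ⟨C, C', hne, hall, hC, -⟩ := exists_two_components (cutGraph L) (D := D)
    (a := vertexOf hd hT h01 1) (b := vertexOf hd hT (zero_mem_latticePoints d) 1)
    ⟨_, h01, h01c, rfl⟩
    (by
      rintro ⟨u, hu, huc, h⟩
      obtain rfl := ((vertexOf_eq_iff hd hT _ _).1 h).1
      exact huc ⟨quad_zero, tag_zero d⟩)
    (by
      rintro _ ⟨u, hu, huc, rfl⟩
      exact reachable_of_not_isCutOff hd hT hu h01 (hL ▸ huc) (hL ▸ h01c))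
    (by
      intro x hx
      obtain ⟨u, hu, q, rfl, huc⟩ := exists_not_isCutOff_none hd hT x
      refine reachable_zero_of_ne_one hd hT hL hu huc ?_
      rintro rfl
      exact hx ⟨u, hu, huc, rfl⟩)
    (by
      intro x y hadj hx
      obtain ⟨u, w, hu, hw, q, -, -, rfl, rfl, huc, hwc⟩ := exists_of_adj hd hT hadj
      rw [hL] at huc hwc
      obtain ⟨rfl, -⟩ := hquad u hu q hx huc
      exact ⟨w, hw, hwc, rfl⟩)
  have hsv : sideVertices C = (fun u => cellOf d {u} 1) '' diskPoints d := by
    unfold sideVertices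
    rw [hC]
    ext c
    constructor
    · rintro ⟨_, ⟨u, hu, huc, rfl⟩, rfl⟩
      exact ⟨u, ⟨hu, huc⟩, rfl⟩
    · rintro ⟨u, ⟨hu, huc⟩, rfl⟩
      exact ⟨_, ⟨u, hu, huc, rfl⟩, rfl⟩
  have hse : sideEdges C = (fun e => cellOf d e 1) ''
      {e ∈ T.latticeFaces | e.card = 2 ∧ ∀ x ∈ e, ¬ IsCutOff d none x 1} := by
    ext c
    constructor
    · rintro ⟨he, hLe, x, hx, hxe⟩
      rw [hC] at hx
      obtain ⟨s, hs, hsc, q, rfl⟩ := mem_cells_iff.1 he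
      have hfree : ∀ u ∈ s, ¬ IsCutOff d none u q := by
        intro u hu hcut
        obtain ⟨w, hw, hwu⟩ := Finset.exists_mem_ne (by rw [hsc]; norm_num) u
        obtain rfl : {u, w} = s := Finset.eq_of_subset_of_card_le (by grind)
          (by rw [hsc, Finset.card_pair hwu.symm])
        exact hLe ((cellOf_mem_crossedEdges hd hT hs hwu.symm).2 (Or.inl (hL ▸ hcut)))
      obtain ⟨r, hrs, -, hxr⟩ := (isFace_cellOf_iff hs).1 hxe
      obtain ⟨u, hu, huc, rfl⟩ := id hx
      obtain rfl := ((cellOf_eq_iff (by simpa using hu)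
        (fun v hv => mem_latticePoints_of_mem hs (hrs hv))).1 hxr).1
      have hxq : vertexOf hd hT hu 1 = vertexOf hd hT hu q := Subtype.ext hxr
      obtain ⟨rfl, -⟩ := hquad u hu q (hxq ▸ hx) (hfree u (hrs (by simp)))
      exact ⟨s, ⟨hs, hsc, hfree⟩, rfl⟩
    · rintro ⟨s, ⟨hs, hsc, hfree⟩, rfl⟩
      obtain ⟨u, w, huw, rfl⟩ := Finset.card_eq_two.1 hsc
      have hu := mem_latticePoints_of_mem hs (v := u) (by simp)
      refine ⟨mem_cells_iff.2 ⟨_, hs, hsc, 1, rfl⟩, ?_, vertexOf hd hT hu 1, ?_,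
        (isFace_cellOf_iff hs).2 ⟨{u}, by simp, by simp, rfl⟩⟩
      · rw [cellOf_mem_crossedEdges hd hT hs huw, hL, not_or]
        exact ⟨hfree u (by simp), hfree w (by simp)⟩
      · rw [hC]
        exact ⟨u, hu, hfree u (by simp), rfl⟩
  have hst : sideTriangles C = (fun t => cellOf d t 1) ''
      {t ∈ T.triangles | ∀ x ∈ t, ¬ IsCutOff d none x 1} := by
    ext c
    constructor
    · rintro ⟨he, hLe, x, hx, hxe⟩
      rw [hC] at hx
      obtain ⟨s, hs, hsc, q, rfl⟩ := mem_cells_iff.1 he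
      have hfree := (forall_not_isFace_iff hd hT ⟨hs, hsc⟩).1 hLe
      rw [hL] at hfree
      obtain ⟨r, hrs, -, hxr⟩ := (isFace_cellOf_iff hs).1 hxe
      obtain ⟨u, hu, huc, rfl⟩ := id hx
      obtain rfl := ((cellOf_eq_iff (by simpa using hu)
        (fun v hv => mem_latticePoints_of_mem hs (hrs hv))).1 hxr).1
      have hxq : vertexOf hd hT hu 1 = vertexOf hd hT hu q := Subtype.ext hxr
      obtain ⟨rfl, -⟩ := hquad u hu q (hxq ▸ hx) (hfree u (hrs (by simp)))
      exact ⟨s, ⟨⟨hs, hsc⟩, hfree⟩, rfl⟩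
    · rintro ⟨s, ⟨hs, hfree⟩, rfl⟩
      obtain ⟨u, hus⟩ := latticeFaces_nonempty hs.1
      have hu := mem_latticePoints_of_mem hs.1 hus
      refine ⟨mem_cells_iff.2 ⟨_, hs.1, hs.2, 1, rfl⟩, ?_, vertexOf hd hT hu 1, ?_,
        (isFace_cellOf_iff hs.1).2 ⟨{u}, by simpa using hus, by simp, rfl⟩⟩
      · rw [forall_not_isFace_iff hd hT hs, hL]
        exact hfree
      · rw [hC]
        exact ⟨u, hu, hfree u hus, rfl⟩
  have hdisk : eulerChar C = 1 := by
    have hcount := ncard_diskEdges hd hT heven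
    unfold eulerChar
    rw [hsv, hse, hst, InjOn.ncard_image, InjOn.ncard_image, InjOn.ncard_image]
    · omega
    · exact fun s hs t ht h => eq_of_cellOf_eq hs.1.1 ht.1.1 h
    · exact fun s hs t ht h => eq_of_cellOf_eq hs.1 ht.1 h
    · exact fun u hu w hw h => Finset.singleton_injective
        (eq_of_cellOf_eq (singleton_mem_latticeFaces hd hT hu.1)
          (singleton_mem_latticeFaces hd hT hw.1) h)
  refine ⟨C, C', hne, hall, hdisk, ?_, hsv⟩
  have := eulerChar_add_eulerChar hd hT hne hall
  unfold IsMoebius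
  omega

end Outer

/-! ### Counting lattice points -/

/-- The lattice points in the interior of `d·Δ₂`. -/
def innerPoints (d : ℕ) : Set (ℤ × ℤ) := {v | 0 < v.1 ∧ 0 < v.2 ∧ v.1 + v.2 < d}

theorem innerPoints_subset (d : ℕ) : innerPoints d ⊆ latticePoints d :=
  fun _ h => ⟨h.1.le, h.2.1.le, h.2.2.le⟩

theorem innerPoints_finite (d : ℕ) : (innerPoints d).Finite :=
  (latticePoints_finite d).subset (innerPoints_subset d)

theorem mem_innerPoints_iff {d : ℕ} {v : ℤ × ℤ} : v ∈ innerPoints d ↔ tag d v = some v := by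
  rw [tag_eq_some_iff]
  simp [innerPoints]

theorem two_mul_ncard_innerPoints (d : ℕ) : 2 * (innerPoints d).ncard = (d - 1) * (d - 2) := by
  have himg : innerPoints d = (fun x : Σ _ : ℕ, ℕ => ((x.2 : ℤ) + 1, (x.1 : ℤ) - x.2)) ''
      ((Finset.range (d - 1)).sigma fun m => Finset.range m : Finset (Σ _ : ℕ, ℕ)) := by
    ext ⟨i, j⟩
    simp only [innerPoints, mem_ofPred_eq, mem_image, Finset.mem_coe, Finset.mem_sigma,
      Finset.mem_range, Prod.mk.injEq]
    constructor
    · rintro ⟨h1, h2, h3⟩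
      exact ⟨⟨(i + j - 1).toNat, (i - 1).toNat⟩, by dsimp only; omega, by dsimp only; omega,
        by dsimp only; omega⟩
    · rintro ⟨⟨m, n⟩, ⟨h1, h2⟩, h3, h4⟩
      dsimp only at *
      omega
  rw [himg, InjOn.ncard_image, Set.ncard_coe_finset, Finset.card_sigma,
    Finset.sum_congr rfl fun m _ => Finset.card_range m, mul_comm, Finset.sum_range_id_mul_two]
  · rfl
  · rintro ⟨m, n⟩ - ⟨m', n'⟩ - h
    simp only [Prod.mk.injEq] at h
    obtain rfl : n = n' := by omega
    obtain rfl : m = m' := by omega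
    rfl

theorem two_mul_ncard_innerPoints_rat {d : ℕ} (hd : 1 ≤ d) :
    2 * ((innerPoints d).ncard : ℚ) = ((d : ℚ) - 1) * ((d : ℚ) - 2) := by
  obtain ⟨n, rfl⟩ : ∃ n, d = n + 1 := ⟨d - 1, by omega⟩
  have h := two_mul_ncard_innerPoints (n + 1)
  rw [Nat.add_sub_cancel] at h
  rcases n with _ | n
  · simpa using h
  · rw [show n + 1 + 1 - 2 = n by omega] at h
    have h' : (2 : ℚ) * (innerPoints (n + 1 + 1)).ncard = (n + 1) * n := by exact_mod_cast h
    rw [h']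
    push_cast
    ring

theorem quad_eq_one_iff {v : ℤ × ℤ} : quad v = 1 ↔ Even v.1 ∧ Even v.2 := by
  rw [quad, Prod.mk_eq_one, Int.negOnePow_eq_one_iff, Int.negOnePow_eq_one_iff, and_comm]

/-- The interior points of `2k·Δ₂` with two even coordinates are the doubles of those of `k·Δ₂`. -/
theorem ncard_innerPoints_quad_one (k : ℕ) :
    {v ∈ innerPoints (2 * k) | quad v = 1}.ncard = (innerPoints k).ncard := by
  have himg : {v ∈ innerPoints (2 * k) | quad v = 1} =
      (fun v : ℤ × ℤ => (2 * v.1, 2 * v.2)) '' innerPoints k := by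
    ext ⟨i, j⟩
    simp only [innerPoints, quad_eq_one_iff, mem_ofPred_eq, mem_image, Prod.mk.injEq, Prod.exists]
    constructor
    · rintro ⟨⟨h1, h2, h3⟩, ⟨a, rfl⟩, ⟨b, rfl⟩⟩
      exact ⟨a, b, by push_cast at h3; omega, by omega, by omega⟩
    · rintro ⟨a, b, h, rfl, rfl⟩
      push_cast
      exact ⟨by omega, by simp, by simp⟩
  rw [himg, InjOn.ncard_image]
  rintro ⟨a, b⟩ - ⟨a', b'⟩ - h
  simp only [Prod.mk.injEq] at h
  exact Prod.ext (by dsimp only; omega) (by dsimp only; omega)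

/-- The inner side of the boundary loop contains, besides the interior points of `2k·Δ₂`, every
other boundary point; there are `k` of these on each of the three sides. -/
theorem two_mul_ncard_diskPoints {k : ℕ} (hk : 1 ≤ k) :
    2 * (diskPoints (2 * k)).ncard = (2 * k) ^ 2 + 2 := by
  set l : ℕ → ℤ × ℤ := fun m => (0, 2 * m + 1)
  set b : ℕ → ℤ × ℤ := fun m => (2 * m + 1, 0)
  set g : ℕ → ℤ × ℤ := fun m => (2 * m + 1, 2 * k - (2 * m + 1))
  have hdecomp : diskPoints (2 * k) =
      innerPoints (2 * k) ∪ (l '' Iio k ∪ (b '' Iio k ∪ g '' Iio k)) := by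
    ext ⟨i, j⟩
    have hL : (i, j) ∈ l '' Iio k ↔ i = 0 ∧ j % 2 = 1 ∧ 0 < j ∧ j < 2 * k := by
      simp only [l, mem_image, mem_Iio, Prod.mk.injEq]
      constructor
      · rintro ⟨m, h⟩; omega
      · intro h; exact ⟨(j / 2).toNat, by omega⟩
    have hB : (i, j) ∈ b '' Iio k ↔ j = 0 ∧ i % 2 = 1 ∧ 0 < i ∧ i < 2 * k := by
      simp only [b, mem_image, mem_Iio, Prod.mk.injEq]
      constructor
      · rintro ⟨m, h⟩; omega
      · intro h; exact ⟨(i / 2).toNat, by omega⟩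
    have hG : (i, j) ∈ g '' Iio k ↔ i + j = 2 * k ∧ i % 2 = 1 ∧ 0 < i ∧ i < 2 * k := by
      simp only [g, mem_image, mem_Iio, Prod.mk.injEq]
      constructor
      · rintro ⟨m, h⟩; omega
      · intro h; exact ⟨(i / 2).toNat, by omega⟩
    rw [mem_union, mem_union, mem_union, hL, hB, hG]
    simp only [diskPoints, IsCutOff, quad_eq_one_iff, innerPoints, mem_ofPred_eq, Int.even_iff]
    constructor
    · rintro ⟨hA, hc⟩
      rw [tag_eq_none_iff hA] at hc
      obtain ⟨h1, h2, h3⟩ := hA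
      push_cast at *
      omega
    · intro h
      have hA : (i, j) ∈ latticePoints (2 * k) := by
        refine ⟨?_, ?_, ?_⟩ <;> push_cast at * <;> omega
      refine ⟨hA, ?_⟩
      rw [tag_eq_none_iff hA]
      push_cast at *
      omega
  have hfin : (Iio k).Finite := finite_Iio k
  have hcard : (Iio k).ncard = k := by
    rw [← Finset.coe_Iio, Set.ncard_coe_finset, Nat.card_Iio]
  have hl : (l '' Iio k).ncard = k := by
    rw [ncard_image_of_injective, hcard]
    intro m n h
    simpa [l] using h
  have hb : (b '' Iio k).ncard = k := by
    rw [ncard_image_of_injective, hcard]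
    intro m n h
    simpa [b] using h
  have hg : (g '' Iio k).ncard = k := by
    rw [ncard_image_of_injective, hcard]
    intro m n h
    simp only [g, Prod.mk.injEq] at h
    omega
  have hin := two_mul_ncard_innerPoints (2 * k)
  rw [hdecomp, ncard_union_eq ?_ (innerPoints_finite _)
    ((hfin.image _).union ((hfin.image _).union (hfin.image _))),
    ncard_union_eq ?_ (hfin.image _) ((hfin.image _).union (hfin.image _)),
    ncard_union_eq ?_ (hfin.image _) (hfin.image _), hl, hb, hg]
  · obtain ⟨n, rfl⟩ : ∃ n, k = n + 1 := ⟨k - 1, by omega⟩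
    rw [show 2 * (n + 1) - 1 = 2 * n + 1 by omega, show 2 * (n + 1) - 2 = 2 * n by omega] at hin
    rw [mul_add, hin]
    ring
  · rw [Set.disjoint_left]
    rintro _ ⟨m, hm, rfl⟩ ⟨n, hn, h⟩
    simp only [b, g, Prod.mk.injEq, mem_Iio] at *
    omega
  · rw [Set.disjoint_left]
    rintro _ ⟨m, hm, rfl⟩ (⟨n, hn, h⟩ | ⟨n, hn, h⟩)
    · simp only [b, l, Prod.mk.injEq, mem_Iio] at *
      omega
    · simp only [g, l, Prod.mk.injEq, mem_Iio] at *
      omega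
  · rw [Set.disjoint_left]
    rintro ⟨i, j⟩ ⟨h1, h2, h3⟩ (⟨n, hn, h⟩ | ⟨n, hn, h⟩ | ⟨n, hn, h⟩)
    · simp only [l, Prod.mk.injEq, mem_Iio] at *
      omega
    · simp only [b, Prod.mk.injEq, mem_Iio] at *
      omega
    · simp only [g, Prod.mk.injEq, mem_Iio] at *
      push_cast at h3
      omega

/-! ### Arrangements of ovals -/

theorem exists_equiv_empties (k : ℕ) : ∃ _ : Fin k ≃ (OvalScheme.empties k).Ovals,
    ∀ a b, ¬ (OvalScheme.empties k).Inside a b := by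
  induction k with
  | zero => exact ⟨(Equiv.equivOfIsEmpty (Fin 0) Empty), fun a => a.elim⟩
  | succ k ih =>
    obtain ⟨e, he⟩ := ih
    refine ⟨?_, ?_⟩
    · refine (finCongr (Nat.add_comm k 1)).trans (finSumFinEquiv.symm.trans (Equiv.sumCongr ?_ e))
      exact Equiv.ofUnique (Fin 1) (Option Empty)
    · rintro (_ | a) (_ | b)
      · rename_i a b
        rcases a with _ | a
        · exact id
        · exact a.elim
      · exact id
      · exact id
      · exact he a b

/-- A relation without pairs is the nesting relation of ovals outside one another. -/
theorem nonempty_relIso_empties {O : Type*} [Finite O] {R : O → O → Prop} (hR : ∀ x y, ¬ R x y) :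
    Nonempty (R ≃r (OvalScheme.empties (Nat.card O)).Inside) := by
  obtain ⟨e, he⟩ := exists_equiv_empties (Nat.card O)
  exact ⟨⟨(Finite.equivFin O).trans e, fun {x y} =>
    ⟨fun h => absurd h (he _ _), fun h => absurd h (hR x y)⟩⟩⟩

/-- The nesting relation of one oval `o` with the ovals of `S` in its interior, all other pairs of
ovals being outside one another. -/
theorem nonempty_relIso_nest {O : Type*} [Finite O] {R : O → O → Prop} {o : O} {S : Set O}
    (ho : o ∉ S) (hR : ∀ x y, R x y ↔ y = o ∧ x ∈ S) :
    Nonempty (R ≃r (OvalScheme.union (.empties {x | x ≠ o ∧ x ∉ S}.ncard)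
      (.nest (.empties S.ncard))).Inside) := by
  obtain ⟨e, he⟩ := exists_equiv_empties {x | x ≠ o ∧ x ∉ S}.ncard
  obtain ⟨e', he'⟩ := exists_equiv_empties S.ncard
  have f : (OvalScheme.empties {x | x ≠ o ∧ x ∉ S}.ncard).Ovals ≃ {x | x ≠ o ∧ x ∉ S} :=
    e.symm.trans (Finite.equivFinOfCardEq (Nat.card_coe_set_eq _)).symm
  have f' : (OvalScheme.empties S.ncard).Ovals ≃ S :=
    e'.symm.trans (Finite.equivFinOfCardEq (Nat.card_coe_set_eq _)).symm
  set g : (OvalScheme.empties {x | x ≠ o ∧ x ∉ S}.ncard).Ovals ⊕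
      Option (OvalScheme.empties S.ncard).Ovals → O :=
    Sum.elim (fun i => (f i).1) (fun j => j.elim o fun j => (f' j).1) with hg
  have hbij : Function.Bijective g := by
    constructor
    · rintro (i | _ | i) (j | _ | j) h <;> simp only [hg, Sum.elim_inl, Sum.elim_inr,
        Option.elim_none, Option.elim_some] at h
      · rw [f.injective (Subtype.ext h)]
      · exact absurd h (f i).2.1
      · exact absurd (h ▸ (f' j).2) (f i).2.2
      · exact absurd h.symm (f j).2.1
      · rfl
      · exact absurd (h ▸ (f' j).2) ho
      · exact absurd (h ▸ (f' i).2) (f j).2.2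
      · exact absurd (h ▸ (f' i).2) ho
      · rw [f'.injective (Subtype.ext h)]
    · intro x
      by_cases hx : x = o
      · exact ⟨.inr none, hx.symm⟩
      · by_cases hS : x ∈ S
        · exact ⟨.inr (some (f'.symm ⟨x, hS⟩)), by simp [hg]⟩
        · exact ⟨.inl (f.symm ⟨x, hx, hS⟩), by simp [hg]⟩
  refine ⟨RelIso.symm ⟨Equiv.ofBijective g hbij, ?_⟩⟩
  intro x y
  change R (g x) (g y) ↔ _
  rw [hR]
  rcases x with i | _ | i <;> rcases y with j | _ | j
  · exact ⟨fun h => absurd h.2 (f i).2.2, fun h => absurd h (he _ _)⟩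
  · exact ⟨fun h => absurd h.2 (f i).2.2, fun h => h.elim⟩
  · exact ⟨fun h => absurd h.2 (f i).2.2, fun h => h.elim⟩
  · exact ⟨fun h => absurd h.2 ho, fun h => h.elim⟩
  · exact ⟨fun h => absurd h.2 ho, fun h => h.elim⟩
  · exact ⟨fun h => absurd h.2 ho, fun h => h.elim⟩
  · exact ⟨fun h => absurd h.1 (f j).2.1, fun h => h.elim⟩
  · exact ⟨fun _ => trivial, fun _ => ⟨rfl, (f' i).2⟩⟩
  · exact ⟨fun h => absurd (h.1 ▸ (f' j).2) ho, fun h => absurd h (he' _ _)⟩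

/-- The ovals in the interior of an even number of ovals, if `o` contains those in `S`. -/
theorem even_card_iff {O : Type*} {R : O → O → Prop} {o : O} {S : Set O}
    (hR : ∀ x y, R x y ↔ y = o ∧ x ∈ S) (x : O) : Even (Nat.card {y // R x y}) ↔ x ∉ S := by
  by_cases hx : x ∈ S
  · have : Nat.card {y // R x y} = 1 := by
      rw [Nat.card_eq_one_iff_unique]
      exact ⟨⟨fun a b => Subtype.ext (((hR _ _).1 a.2).1.trans ((hR _ _).1 b.2).1.symm)⟩,
        ⟨⟨o, (hR _ _).2 ⟨rfl, hx⟩⟩⟩⟩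
    simp [this, hx]
  · have : IsEmpty {y // R x y} := ⟨fun a => hx ((hR _ _).1 a.2).2⟩
    simp [hx]

variable {d : ℕ} {T : Triangulation d}

/-! ### The real scheme -/

theorem range_loopTag (hd : 1 ≤ d) (hT : T.IsUnimodular) :
    range (loopTag hd hT : Loop T harnackSign → _) = insert none (some '' innerPoints d) := by
  ext l
  constructor
  · rintro ⟨L, rfl⟩
    obtain ⟨v, -, hL⟩ := exists_tag_eq hd hT L
    rw [hL]
    rcases h : tag d v with _ | w
    · exact Or.inl rfl
    · obtain rfl := (tag_eq_some_iff.1 h).1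
      exact Or.inr ⟨v, mem_innerPoints_iff.2 h, rfl⟩
  · rintro (rfl | ⟨v, hv, rfl⟩)
    · obtain ⟨L, hL⟩ := exists_loopTag_eq hd hT (zero_mem_latticePoints d)
      exact ⟨L, hL.trans (tag_zero d)⟩
    · obtain ⟨L, hL⟩ := exists_loopTag_eq hd hT (innerPoints_subset d hv)
      exact ⟨L, hL.trans (mem_innerPoints_iff.1 hv)⟩

theorem mem_innerPoints_of_loopTag (hd : 1 ≤ d) (hT : T.IsUnimodular) {L : Loop T harnackSign}
    {v : ℤ × ℤ} (hL : loopTag hd hT L = some v) : v ∈ innerPoints d := by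
  have h : loopTag hd hT L ∈ insert none (some '' innerPoints d) :=
    range_loopTag hd hT ▸ mem_range_self L
  rw [hL] at h
  simpa using h

theorem finite_range_loopTag (hd : 1 ≤ d) (hT : T.IsUnimodular) :
    (range (loopTag hd hT : Loop T harnackSign → _)).Finite := by
  rw [range_loopTag]
  exact ((innerPoints_finite d).image _).insert _

theorem finite_loop (hd : 1 ≤ d) (hT : T.IsUnimodular) : Finite (Loop T harnackSign) := by
  have := (finite_range_loopTag hd hT).to_subtype
  exact Finite.of_injective_finite_range (loopTag_injective hd hT)

theorem card_loop (hd : 1 ≤ d) (hT : T.IsUnimodular) :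
    Nat.card (Loop T harnackSign) = (innerPoints d).ncard + 1 := by
  rw [← Nat.card_range_of_injective (loopTag_injective hd hT), range_loopTag,
    Nat.card_coe_set_eq, ncard_insert_of_notMem (by simp) ((innerPoints_finite d).image _),
    ncard_image_of_injective _ (Option.some_injective _)]

/-- Among the two sides of an oval, the disk is the one with Euler characteristic `1`. -/
theorem eq_of_isDisk {σ : ℤ × ℤ → ZMod 2} {L : Loop T σ} {C C' D : Side L}
    (hall : ∀ W : Side L, W = C ∨ W = C') (hC' : IsMoebius C') (hD : IsDisk D) : D = C := by
  rcases hall D with h | rfl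
  · exact h
  · rw [IsDisk] at hD
    rw [IsMoebius, hD] at hC'
    exact absurd hC' one_ne_zero

theorem not_isPseudoLine_of_isOval {σ : ℤ × ℤ → ZMod 2} {L : Loop T σ} (h : IsOval L) :
    ¬ IsPseudoLine L := by
  obtain ⟨D, M, hne, -⟩ := h
  intro hL
  have := hL.preconnected.subsingleton_connectedComponent
  exact hne (Subsingleton.elim _ _)

theorem isOval_of_inner (hd : 1 ≤ d) (hT : T.IsUnimodular) {L : Loop T harnackSign} {v : ℤ × ℤ}
    (hL : loopTag hd hT L = some v) : IsOval L := by
  obtain ⟨C, C', h1, h2, h3, h4, -⟩ :=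
    sides_of_inner hd hT hL (innerPoints_subset d (mem_innerPoints_of_loopTag hd hT hL))
  exact ⟨C, C', h1, h2, h3, h4⟩

/-- Every loop crosses an edge at an isolated point with the label of the loop. -/
theorem exists_mem_crossedEdges (hd : 1 ≤ d) (hT : T.IsUnimodular) (L : Loop T harnackSign) :
    ∃ u w, u ≠ w ∧ u ∈ latticePoints d ∧ w ∈ latticePoints d ∧ tag d u = loopTag hd hT L ∧
      cellOf d {u, w} (quad u) ∈ crossedEdges L ∧
      T.IsFace (cellOf d {u} (quad u)) (cellOf d {u, w} (quad u)) ∧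
      T.IsFace (cellOf d {w} (quad u)) (cellOf d {u, w} (quad u)) := by
  obtain ⟨v, hv, hL⟩ := exists_tag_eq hd hT L
  obtain ⟨t, ht, hvt⟩ := exists_triangle_of_vertex hd hT hv
  have hcard : 1 < t.card := by
    have := ht.2
    omega
  obtain ⟨w, hwt, hwv⟩ := Finset.exists_mem_ne hcard v
  have he : {v, w} ∈ T.latticeFaces :=
    latticeFaces_down ht.1 (by simp [Finset.insert_subset_iff, hvt, hwt]) (by simp)
  refine ⟨v, w, hwv.symm, hv, mem_latticePoints_of_mem ht.1 hwt, hL.symm,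
    (mem_crossedEdges_iff hd hT).2 ⟨v, w, he, hwv.symm, rfl, hL.symm⟩, ?_, ?_⟩
  · exact (isFace_cellOf_iff he).2 ⟨{v}, by simp, by simp, rfl⟩
  · exact (isFace_cellOf_iff he).2 ⟨{w}, by simp, by simp, rfl⟩

/-- An oval around a lattice point has a single vertex in its interior, and hence contains no
other loop. -/
theorem not_liesInside_of_inner (hd : 1 ≤ d) (hT : T.IsUnimodular) {P O : Oval T harnackSign}
    {v : ℤ × ℤ} (hO : loopTag hd hT O.1 = some v) : ¬ LiesInside P O := by
  rintro ⟨-, D, hD, hP⟩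
  obtain ⟨C, C', -, hall, -, hC', hside⟩ :=
    sides_of_inner hd hT hO (innerPoints_subset d (mem_innerPoints_of_loopTag hd hT hO))
  obtain rfl := eq_of_isDisk hall hC' hD
  obtain ⟨u, w, huw, hu, hw, -, he, hue, hwe⟩ := exists_mem_crossedEdges hd hT P.1
  have h1 := hP _ he _ ((mem_cells_zero_iff hd hT).2 ⟨u, hu, _, rfl⟩) hue
  have h2 := hP _ he _ ((mem_cells_zero_iff hd hT).2 ⟨w, hw, _, rfl⟩) hwe
  rw [hside, mem_singleton_iff] at h1 h2
  exact huw ((cellOf_singleton_eq_iff hu hw).1 (h1.trans h2.symm)).1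

/-- If `d` is even, the oval along the boundary contains the ovals around the interior points which
are isolated in the positive quadrant. -/
theorem liesInside_iff_of_outer (hd : 1 ≤ d) (hT : T.IsUnimodular) (heven : Even d)
    (hcard : 2 * (diskPoints d).ncard = d ^ 2 + 2) {P O : Oval T harnackSign}
    (hO : loopTag hd hT O.1 = none) :
    LiesInside P O ↔ ∃ v, loopTag hd hT P.1 = some v ∧ quad v = 1 := by
  obtain ⟨C, C', -, hall, hC, hC', hside⟩ := sides_of_outer hd hT heven hcard hO
  constructor
  · rintro ⟨hne, D, hD, hP⟩
    obtain rfl := eq_of_isDisk hall hC' hD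
    obtain ⟨v, w, -, hv, -, hPv, he, hve, -⟩ := exists_mem_crossedEdges hd hT P.1
    rcases htag : loopTag hd hT P.1 with _ | v'
    · exact absurd (Subtype.ext (loopTag_injective hd hT (htag.trans hO.symm))) hne
    · rw [htag] at hPv
      obtain rfl := (tag_eq_some_iff.1 hPv).1
      refine ⟨v, rfl, ?_⟩
      have h1 := hP _ he _ ((mem_cells_zero_iff hd hT).2 ⟨v, hv, _, rfl⟩) hve
      rw [hside] at h1
      obtain ⟨u, hu, h1⟩ := h1
      exact (eq_of_vertexOf_eq hd hT hu.1 hv hPv (Subtype.ext h1)).2.symm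
  · rintro ⟨v, hPv, hq⟩
    refine ⟨?_, C, hC, ?_⟩
    · rintro rfl
      rw [hO] at hPv
      exact absurd hPv (by simp)
    · intro e he x hx hxe
      obtain ⟨u, w, hF, huw, rfl, hu⟩ := (mem_crossedEdges_iff hd hT).1 he
      rw [hPv] at hu
      obtain rfl := (tag_eq_some_iff.1 hu).1
      obtain ⟨s, hs, -, rfl⟩ := (isFace_cellOf_iff hF).1 hxe
      obtain ⟨y, hy, q, hyq⟩ := (mem_cells_zero_iff hd hT).1 hx
      obtain rfl := ((cellOf_eq_iff (fun z hz => mem_latticePoints_of_mem hF (hs hz))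
        (by simpa using hy)).1 hyq).1
      rw [hside, hq]
      refine ⟨y, ⟨hy, fun hcut => ?_⟩, rfl⟩
      obtain rfl | rfl : y = u ∨ y = w := by simpa using hs
      · exact absurd (hu.symm.trans hcut.2) (by simp)
      · exact quad_ne_of_edge hd hT hF huw (hq.trans hcut.1.symm)

theorem isMCurve (hd : 1 ≤ d) (hT : T.IsUnimodular) : IsMCurve T harnackSign := by
  refine ⟨finite_loop hd hT, ?_⟩
  have h := two_mul_ncard_innerPoints_rat hd
  rw [card_loop hd hT]
  push_cast
  linarith

theorem exists_loopTag_eq_none (hd : 1 ≤ d) (hT : T.IsUnimodular) :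
    ∃ L : Loop T harnackSign, loopTag hd hT L = none := by
  obtain ⟨L, hL⟩ := exists_loopTag_eq hd hT (zero_mem_latticePoints d)
  exact ⟨L, hL.trans (tag_zero d)⟩

theorem hasRealScheme_of_even {k : ℕ} {T : Triangulation (2 * k)} (hd : 1 ≤ 2 * k)
    (hT : T.IsUnimodular) : ∃ a b : ℕ,
      (a : ℚ) = 3 / 2 * ((k : ℚ) ^ 2 - k) ∧ (b : ℚ) = 1 / 2 * ((k : ℚ) - 1) * ((k : ℚ) - 2) ∧
      HasRealScheme T harnackSign 0 (.union (.empties a) (.nest (.empties b))) ∧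
      numEvenOvals T harnackSign = a + 1 ∧ numOddOvals T harnackSign = b := by
  have hk : 1 ≤ k := by omega
  have heven : Even (2 * k) := even_two_mul k
  have hcard := two_mul_ncard_diskPoints hk
  have := finite_loop hd hT
  have hoval : ∀ L : Loop T harnackSign, IsOval L := by
    intro L
    rcases hL : loopTag hd hT L with _ | v
    · obtain ⟨C, C', h1, h2, h3, h4, -⟩ := sides_of_outer hd hT heven hcard hL
      exact ⟨C, C', h1, h2, h3, h4⟩
    · exact isOval_of_inner hd hT hL
  obtain ⟨L, hL⟩ := exists_loopTag_eq_none hd hT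
  set o : Oval T harnackSign := ⟨L, hoval L⟩
  set S : Set (Oval T harnackSign) := {P | ∃ v, loopTag hd hT P.1 = some v ∧ quad v = 1} with hS
  have ho : o ∉ S := by
    rintro ⟨v, hv, -⟩
    exact absurd (hL.symm.trans hv) (by simp)
  have hR : ∀ P O : Oval T harnackSign, LiesInside P O ↔ O = o ∧ P ∈ S := by
    intro P O
    rcases hO : loopTag hd hT O.1 with _ | v
    · rw [liesInside_iff_of_outer hd hT heven hcard hO]
      exact (and_iff_right (Subtype.ext (loopTag_injective hd hT (hO.trans hL.symm)))).symm
    · refine iff_of_false (not_liesInside_of_inner hd hT hO) ?_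
      rintro ⟨rfl, -⟩
      exact absurd (hL.symm.trans hO) (by simp)
  have hScard : S.ncard = (innerPoints k).ncard := by
    rw [← ncard_innerPoints_quad_one,
      ← ncard_image_of_injective {v | _ ∧ _} (Option.some_injective _),
      ← ncard_image_of_injective S ((loopTag_injective hd hT).comp Subtype.val_injective)]
    congr 1
    ext l
    constructor
    · rintro ⟨P, ⟨v, hv, hq⟩, rfl⟩
      exact ⟨v, ⟨mem_innerPoints_of_loopTag hd hT hv, hq⟩, hv.symm⟩
    · rintro ⟨v, ⟨hv, hq⟩, rfl⟩
      obtain ⟨M, hM⟩ := exists_loopTag_eq hd hT (innerPoints_subset _ hv)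
      rw [mem_innerPoints_iff.1 hv] at hM
      exact ⟨⟨M, hoval M⟩, ⟨v, hM, hq⟩, hM⟩
  have hSc : Sᶜ.ncard = {x | x ≠ o ∧ x ∉ S}.ncard + 1 := by
    rw [← ncard_insert_of_notMem (a := o) (by simp)]
    congr 1
    ext x
    by_cases hx : x = o <;> simp [hx, ho]
  have htot : S.ncard + Sᶜ.ncard = (innerPoints (2 * k)).ncard + 1 := by
    rw [ncard_add_ncard_compl, Nat.card_congr (Equiv.subtypeUnivEquiv hoval), card_loop hd hT]
  have h1 := two_mul_ncard_innerPoints_rat hk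
  have h2 := two_mul_ncard_innerPoints_rat hd
  refine ⟨{x | x ≠ o ∧ x ∉ S}.ncard, S.ncard, ?_, ?_, ⟨fun L => Or.inl (hoval L), ?_, ?_⟩, ?_, ?_⟩
  · have h3 : (S.ncard : ℚ) + ({x | x ≠ o ∧ x ∉ S}.ncard + 1) =
        (innerPoints (2 * k)).ncard + 1 := by exact_mod_cast hSc ▸ htot
    rw [hScard] at h3
    push_cast at h2
    linarith
  · rw [hScard]
    linarith
  · rw [eq_empty_of_forall_notMem (s := {L : Loop T harnackSign | IsPseudoLine L})
      fun L h => not_isPseudoLine_of_isOval (hoval L) h]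
    simp
  · exact nonempty_relIso_nest ho hR
  · rw [← hSc, numEvenOvals, ← Nat.card_coe_set_eq]
    exact Nat.card_congr (Equiv.subtypeEquivRight fun P => even_card_iff hR P)
  · rw [numOddOvals, ← Nat.card_coe_set_eq]
    exact Nat.card_congr (Equiv.subtypeEquivRight fun P =>
      (not_congr (even_card_iff hR P)).trans not_not)

theorem hasRealScheme_of_odd (hd : 1 ≤ d) (hT : T.IsUnimodular) (hodd : Odd d) : ∃ a : ℕ,
      (a : ℚ) = 1 / 2 * ((d : ℚ) - 1) * ((d : ℚ) - 2) ∧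
      HasRealScheme T harnackSign 1 (.empties a) ∧
      numEvenOvals T harnackSign = a ∧ numOddOvals T harnackSign = 0 := by
  have := finite_loop hd hT
  have hpl : ∀ L : Loop T harnackSign, IsPseudoLine L ↔ loopTag hd hT L = none := by
    refine fun L => ⟨fun h => ?_, fun h => isPseudoLine_of_odd hd hT h hodd⟩
    rcases hL : loopTag hd hT L with _ | v
    · rfl
    · exact absurd h (not_isPseudoLine_of_isOval (isOval_of_inner hd hT hL))
  have hov : ∀ L : Loop T harnackSign, IsOval L ↔ ¬ IsPseudoLine L := by
    refine fun L => ⟨not_isPseudoLine_of_isOval, fun h => ?_⟩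
    rw [hpl] at h
    obtain ⟨v, hv⟩ := Option.ne_none_iff_exists'.1 h
    exact isOval_of_inner hd hT hv
  have hR : ∀ P O : Oval T harnackSign, ¬ LiesInside P O := by
    intro P O
    have hO := (hov O.1).1 O.2
    rw [hpl] at hO
    obtain ⟨v, hv⟩ := Option.ne_none_iff_exists'.1 hO
    exact not_liesInside_of_inner hd hT hv
  obtain ⟨L, hL⟩ := exists_loopTag_eq_none hd hT
  have hset : {L : Loop T harnackSign | IsPseudoLine L} = {L} := by
    ext M
    rw [mem_ofPred_eq, hpl, mem_singleton_iff, ← hL]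
    exact (loopTag_injective hd hT).eq_iff
  have hcompl : {L : Loop T harnackSign | IsOval L} = {L}ᶜ := by
    rw [← hset]
    ext M
    exact hov M
  have hcard : Nat.card (Oval T harnackSign) = (innerPoints d).ncard := by
    have h := ncard_add_ncard_compl ({L} : Set (Loop T harnackSign))
    rw [ncard_singleton, card_loop hd hT, ← hcompl, ← Nat.card_coe_set_eq] at h
    change 1 + Nat.card (Oval T harnackSign) = _ at h
    omega
  have heven : ∀ P : Oval T harnackSign, IsEvenOval P := by
    intro P
    have : IsEmpty {O : Oval T harnackSign // LiesInside P O} := ⟨fun O => hR _ _ O.2⟩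
    rw [IsEvenOval, Nat.card_of_isEmpty]
    exact Even.zero
  have h := two_mul_ncard_innerPoints_rat hd
  refine ⟨Nat.card (Oval T harnackSign), ?_, ⟨fun L => ?_, ?_, nonempty_relIso_empties hR⟩, ?_, ?_⟩
  · rw [hcard]
    linarith
  · rw [hov, or_comm]
    exact em _
  · rw [hset, encard_singleton]
    rfl
  · exact Nat.card_congr (Equiv.subtypeUnivEquiv heven)
  · have : IsEmpty {P : Oval T harnackSign // ¬ IsEvenOval P} := ⟨fun P => P.2 (heven P.1)⟩
    exact Nat.card_of_isEmpty

end TCurve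

theorem proposition3p5 (d : ℕ) (hd : 1 ≤ d) (T : TCurve.Triangulation d) (hT : T.IsUnimodular) :
    TCurve.IsMCurve T TCurve.harnackSign ∧
    (∀ k : ℕ, d = 2 * k → ∃ a b : ℕ,
      (a : ℚ) = 3 / 2 * ((k : ℚ) ^ 2 - k) ∧
      (b : ℚ) = 1 / 2 * ((k : ℚ) - 1) * ((k : ℚ) - 2) ∧
      TCurve.HasRealScheme T TCurve.harnackSign 0
        (.union (.empties a) (.nest (.empties b))) ∧
      TCurve.numEvenOvals T TCurve.harnackSign = a + 1 ∧
      TCurve.numOddOvals T TCurve.harnackSign = b) ∧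
    (Odd d → ∃ a : ℕ,
      (a : ℚ) = 1 / 2 * ((d : ℚ) - 1) * ((d : ℚ) - 2) ∧
      TCurve.HasRealScheme T TCurve.harnackSign 1 (.empties a) ∧
      TCurve.numEvenOvals T TCurve.harnackSign = a ∧
      TCurve.numOddOvals T TCurve.harnackSign = 0) := by
  refine ⟨TCurve.isMCurve hd hT, ?_, TCurve.hasRealScheme_of_odd hd hT⟩
  rintro k rfl
  exact TCurve.hasRealScheme_of_even hd hT
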